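/- **Notation.** Write $\mathbb D=\{x:\|x\|\le 1\}$ for the closed Euclidean unit ball (of $\mathbb R^n$ or $\mathbb R^{2n}$), $A_*=A\setminus\{0\}$, and $\ln^-x=\max(0,-\ln x)$. $X\sim L^n(m,S,\nu)$ means that $X$ is an $n$-dimensional Lévy process (with càdlàg paths) with characteristic triplet $(m,S,\nu)$, i.e. $E e^{i\langle\theta,X(t)\rangle}=e^{t\Psi(\theta)}$ with $$\Psi(\theta)=i\langle m,\theta\rangle-\tfrac12\,\theta S\theta'+\int_{\mathbb R^n_*}\big(e^{i\langle\theta,x\rangle}-1-i\langle\theta,x\rangle 1_{\mathbb D}(x)\big)\,\nu(dx);$$ $\nu$ is called its Lévy measure, and Brownian motion is $BM^n(\mu,\Sigma)=L^n(\mu,\Sigma,0)$. If $\int_{\mathbb D_*}\|x\|\,\nu(dx)<\infty$, the *drift* of $X$ is $m-\int_{\mathbb D_*}x\,\nu(dx)$. $X$ is an $FV^n$-process if almost all of its paths are of locally finite variation; it is *drift-less* if its drift is $0$. A subordinator is a Lévy process with nondecreasing components. For $t\in[0,\infty)^n$ put $t\diamond\mu=(t_1\mu_1,\dots,t_n\mu_n)$,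 $(t\diamond\Sigma)_{kl}=\Sigma_{kl}\min(t_k,t_l)$, and $B(t)=(B_1(t_1),\dots,B_n(t_n))$. A *Thorin measure* is a Borel measure $\mathcal U$ on $[0,\infty)^n_*$ with $\int \min\{1+\ln^-\|u\|,\,1/\|u\|\}\,\mathcal U(du)<\infty$. For $d\in[0,\infty)^n$, a *Thorin subordinator* $T\sim GGC^n_S(d,\mathcal U)$ is a subordinator with $$-\ln E e^{-\langle\lambda,T(t)\rangle}=t\langle d,\lambda\rangle+t\int_{[0,\infty)^n_*}\ln\frac{\|u\|^2+\langle\lambda,u\rangle}{\|u\|^2}\,\mathcal U(du),\qquad t\ge0,\ \lambda\in[0,\infty)^n.$$ Let $T$ be a subordinator with drift $d$ and Lévy measure $\mathcal T$, and let $B\sim BM^n(\mu,\Sigma)$. The law of $(T,B\odot T)$ (weak subordination) is that of the $2n$-dimensional Lévy process $Z=(Z_1,Z_2)\sim L^{2n}((m_1,m_2),\Theta,\mathcal Z)$ with $$m_1=d+\int_{[0,\infty)^n_*} t\,P\big((t,B(t))\in\mathbb D\big)\,\mathcal T(dt),\qquad m_2=d\diamond\mu+\int_{[0,\infty)^n_*}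 E\big[B(t)1_{\mathbb D}(t,B(t))\big]\,\mathcal T(dt),$$ $$\Theta=\begin{pmatrix}0&0\\0&d\diamond\Sigma\end{pmatrix},\qquad \mathcal Z(dt,dx)=1_{[0,\infty)^n_*\times\mathbb R^n}\,P(B(t)\in dx)\,\mathcal T(dt).$$ A Lévy process $Y$ is a (weak) $VGG^n(d,\mu,\Sigma,\mathcal U)$-process if it is equal in law to $B\odot T$, i.e. to the second component $Z_2$, for some $B\sim BM^n(\mu,\Sigma)$ and $T\sim GGC^n_S(d,\mathcal U)$. **Proposition.** Let $d\in[0,\infty)^n$, $\mu\in\mathbb R^n$, let $\Sigma\in\mathbb R^{n\times n}$ be a covariance matrix and $\mathcal U$ an $n$-dimensional Thorin measure. Let $T\sim GGC^n_S(d,\mathcal U)$ and $Y\sim VGG^n(d,\mu,\Sigma,\mathcal U)$, with Lévy measures $\mathcal T$ and $\mathcal Y$, respectively. Suppose $0<q<1$. (i) $\int_{\mathbb D^C}\|u\|^{-q}\,\mathcal U(du)<\infty$ if and only if $\int_{\mathbb D_*}\|t\|^q\,\mathcal T(dt)<\infty$. (ii) If $\int_{\mathbb D^C}\|u\|^{-q}\,\mathcal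 U(du)<\infty$, then $\int_{\mathbb D_*}\|y\|^{2q}\,\mathcal Y(dy)<\infty$. If $\Sigma$ is invertible, the converse also holds. (iii) If $d=0$ and $\int_{\mathbb D^C}\|u\|^{-1/2}\,\mathcal U(du)<\infty$, then $Y$ is a drift-less $FV^n$-process. If, in addition, $\Sigma$ is invertible, then conversely: if $Y$ is an $FV^n$-process, then $d=0$ and $\int_{\mathbb D^C}\|u\|^{-1/2}\,\mathcal U(du)<\infty$ (this converse does not presuppose $d=0$). -/

import Mathlib

open MeasureTheory ProbabilityTheory Filter Topology Set
open scoped NNReal ENNReal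

universe w

noncomputable section

namespace WeakSub

/-! ### Lévy processes and their characteristic triplets -/

section Levy

variable {ι : Type*} [Fintype ι] {Ω : Type*} [MeasurableSpace Ω]

/-- A Lévy process: starts at `0`, has independent and stationary increments, is continuous in
probability, and has càdlàg paths (almost surely). -/
structure IsLevyProcess (P : Measure Ω) (X : ℝ≥0 → Ω → EuclideanSpace ℝ ι) : Prop where
  measurable : ∀ t, Measurable (X t)
  zero : ∀ᵐ ω ∂P, X 0 ω = 0
  indep : HasIndepIncrements X P
  stationary : ∀ s t : ℝ≥0, IdentDistrib (fun ω => X (s + t) ω - X s ω) (X t) P P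
  continuous_prob : ∀ t : ℝ≥0, TendstoInMeasure P X (𝓝 t) (X t)
  cadlag : ∀ᵐ ω ∂P, ∀ t : ℝ≥0,
    ContinuousWithinAt (fun s => X s ω) (Ici t) t ∧
      ∃ l, Tendsto (fun s => X s ω) (𝓝[<] t) (𝓝 l)

/-- A Lévy measure. A Borel measure on `ℝ^ι ∖ {0}` is encoded as a measure on `ℝ^ι` which does
not charge the origin. -/
def IsLevyMeasure (ν : Measure (EuclideanSpace ℝ ι)) : Prop :=
  ν {0} = 0 ∧ ∫⁻ x, ENNReal.ofReal (min (‖x‖ ^ 2) 1) ∂ν < ∞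

/-- `|θ|²_S = θ S θ'`. -/
def quadForm (S : Matrix ι ι ℝ) (θ : EuclideanSpace ℝ ι) : ℝ :=
  ∑ k, ∑ l, θ k * S k l * θ l

open scoped Classical in
/-- The Lévy-Khintchine exponent of the triplet `(m, S, ν)`, with truncation at the closed
Euclidean unit ball. -/
def levyExponent (m : EuclideanSpace ℝ ι) (S : Matrix ι ι ℝ) (ν : Measure (EuclideanSpace ℝ ι))
    (θ : EuclideanSpace ℝ ι) : ℂ :=
  Complex.I * (inner ℝ m θ : ℝ) - (1 / 2 : ℂ) * (quadForm S θ : ℝ) +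
    ∫ x, (Complex.exp (Complex.I * (inner ℝ θ x : ℝ)) - 1 -
      (if ‖x‖ ≤ 1 then Complex.I * (inner ℝ θ x : ℝ) else 0)) ∂ν

/-- `X ∼ L(m, S, ν)`: `X` is a Lévy process with characteristic triplet `(m, S, ν)`. -/
structure IsLevy (P : Measure Ω) (X : ℝ≥0 → Ω → EuclideanSpace ℝ ι)
    (m : EuclideanSpace ℝ ι) (S : Matrix ι ι ℝ) (ν : Measure (EuclideanSpace ℝ ι)) : Prop where
  isLevyProcess : IsLevyProcess P X
  covariance : S.PosSemidef
  levyMeasure : IsLevyMeasure ν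
  charFun_eq : ∀ (t : ℝ≥0) (θ : EuclideanSpace ℝ ι),
    charFun (P.map (X t)) θ = Complex.exp ((t : ℝ) * levyExponent m S ν θ)

/-- `ν` is the Lévy measure of the Lévy process `X`. -/
def HasLevyMeasure (P : Measure Ω) (X : ℝ≥0 → Ω → EuclideanSpace ℝ ι)
    (ν : Measure (EuclideanSpace ℝ ι)) : Prop :=
  ∃ m S, IsLevy P X m S ν

/-- `X ∼ BM(μ, S)`: Brownian motion with drift `μ` and covariance matrix `S`. -/
def IsBrownianMotion (P : Measure Ω) (X : ℝ≥0 → Ω → EuclideanSpace ℝ ι)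
    (μ : EuclideanSpace ℝ ι) (S : Matrix ι ι ℝ) : Prop :=
  IsLevy P X μ S 0

/-- The punctured closed Euclidean unit ball. -/
def puncturedBall (ι : Type*) [Fintype ι] : Set (EuclideanSpace ℝ ι) :=
  Metric.closedBall 0 1 \ {0}

/-- `X` has drift `d` after removing the compensation of small jumps: for some triplet `(m, S, ν)`
of `X` the small jumps are summable and `d = m - ∫_{0 < ‖x‖ ≤ 1} x ν(dx)`. -/
def HasDrift (P : Measure Ω) (X : ℝ≥0 → Ω → EuclideanSpace ℝ ι)
    (d : EuclideanSpace ℝ ι) (ν : Measure (EuclideanSpace ℝ ι)) : Prop :=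
  ∃ m S, IsLevy P X m S ν ∧ IntegrableOn (fun x => x) (puncturedBall ι) ν ∧
    d = m - ∫ x in puncturedBall ι, x ∂ν

/-- Almost all paths of `X` are of locally finite variation. -/
def HasFiniteVariationPaths (P : Measure Ω) (X : ℝ≥0 → Ω → EuclideanSpace ℝ ι) : Prop :=
  ∀ᵐ ω ∂P, LocallyBoundedVariationOn (fun t => X t ω) univ

/-- `X ∼ FV(d, ν)`: a Lévy process with paths of locally finite variation, drift `d` and
Lévy measure `ν`. -/
def IsFV (P : Measure Ω) (X : ℝ≥0 → Ω → EuclideanSpace ℝ ι)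
    (d : EuclideanSpace ℝ ι) (ν : Measure (EuclideanSpace ℝ ι)) : Prop :=
  HasFiniteVariationPaths P X ∧ HasDrift P X d ν

/-- A subordinator: a Lévy process with nondecreasing components. -/
def IsSubordinator (P : Measure Ω) (T : ℝ≥0 → Ω → EuclideanSpace ℝ ι) : Prop :=
  IsLevyProcess P T ∧ ∀ᵐ ω ∂P, ∀ i, Monotone (fun t => T t ω i)

/-- `T ∼ S(d, τ)`: a subordinator with drift `d` and Lévy measure `τ`. -/
def IsSubordinatorWith (P : Measure Ω) (T : ℝ≥0 → Ω → EuclideanSpace ℝ ι)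
    (d : EuclideanSpace ℝ ι) (τ : Measure (EuclideanSpace ℝ ι)) : Prop :=
  IsSubordinator P T ∧ (∀ i, 0 ≤ d i) ∧ HasDrift P T d τ

/-- The punctured nonnegative orthant `[0,∞)^ι ∖ {0}`. -/
def puncturedOrthant (ι : Type*) [Fintype ι] : Set (EuclideanSpace ℝ ι) :=
  {u | (∀ i, 0 ≤ u i) ∧ u ≠ 0}

/-- A Thorin measure: a measure carried by the punctured nonnegative orthant such that
`(1 + ln⁻ ‖u‖) ∧ (1 / ‖u‖)` is integrable. Here `ln⁻ x = max 0 (-ln x)`. -/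
def IsThorinMeasure (U : Measure (EuclideanSpace ℝ ι)) : Prop :=
  U (puncturedOrthant ι)ᶜ = 0 ∧
    ∫⁻ u, ENNReal.ofReal (min (1 + max 0 (-Real.log ‖u‖)) (1 / ‖u‖)) ∂U < ∞

/-- `T ∼ GGC_S(d, U)`: a Thorin subordinator, specified by its Laplace transform. -/
structure IsThorinSubordinator (P : Measure Ω) (T : ℝ≥0 → Ω → EuclideanSpace ℝ ι)
    (d : EuclideanSpace ℝ ι) (U : Measure (EuclideanSpace ℝ ι)) : Prop where
  subordinator : IsSubordinator P T
  drift_nonneg : ∀ i, 0 ≤ d i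
  thorin : IsThorinMeasure U
  laplace : ∀ (t : ℝ≥0) (l : EuclideanSpace ℝ ι), (∀ i, 0 ≤ l i) →
    -Real.log (∫ ω, Real.exp (-(inner ℝ l (T t ω))) ∂P) =
      t * inner ℝ d l +
        t * ∫ u, Real.log ((‖u‖ ^ 2 + inner ℝ l u) / ‖u‖ ^ 2) ∂U

/-- `t ⋄ μ = (t₁ μ₁, …, tₙ μₙ)`. -/
def diamondVec (t μ : EuclideanSpace ℝ ι) : EuclideanSpace ℝ ι :=
  WithLp.toLp 2 fun i => t i * μ i

/-- `(t ⋄ S)ₖₗ = Sₖₗ (tₖ ∧ tₗ)`. -/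
def diamondMat (t : EuclideanSpace ℝ ι) (S : Matrix ι ι ℝ) : Matrix ι ι ℝ :=
  Matrix.of fun k l => S k l * min (t k) (t l)

/-- The process evaluated at a multivariate time point: `B(t) = (B₁(t₁), …, Bₙ(tₙ))`
(meaningful for `t` in the nonnegative orthant). -/
def multiTime (B : ℝ≥0 → Ω → EuclideanSpace ℝ ι) (t : EuclideanSpace ℝ ι) (ω : Ω) :
    EuclideanSpace ℝ ι :=
  WithLp.toLp 2 fun i => B (t i).toNNReal ω i

/-- The vector `(t, x)` of `ℝ^{2n}`, with its Euclidean norm. -/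
def pair (t x : EuclideanSpace ℝ ι) : EuclideanSpace ℝ (ι ⊕ ι) :=
  WithLp.toLp 2 (Sum.elim (fun i => t i) (fun i => x i))

/-- The second component `Z₂` of a process `Z = (Z₁, Z₂)` in `ℝ^{2n}`. -/
def second (Z : ℝ≥0 → Ω → EuclideanSpace ℝ (ι ⊕ ι)) (t : ℝ≥0) (ω : Ω) : EuclideanSpace ℝ ι :=
  WithLp.toLp 2 fun i => Z t ω (Sum.inr i)

end Levy

/-! ### Weak subordination of Brownian motion -/

section Subordination

variable {ι : Type*} [Fintype ι]
  {ΩB : Type*} [MeasurableSpace ΩB] {ΩZ : Type*} [MeasurableSpace ΩZ]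
  {ΩT : Type*} [MeasurableSpace ΩT]

/-- First half of the location parameter of `(T, B ⊙ T)`:
`d + ∫ t P((t, B(t)) ∈ 𝔻) τ(dt)`. -/
def weakMean₁ (PB : Measure ΩB) (B : ℝ≥0 → ΩB → EuclideanSpace ℝ ι)
    (d : EuclideanSpace ℝ ι) (τ : Measure (EuclideanSpace ℝ ι)) : EuclideanSpace ℝ ι :=
  d + ∫ t in puncturedOrthant ι, PB.real {ω | ‖pair t (multiTime B t ω)‖ ≤ 1} • t ∂τ

/-- Second half of the location parameter of `(T, B ⊙ T)`:
`d ⋄ μ + ∫ E[B(t) 1_𝔻(t, B(t))] τ(dt)`. -/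
def weakMean₂ (PB : Measure ΩB) (B : ℝ≥0 → ΩB → EuclideanSpace ℝ ι)
    (μ d : EuclideanSpace ℝ ι) (τ : Measure (EuclideanSpace ℝ ι)) : EuclideanSpace ℝ ι :=
  diamondVec d μ + ∫ t in puncturedOrthant ι,
    (∫ ω in {ω | ‖pair t (multiTime B t ω)‖ ≤ 1}, multiTime B t ω ∂PB) ∂τ

/-- `Z` is equal in law to `(T, B ⊙ T)`: the subordinator `T` subordinating the Brownian motion
`B ∼ BM(μ, S)` in the weak sense. Here `T ∼ S(d, τ)`, and `Z` is the Lévy process in `ℝ^{2n}` with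
Gaussian covariance `diag(0, d ⋄ S)` and Lévy measure `P(B(t) ∈ dx) τ(dt)`. (The terms of weak
subordination that come from the Lévy measure of the subordinate vanish for Brownian motion.) -/
def IsWeakSubordination (PZ : Measure ΩZ) (Z : ℝ≥0 → ΩZ → EuclideanSpace ℝ (ι ⊕ ι))
    (PT : Measure ΩT) (T : ℝ≥0 → ΩT → EuclideanSpace ℝ ι)
    (PB : Measure ΩB) (B : ℝ≥0 → ΩB → EuclideanSpace ℝ ι)
    (μ : EuclideanSpace ℝ ι) (S : Matrix ι ι ℝ) : Prop :=
  IsBrownianMotion PB B μ S ∧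
  ∃ (d : EuclideanSpace ℝ ι) (τ : Measure (EuclideanSpace ℝ ι)),
    IsSubordinatorWith PT T d τ ∧
    ∃ ζ : Measure (EuclideanSpace ℝ (ι ⊕ ι)),
      (∀ A, MeasurableSet A → ζ A =
        ∫⁻ t in puncturedOrthant ι, PB {ω | pair t (multiTime B t ω) ∈ A} ∂τ) ∧
      IsLevy PZ Z (pair (weakMean₁ PB B d τ) (weakMean₂ PB B μ d τ))
        (Matrix.fromBlocks 0 0 0 (diamondMat d S)) ζ

end Subordination

/-- `Y ∼ VGG(d, μ, S, U)`: a Lévy process equal in law (as a process) to `B ⊙ T`, the second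
component of `(T, B ⊙ T)`, with `B ∼ BM(μ, S)` and `T ∼ GGC_S(d, U)`. -/
def IsVGG {ι : Type*} [Fintype ι] {Ω : Type*} [MeasurableSpace Ω]
    (P : Measure Ω) (Y : ℝ≥0 → Ω → EuclideanSpace ℝ ι)
    (d μ : EuclideanSpace ℝ ι) (S : Matrix ι ι ℝ) (U : Measure (EuclideanSpace ℝ ι)) : Prop :=
  IsLevyProcess P Y ∧
  ∃ (ΩB ΩT ΩZ : Type w) (_ : MeasurableSpace ΩB) (_ : MeasurableSpace ΩT)
    (_ : MeasurableSpace ΩZ)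
    (PB : Measure ΩB) (PT : Measure ΩT) (PZ : Measure ΩZ)
    (B : ℝ≥0 → ΩB → EuclideanSpace ℝ ι) (T : ℝ≥0 → ΩT → EuclideanSpace ℝ ι)
    (Z : ℝ≥0 → ΩZ → EuclideanSpace ℝ (ι ⊕ ι)),
    IsProbabilityMeasure PB ∧ IsProbabilityMeasure PT ∧ IsProbabilityMeasure PZ ∧
    IsThorinSubordinator PT T d U ∧
    IsWeakSubordination PZ Z PT T PB B μ S ∧
    IdentDistrib (fun ω t => Y t ω) (fun ω t => second Z t ω) P PZ

/-- Finiteness of `∫_{‖u‖ > 1} U(du) / ‖u‖ ^ q`. -/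
def ThorinTailFinite {ι : Type*} [Fintype ι] (U : Measure (EuclideanSpace ℝ ι)) (q : ℝ) : Prop :=
  ∫⁻ u in (Metric.closedBall 0 1)ᶜ, ENNReal.ofReal (1 / ‖u‖ ^ q) ∂U < ∞

/-- Finiteness of `∫_{0 < ‖x‖ ≤ 1} ‖x‖ ^ p ν(dx)`. -/
def SmallJumpsFinite {ι : Type*} [Fintype ι] (ν : Measure (EuclideanSpace ℝ ι)) (p : ℝ) : Prop :=
  ∫⁻ x in puncturedBall ι, ENNReal.ofReal (‖x‖ ^ p) ∂ν < ∞

end WeakSub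

end

/-!
The Laplace transform of `T` identifies its Lévy measure: it is the image of `U ⊗ e^{-r}/r dr`
under `(u, r) ↦ r u / ‖u‖²`, because `∫ (1 - e^{-ar}) e^{-r}/r dr = log (1 + a)`. Hence the small
jump moment of order `q` of `T` is a `U`-integral of truncated gamma moments, which decay like
`‖u‖^{-q}` at infinity; this is (i).

The Lévy measure of `Y` is the mixture of the laws of `B(t)` over the Lévy measure of `T`, and for
small `t` the truncated moment `E ‖B(t)‖^{2q}` is of order `‖t‖^q`, the lower bound coming from the
variances `t_k Σ_kk` of the coordinates of `B(t)`; this is (ii).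

For (iii), a Lévy process has paths of locally finite variation iff it has no Gaussian part and
summable small jumps. Both directions rest on the sums of the absolute increments of a coordinate
over dyadic grids: averaging `cos (s x)` over a standard Cauchy variable `s` gives `e^{-|x|}`, so
that `E (1 - e^{-|x|})` for an increment `x` can be read off the Lévy exponent. The drift is then
computed from the location parameter of weak subordination.
-/

noncomputable section

namespace WeakSub

section LevyKhintchine

variable {ι : Type*} [Fintype ι] {m m' : EuclideanSpace ℝ ι} {S S' : Matrix ι ι ℝ}
  {ν ν' : Measure (EuclideanSpace ℝ ι)}

/-- The integrand in the Lévy-Khintchine formula. -/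
def levyIntegrand (θ x : EuclideanSpace ℝ ι) : ℂ :=
  Complex.exp (Complex.I * (inner ℝ θ x : ℝ)) - 1 -
    (if ‖x‖ ≤ 1 then Complex.I * (inner ℝ θ x : ℝ) else 0)

lemma levyExponent_eq (m : EuclideanSpace ℝ ι) (S : Matrix ι ι ℝ)
    (ν : Measure (EuclideanSpace ℝ ι)) (θ : EuclideanSpace ℝ ι) :
    levyExponent m S ν θ = Complex.I * (inner ℝ m θ : ℝ) - (1 / 2 : ℂ) * (quadForm S θ : ℝ) +
      ∫ x, levyIntegrand θ x ∂ν := rfl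

lemma norm_cexp_I_sub_one_sub_le (y : ℝ) :
    ‖Complex.exp (Complex.I * y) - 1 - Complex.I * y‖ ≤ 3 * y ^ 2 := by
  rcases le_or_gt |y| 1 with hy | hy
  · have h := Complex.norm_exp_sub_one_sub_id_le (x := Complex.I * y) (by simpa using hy)
    simp only [norm_mul, Complex.norm_I, one_mul, Complex.norm_real, Real.norm_eq_abs,
      sq_abs] at h
    nlinarith [sq_nonneg y]
  · have hexp : ‖Complex.exp (Complex.I * y) - 1‖ ≤ ‖y‖ :=
      Real.norm_exp_I_mul_ofReal_sub_one_le
    have htri := norm_sub_le (Complex.exp (Complex.I * y) - 1) (Complex.I * y)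
    simp only [norm_mul, Complex.norm_I, one_mul, Complex.norm_real, Real.norm_eq_abs]
      at hexp htri
    nlinarith [sq_abs y]

lemma norm_cexp_I_sub_one_le_two (y : ℝ) : ‖Complex.exp (Complex.I * y) - 1‖ ≤ 2 := by
  refine (norm_sub_le _ _).trans ?_
  rw [Complex.norm_exp_I_mul_ofReal]
  norm_num

lemma re_cexp_I_mul_sub_one (y : ℝ) :
    (Complex.exp (Complex.I * y) - 1).re = Real.cos y - 1 := by
  rw [mul_comm, Complex.sub_re, Complex.exp_ofReal_mul_I_re, Complex.one_re]

lemma one_sub_cos_nonneg (y : ℝ) : 0 ≤ 1 - Real.cos y := sub_nonneg.2 (Real.cos_le_one y)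

lemma norm_levyIntegrand_le (θ x : EuclideanSpace ℝ ι) :
    ‖levyIntegrand θ x‖ ≤ (3 * ‖θ‖ ^ 2 + 2) * min (‖x‖ ^ 2) 1 := by
  unfold levyIntegrand
  split_ifs with hx
  · have hexp := norm_cexp_I_sub_one_sub_le (inner ℝ θ x)
    have hinner : (inner ℝ θ x) ^ 2 ≤ (‖θ‖ * ‖x‖) ^ 2 :=
      sq_le_sq.2 ((abs_real_inner_le_norm θ x).trans (le_abs_self _))
    rw [min_eq_left (by nlinarith [norm_nonneg x])]
    nlinarith [sq_nonneg ‖x‖]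
  · rw [sub_zero, min_eq_right (by nlinarith [norm_nonneg x])]
    nlinarith [norm_cexp_I_sub_one_le_two (inner ℝ θ x), sq_nonneg ‖θ‖]

@[fun_prop]
lemma measurable_levyIntegrand (θ : EuclideanSpace ℝ ι) : Measurable (levyIntegrand θ) := by
  unfold levyIntegrand
  have hball : MeasurableSet {x : EuclideanSpace ℝ ι | ‖x‖ ≤ 1} :=
    measurableSet_le measurable_norm measurable_const
  exact Measurable.sub (by fun_prop) (Measurable.ite hball (by fun_prop) (by fun_prop))

lemma measurableSet_puncturedBall : MeasurableSet (puncturedBall ι) :=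
  measurableSet_closedBall.diff (measurableSet_singleton 0)

lemma re_levyIntegrand (θ x : EuclideanSpace ℝ ι) :
    (levyIntegrand θ x).re = Real.cos (inner ℝ θ x) - 1 := by
  rw [levyIntegrand, Complex.sub_re, re_cexp_I_mul_sub_one]
  split_ifs <;> simp

namespace IsLevyMeasure

lemma integrable_min (hν : IsLevyMeasure ν) : Integrable (fun x => min (‖x‖ ^ 2) 1) ν := by
  refine ⟨by fun_prop, ?_⟩
  rw [hasFiniteIntegral_iff_ofReal (ae_of_all _ fun x => by positivity)]
  exact hν.2

lemma integrable_levyIntegrand (hν : IsLevyMeasure ν) (θ : EuclideanSpace ℝ ι) :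
    Integrable (levyIntegrand θ) ν :=
  Integrable.mono' (hν.integrable_min.const_mul _) (by fun_prop)
    (ae_of_all _ (norm_levyIntegrand_le θ))

lemma integrable_one_sub_cos (hν : IsLevyMeasure ν) (θ : EuclideanSpace ℝ ι) :
    Integrable (fun x => 1 - Real.cos (inner ℝ θ x)) ν := by
  refine (hν.integrable_levyIntegrand θ).re.neg.congr (ae_of_all _ fun x => ?_)
  simp [re_levyIntegrand]

lemma neg_re_levyExponent (hν : IsLevyMeasure ν) (m : EuclideanSpace ℝ ι) (S : Matrix ι ι ℝ)
    (θ : EuclideanSpace ℝ ι) :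
    -(levyExponent m S ν θ).re =
      1 / 2 * quadForm S θ + ∫ x, (1 - Real.cos (inner ℝ θ x)) ∂ν := by
  have hre : (∫ x, levyIntegrand θ x ∂ν).re = ∫ x, (levyIntegrand θ x).re ∂ν :=
    (integral_re (hν.integrable_levyIntegrand θ)).symm
  have hcos : ∫ x, (1 - Real.cos (inner ℝ θ x)) ∂ν = -∫ x, (levyIntegrand θ x).re ∂ν := by
    rw [← integral_neg]
    simp_rw [re_levyIntegrand, neg_sub]
  rw [hcos, ← hre, levyExponent_eq]
  simp [add_comm]

end IsLevyMeasure

lemma quadForm_nonneg (hS : S.PosSemidef) (θ : EuclideanSpace ℝ ι) : 0 ≤ quadForm S θ := by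
  have h := hS.dotProduct_mulVec_nonneg (fun i => θ i)
  simpa [quadForm, dotProduct, Matrix.mulVec, Finset.mul_sum, mul_assoc] using h

lemma quadForm_parallelogram (S : Matrix ι ι ℝ) (θ a : EuclideanSpace ℝ ι) :
    quadForm S (θ + a) + quadForm S (θ - a) = 2 * quadForm S θ + 2 * quadForm S a := by
  simp only [quadForm, Finset.mul_sum, ← Finset.sum_add_distrib]
  refine Finset.sum_congr rfl fun k _ => Finset.sum_congr rfl fun l _ => ?_
  simp only [PiLp.add_apply, PiLp.sub_apply]
  ring

lemma levyIntegrand_second_difference (θ a x : EuclideanSpace ℝ ι) :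
    levyIntegrand θ x - (levyIntegrand (θ + a) x + levyIntegrand (θ - a) x) / 2 =
      Complex.exp ((inner ℝ x θ : ℝ) * Complex.I) * ((1 - Real.cos (inner ℝ a x) : ℝ) : ℂ) := by
  rw [real_inner_comm θ x]
  simp only [levyIntegrand, inner_add_left, inner_sub_left]
  push_cast
  rw [Complex.cos, mul_add, mul_sub, Complex.exp_add, sub_eq_add_neg (Complex.I * _),
    Complex.exp_add, mul_comm Complex.I, mul_comm Complex.I, neg_mul]
  split_ifs <;> ring

lemma levyExponent_second_difference (hν : IsLevyMeasure ν) (m : EuclideanSpace ℝ ι)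
    (S : Matrix ι ι ℝ) (θ a : EuclideanSpace ℝ ι) :
    levyExponent m S ν θ - (levyExponent m S ν (θ + a) + levyExponent m S ν (θ - a)) / 2 =
      (1 / 2 * quadForm S a : ℝ) + ∫ x, Complex.exp ((inner ℝ x θ : ℝ) * Complex.I) *
        ((1 - Real.cos (inner ℝ a x) : ℝ) : ℂ) ∂ν := by
  have hi := hν.integrable_levyIntegrand
  have hquad : ((quadForm S (θ + a) : ℝ) : ℂ) + (quadForm S (θ - a) : ℝ) =
      2 * (quadForm S θ : ℝ) + 2 * (quadForm S a : ℝ) := by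
    exact_mod_cast quadForm_parallelogram S θ a
  simp_rw [← levyIntegrand_second_difference θ a]
  have hadd : Integrable (fun x => levyIntegrand (θ + a) x + levyIntegrand (θ - a) x) ν :=
    (hi _).add (hi _)
  rw [integral_sub (hi _) (hadd.div_const 2), integral_div, integral_add (hi _) (hi _)]
  simp only [levyExponent_eq, inner_add_right, inner_sub_right]
  push_cast
  linear_combination 1 / 4 * hquad

/-- The finite measure `(1 - cos ⟨a, x⟩) ν(dx) + ½ quadForm S a δ₀`, whose characteristic function
is a second difference of the Lévy exponent. -/
def secondDifferenceMeasure (S : Matrix ι ι ℝ) (ν : Measure (EuclideanSpace ℝ ι))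
    (a : EuclideanSpace ℝ ι) : Measure (EuclideanSpace ℝ ι) :=
  ν.withDensity (fun x => ENNReal.ofReal (1 - Real.cos (inner ℝ a x))) +
    ENNReal.ofReal (1 / 2 * quadForm S a) • Measure.dirac 0

lemma isFiniteMeasure_secondDifferenceMeasure (S : Matrix ι ι ℝ) (hν : IsLevyMeasure ν)
    (a : EuclideanSpace ℝ ι) : IsFiniteMeasure (secondDifferenceMeasure S ν a) := by
  have hdens : IsFiniteMeasure
      (ν.withDensity (fun x => ENNReal.ofReal (1 - Real.cos (inner ℝ a x)))) :=
    isFiniteMeasure_withDensity ((hasFiniteIntegral_iff_ofReal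
      (ae_of_all _ fun x => one_sub_cos_nonneg _)).1 (hν.integrable_one_sub_cos a).2).ne
  have hdirac : IsFiniteMeasure (ENNReal.ofReal (1 / 2 * quadForm S a) •
      (Measure.dirac 0 : Measure (EuclideanSpace ℝ ι))) :=
    Measure.smul_finite _ ENNReal.ofReal_ne_top
  unfold secondDifferenceMeasure
  infer_instance

lemma charFun_secondDifferenceMeasure (hS : ∀ a, 0 ≤ quadForm S a) (hν : IsLevyMeasure ν)
    (m a θ : EuclideanSpace ℝ ι) :
    charFun (secondDifferenceMeasure S ν a) θ =
      levyExponent m S ν θ - (levyExponent m S ν (θ + a) + levyExponent m S ν (θ - a)) / 2 := by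
  have hfin := isFiniteMeasure_secondDifferenceMeasure S hν a
  have hint : Integrable (fun x => Complex.exp ((inner ℝ x θ : ℝ) * Complex.I))
      (secondDifferenceMeasure S ν a) :=
    Integrable.of_bound (by fun_prop) 1
      (ae_of_all _ fun x => (Complex.norm_exp_ofReal_mul_I _).le)
  rw [secondDifferenceMeasure] at hint
  rw [levyExponent_second_difference hν, charFun_apply, secondDifferenceMeasure,
    integral_add_measure hint.left_of_add_measure hint.right_of_add_measure,
    integral_smul_measure, integral_dirac, add_comm]
  congr 1
  · simp [ENNReal.toReal_ofReal, hS a]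
  · rw [integral_withDensity_eq_integral_toReal_smul (by fun_prop) (by simp)]
    refine integral_congr_ae (ae_of_all _ fun x => ?_)
    simp only
    rw [ENNReal.toReal_ofReal (one_sub_cos_nonneg _), Complex.real_smul, mul_comm]

lemma restrict_secondDifferenceMeasure (S : Matrix ι ι ℝ) (hν : ν {0} = 0)
    (a : EuclideanSpace ℝ ι) :
    (secondDifferenceMeasure S ν a).restrict {0}ᶜ =
      ν.withDensity (fun x => ENNReal.ofReal (1 - Real.cos (inner ℝ a x))) := by
  have hae : ∀ᵐ x ∂ν, x ∈ ({0}ᶜ : Set (EuclideanSpace ℝ ι)) := compl_mem_ae_iff.2 hν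
  rw [secondDifferenceMeasure, Measure.restrict_add, Measure.restrict_smul,
    restrict_dirac' (measurableSet_singleton 0).compl, if_neg (by simp), smul_zero,
    add_zero, restrict_withDensity (measurableSet_singleton 0).compl,
    Measure.restrict_eq_self_of_ae_mem hae]

lemma eq_zero_of_cos_eq_one {y : ℝ} (h : Real.cos y = 1) (h' : Real.cos (√2 * y) = 1) :
    y = 0 := by
  obtain ⟨p, rfl⟩ := (Real.cos_eq_one_iff _).1 h
  obtain ⟨r, hr⟩ := (Real.cos_eq_one_iff _).1 h'
  by_contra hne
  have hp : (p : ℝ) ≠ 0 := left_ne_zero_of_mul hne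
  refine irrational_sqrt_two ⟨(r : ℚ) / p, ?_⟩
  push_cast
  rw [div_eq_iff hp]
  exact mul_right_cancel₀ (right_ne_zero_of_mul hne) (hr.trans (mul_assoc _ _ _).symm)

open scoped Classical in
/-- A weight that vanishes only at the origin. The two frequencies `1` and `√2` per coordinate are
incommensurable, so that their cosines equal `1` simultaneously only at `0`. -/
def cosineWeight (x : EuclideanSpace ℝ ι) : ℝ≥0∞ :=
  ∑ k : ι, (ENNReal.ofReal (1 - Real.cos (inner ℝ (EuclideanSpace.single k (1 : ℝ)) x)) +
    ENNReal.ofReal (1 - Real.cos (inner ℝ (EuclideanSpace.single k (√2)) x)))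

lemma measurable_cosineWeight : Measurable (cosineWeight (ι := ι)) := by
  unfold cosineWeight
  fun_prop

lemma cosineWeight_ne_top (x : EuclideanSpace ℝ ι) : cosineWeight x ≠ ∞ := by
  simp [cosineWeight]

lemma cosineWeight_ne_zero {x : EuclideanSpace ℝ ι} (hx : x ≠ 0) : cosineWeight x ≠ 0 := by
  refine fun hw => hx (PiLp.ext fun k => ?_)
  have hk := Finset.sum_eq_zero_iff.1 hw k (Finset.mem_univ k)
  simp only [EuclideanSpace.inner_single_left, add_eq_zero, ENNReal.ofReal_eq_zero, conj_trivial,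
    one_mul] at hk
  exact eq_zero_of_cos_eq_one (le_antisymm (Real.cos_le_one _) (by linarith [hk.1]))
    (le_antisymm (Real.cos_le_one _) (by linarith [hk.2]))

lemma eq_of_withDensity_one_sub_cos_eq (hν : ν {0} = 0) (hν' : ν' {0} = 0)
    (h : ∀ a, ν.withDensity (fun x => ENNReal.ofReal (1 - Real.cos (inner ℝ a x))) =
      ν'.withDensity (fun x => ENNReal.ofReal (1 - Real.cos (inner ℝ a x)))) : ν = ν' := by
  have hset : ∀ a A, MeasurableSet A →
      ∫⁻ x in A, ENNReal.ofReal (1 - Real.cos (inner ℝ a x)) ∂ν =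
        ∫⁻ x in A, ENNReal.ofReal (1 - Real.cos (inner ℝ a x)) ∂ν' := fun a A hA => by
    rw [← withDensity_apply _ hA, ← withDensity_apply _ hA, h]
  have hweight : ν.withDensity cosineWeight = ν'.withDensity cosineWeight := by
    ext A hA
    rw [withDensity_apply _ hA, withDensity_apply _ hA]
    unfold cosineWeight
    rw [lintegral_finsetSum _ (by fun_prop), lintegral_finsetSum _ (by fun_prop)]
    refine Finset.sum_congr rfl fun k _ => ?_
    rw [lintegral_add_left (by fun_prop), lintegral_add_left (by fun_prop), hset _ _ hA,
      hset _ _ hA]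
  have hrecover : ∀ {ρ : Measure (EuclideanSpace ℝ ι)}, ρ {0} = 0 →
      (ρ.withDensity cosineWeight).withDensity cosineWeight⁻¹ = ρ := fun {ρ} hρ => by
    have hae : ∀ᵐ x ∂ρ, x ∈ ({0}ᶜ : Set (EuclideanSpace ℝ ι)) := compl_mem_ae_iff.2 hρ
    exact withDensity_inv_same measurable_cosineWeight
      (hae.mono fun x hx => cosineWeight_ne_zero hx) (ae_of_all _ cosineWeight_ne_top)
  rw [← hrecover hν, hweight, hrecover hν']

theorem levyMeasure_unique (hS : ∀ a, 0 ≤ quadForm S a) (hS' : ∀ a, 0 ≤ quadForm S' a)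
    (hν : IsLevyMeasure ν) (hν' : IsLevyMeasure ν')
    (h : ∀ θ, levyExponent m S ν θ = levyExponent m' S' ν' θ) : ν = ν' := by
  refine eq_of_withDensity_one_sub_cos_eq hν.1 hν'.1 fun a => ?_
  have hfin := isFiniteMeasure_secondDifferenceMeasure S hν a
  have hfin' := isFiniteMeasure_secondDifferenceMeasure S' hν' a
  rw [← restrict_secondDifferenceMeasure S hν.1, ← restrict_secondDifferenceMeasure S' hν'.1]
  congr 1
  refine Measure.ext_of_charFun (funext fun θ => ?_)
  simp only [charFun_secondDifferenceMeasure hS hν m, charFun_secondDifferenceMeasure hS' hν' m', h]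

theorem levyTriplet_unique (hS : ∀ a, 0 ≤ quadForm S a) (hS' : ∀ a, 0 ≤ quadForm S' a)
    (hν : IsLevyMeasure ν) (hν' : IsLevyMeasure ν')
    (h : ∀ θ, levyExponent m S ν θ = levyExponent m' S' ν' θ) :
    m = m' ∧ (∀ a, quadForm S a = quadForm S' a) ∧ ν = ν' := by
  obtain rfl := levyMeasure_unique hS hS' hν hν' h
  have hquad : ∀ a, quadForm S a = quadForm S' a := fun a => by
    have hdiff := levyExponent_second_difference hν m S 0 a
    rw [h, h, h, levyExponent_second_difference hν m' S' 0 a] at hdiff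
    have hhalf : 1 / 2 * quadForm S' a = 1 / 2 * quadForm S a := by
      exact_mod_cast add_right_cancel hdiff
    linarith
  refine ⟨ext_inner_right ℝ fun θ => ?_, hquad, rfl⟩
  have hθ := h θ
  rw [levyExponent_eq, levyExponent_eq, hquad θ] at hθ
  exact_mod_cast mul_left_cancel₀ Complex.I_ne_zero (sub_left_injective (add_right_cancel hθ))

lemma eq_of_forall_cexp_mul_eq {z w : ℂ}
    (h : ∀ t : ℝ≥0, Complex.exp ((t : ℝ) * z) = Complex.exp ((t : ℝ) * w)) : z = w := by
  by_contra hne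
  have hpos : 0 < ‖z - w‖ := norm_pos_iff.2 (sub_ne_zero.2 hne)
  -- At this time `t * (z - w)` has norm `1`, too small for a nonzero multiple of `2 * π * I`.
  have hexp := h (Real.toNNReal ‖z - w‖⁻¹)
  rw [Real.coe_toNNReal _ (by positivity), ← div_eq_one_iff_eq (Complex.exp_ne_zero _),
    ← Complex.exp_sub, ← mul_sub, Complex.exp_eq_one_iff] at hexp
  obtain ⟨n, hn⟩ := hexp
  have hnorm := congrArg norm hn
  simp only [norm_mul, Complex.norm_real, norm_inv, abs_of_pos hpos, Complex.norm_I, mul_one,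
    inv_mul_cancel₀ hpos.ne', Complex.norm_intCast, Real.norm_eq_abs, Complex.norm_ofNat,
    abs_of_pos Real.pi_pos] at hnorm
  rcases eq_or_ne n 0 with rfl | hn0
  · simp at hnorm
  · have habs : (1 : ℝ) ≤ |(n : ℝ)| := by exact_mod_cast Int.one_le_abs hn0
    nlinarith [Real.pi_gt_three]

theorem IsLevy.triplet_unique {Ω : Type*} [MeasurableSpace Ω] {P : Measure Ω}
    {X : ℝ≥0 → Ω → EuclideanSpace ℝ ι} (hX : IsLevy P X m S ν) (hS' : ∀ a, 0 ≤ quadForm S' a)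
    (hν' : IsLevyMeasure ν')
    (h : ∀ (t : ℝ≥0) θ, charFun (P.map (X t)) θ =
      Complex.exp ((t : ℝ) * levyExponent m' S' ν' θ)) :
    m = m' ∧ (∀ a, quadForm S a = quadForm S' a) ∧ ν = ν' :=
  levyTriplet_unique (quadForm_nonneg hX.covariance) hS' hX.levyMeasure hν' fun θ =>
    eq_of_forall_cexp_mul_eq fun t => (hX.charFun_eq t θ).symm.trans (h t θ)

lemma ite_norm_le_one_eq_indicator_puncturedBall (θ x : EuclideanSpace ℝ ι) :
    (if ‖x‖ ≤ 1 then Complex.I * (inner ℝ θ x : ℝ) else 0) =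
      (puncturedBall ι).indicator (fun x => Complex.I * ((inner ℝ θ x : ℝ) : ℂ)) x := by
  rcases eq_or_ne x 0 with rfl | hx
  · simp [puncturedBall]
  · simp [puncturedBall, indicator, hx]

lemma levyExponent_add_integral_puncturedBall (hν : IsLevyMeasure ν)
    (hint : IntegrableOn (fun x => x) (puncturedBall ι) ν) (d : EuclideanSpace ℝ ι)
    (S : Matrix ι ι ℝ) (θ : EuclideanSpace ℝ ι) :
    levyExponent (d + ∫ x in puncturedBall ι, x ∂ν) S ν θ =
      Complex.I * (inner ℝ d θ : ℝ) - (1 / 2 : ℂ) * (quadForm S θ : ℝ) +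
        ∫ x, (Complex.exp (Complex.I * (inner ℝ θ x : ℝ)) - 1) ∂ν := by
  have hcomp : Integrable ((puncturedBall ι).indicator
      fun x => Complex.I * (inner ℝ θ x : ℝ)) ν := by
    rw [integrable_indicator_iff measurableSet_puncturedBall]
    exact ((hint.const_inner θ).ofReal).const_mul _
  have hsplit : ∀ x, Complex.exp (Complex.I * (inner ℝ θ x : ℝ)) - 1 = levyIntegrand θ x +
      (puncturedBall ι).indicator (fun x => Complex.I * ((inner ℝ θ x : ℝ) : ℂ)) x := fun x => by
    rw [levyIntegrand, ← ite_norm_le_one_eq_indicator_puncturedBall, sub_add_cancel]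
  simp_rw [hsplit]
  rw [integral_add (hν.integrable_levyIntegrand θ) hcomp,
    integral_indicator measurableSet_puncturedBall, integral_const_mul, integral_complex_ofReal,
    integral_inner hint θ, levyExponent_eq, inner_add_left, real_inner_comm θ (∫ x in _, x ∂ν)]
  push_cast
  ring

end LevyKhintchine

section Cauchy

lemma integrable_exp_neg_abs : Integrable fun x : ℝ => Real.exp (-|x|) := by
  have hright : IntegrableOn (fun x : ℝ => Real.exp (-|x|)) (Ioi 0) :=
    (integrableOn_exp_neg_Ioi 0).congr_fun (fun x hx => by simp [abs_of_pos (mem_Ioi.1 hx)])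
      measurableSet_Ioi
  have hleft : IntegrableOn (fun x : ℝ => Real.exp (-|x|)) (Iic 0) :=
    (integrableOn_exp_Iic 0).congr_fun (fun x hx => by simp [abs_of_nonpos (mem_Iic.1 hx)])
      measurableSet_Iic
  exact integrableOn_univ.1 (Iic_union_Ioi (a := (0 : ℝ)) ▸ hleft.union hright)

lemma integral_cexp_mul_exp_neg_abs (a : ℝ) :
    ∫ x : ℝ, Complex.exp (a * x * Complex.I) * (Real.exp (-|x|) : ℂ) =
      ((2 / (1 + a ^ 2) : ℝ) : ℂ) := by
  have hint : Integrable fun x : ℝ =>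
      Complex.exp (a * x * Complex.I) * (Real.exp (-|x|) : ℂ) :=
    Integrable.bdd_mul integrable_exp_neg_abs.ofReal (by fun_prop) (c := 1)
      (ae_of_all _ fun x => by rw [← Complex.ofReal_mul, Complex.norm_exp_ofReal_mul_I])
  have hright : ∀ x ∈ Ioi (0 : ℝ), Complex.exp (a * x * Complex.I) * (Real.exp (-|x|) : ℂ) =
      Complex.exp ((a * Complex.I - 1) * x) := fun x hx => by
    rw [abs_of_pos hx, Complex.ofReal_exp, ← Complex.exp_add]
    push_cast
    ring_nf
  have hleft : ∀ x ∈ Iic (0 : ℝ), Complex.exp (a * x * Complex.I) * (Real.exp (-|x|) : ℂ) =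
      Complex.exp ((a * Complex.I + 1) * x) := fun x hx => by
    rw [abs_of_nonpos hx, Complex.ofReal_exp, ← Complex.exp_add]
    push_cast
    ring_nf
  have hsub : (a * Complex.I - 1 : ℂ) ≠ 0 := fun h => by simpa using congrArg Complex.re h
  have hadd : (a * Complex.I + 1 : ℂ) ≠ 0 := fun h => by simpa using congrArg Complex.re h
  have hsq : (1 + a ^ 2 : ℂ) ≠ 0 := by exact_mod_cast (by positivity : (1 + a ^ 2 : ℝ) ≠ 0)
  rw [← intervalIntegral.integral_Iic_add_Ioi (b := 0) hint.integrableOn hint.integrableOn,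
    setIntegral_congr_fun measurableSet_Iic hleft, setIntegral_congr_fun measurableSet_Ioi hright,
    integral_exp_mul_complex_Ioi (by simp), integral_exp_mul_complex_Iic (by simp)]
  simp only [Complex.ofReal_zero, mul_zero, Complex.exp_zero]
  push_cast
  field_simp
  linear_combination -2 * (a : ℂ) ^ 2 * Complex.I_sq

open scoped FourierTransform in
lemma fourier_exp_neg_abs :
    𝓕 (fun x : ℝ => (Real.exp (-|x|) : ℂ)) =
      fun w => ((2 / (1 + (2 * Real.pi * w) ^ 2) : ℝ) : ℂ) := by
  ext w
  rw [Real.fourier_eq', ← neg_sq, ← integral_cexp_mul_exp_neg_abs]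
  refine integral_congr_ae (ae_of_all _ fun x => ?_)
  simp only [smul_eq_mul, RCLike.inner_apply, conj_trivial]
  push_cast
  ring_nf

lemma integral_cexp_mul_inv_one_add_sq (x : ℝ) :
    ∫ s : ℝ, Complex.exp (s * x * Complex.I) * ((2 / (1 + s ^ 2) : ℝ) : ℂ) =
      ((2 * Real.pi * Real.exp (-|x|) : ℝ) : ℂ) := by
  have hint : Integrable fun s : ℝ => ((2 / (1 + s ^ 2) : ℝ) : ℂ) := by
    simp only [div_eq_mul_inv]
    exact (integrable_inv_one_add_sq.const_mul 2).ofReal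
  have hfourier : Integrable fun w : ℝ => ((2 / (1 + (2 * Real.pi * w) ^ 2) : ℝ) : ℂ) :=
    hint.comp_mul_left' (by positivity)
  have hinv := integrable_exp_neg_abs.ofReal.fourierInv_fourier_eq
    (fourier_exp_neg_abs ▸ hfourier) (v := x) (by fun_prop)
  rw [fourier_exp_neg_abs, Real.fourierInv_eq'] at hinv
  have hscale := Measure.integral_comp_mul_left
    (fun s : ℝ => Complex.exp (s * x * Complex.I) * ((2 / (1 + s ^ 2) : ℝ) : ℂ)) (2 * Real.pi)
  rw [abs_of_pos (by positivity), eq_inv_smul_iff₀ (by positivity)] at hscale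
  rw [← hscale, Complex.ofReal_mul, Complex.real_smul, ← hinv]
  congr 1
  refine integral_congr_ae (ae_of_all _ fun w => ?_)
  simp only [smul_eq_mul, RCLike.inner_apply, conj_trivial]
  push_cast
  ring_nf

lemma charFun_cauchyMeasure (x : ℝ) : charFun (cauchyMeasure 0 1) x = Real.exp (-|x|) := by
  have hpdf : ∀ s : ℝ, (cauchyPDF 0 1 s).toReal • Complex.exp (x * s * Complex.I) =
      ((2 * Real.pi)⁻¹ : ℂ) * (Complex.exp (s * x * Complex.I) * ((2 / (1 + s ^ 2) : ℝ) : ℂ)) :=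
    fun s => by
    rw [cauchyPDF, ENNReal.toReal_ofReal (cauchyPDF_pos 0 one_ne_zero s).le, cauchyPDFReal,
      Complex.real_smul, mul_comm (x : ℂ)]
    push_cast
    simp only [sub_zero, mul_one, one_pow, div_eq_mul_inv, mul_inv, add_comm]
    ring
  rw [charFun_apply_real, cauchyMeasure_of_scale_ne_zero 0 one_ne_zero,
    integral_withDensity_eq_integral_toReal_smul (by fun_prop) (by simp [cauchyPDF])]
  simp_rw [hpdf]
  rw [integral_const_mul, integral_cexp_mul_inv_one_add_sq]
  push_cast
  exact inv_mul_cancel_left₀ (by simp [Real.pi_ne_zero]) _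

lemma integral_one_sub_cos_eq_one_sub_re_charFun (P : Measure ℝ) [IsProbabilityMeasure P] (a : ℝ) :
    ∫ x, (1 - Real.cos (a * x)) ∂P = 1 - (charFun P a).re := by
  have hint : Integrable (fun x : ℝ => Complex.exp (a * x * Complex.I)) P :=
    Integrable.of_bound (by fun_prop) 1 (ae_of_all _ fun x => by
      rw [← Complex.ofReal_mul, Complex.norm_exp_ofReal_mul_I])
  have hre : ∀ x : ℝ, RCLike.re (Complex.exp (a * x * Complex.I)) = Real.cos (a * x) := fun x => by
    rw [← Complex.ofReal_mul, RCLike.re_eq_complex_re, Complex.exp_ofReal_mul_I_re]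
  have hcos := integral_re hint
  simp only [hre] at hcos
  rw [integral_sub (integrable_const 1) (hint.re.congr (ae_of_all _ hre)), hcos, charFun_apply_real]
  simp

lemma integral_one_sub_cos_cauchyMeasure (x : ℝ) :
    ∫ s, (1 - Real.cos (s * x)) ∂(cauchyMeasure 0 1) = 1 - Real.exp (-|x|) := by
  simp_rw [mul_comm _ x]
  rw [integral_one_sub_cos_eq_one_sub_re_charFun, charFun_cauchyMeasure, Complex.ofReal_re]

lemma lintegral_cauchyMeasure {f : ℝ → ℝ≥0∞} (hf : Measurable f) :
    ∫⁻ s, f s ∂(cauchyMeasure 0 1) =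
      ∫⁻ s, ENNReal.ofReal (Real.pi⁻¹ * (1 + s ^ 2)⁻¹) * f s := by
  rw [cauchyMeasure_of_scale_ne_zero 0 one_ne_zero,
    lintegral_withDensity_eq_lintegral_mul _ (by fun_prop) hf]
  refine lintegral_congr fun s => ?_
  simp [cauchyPDF, cauchyPDFReal, add_comm]

lemma min_one_le_two_mul_div_one_add {y : ℝ} (hy : 0 ≤ y) : min 1 y ≤ 2 * y * (1 + y)⁻¹ := by
  rw [← div_eq_mul_inv, le_div_iff₀ (by positivity)]
  rcases le_total 1 y with h | h
  · rw [min_eq_left h]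
    linarith
  · rw [min_eq_right h]
    nlinarith

lemma lintegral_min_sq_cauchyMeasure_le {a : ℝ} (ha : 0 ≤ a) :
    ∫⁻ s, ENNReal.ofReal (min 1 ((a * s) ^ 2)) ∂(cauchyMeasure 0 1) ≤ ENNReal.ofReal (2 * a) := by
  rcases ha.eq_or_lt with rfl | ha
  · simp
  have hint : Integrable (fun s : ℝ => 2 * a ^ 2 * Real.pi⁻¹ * (1 + (a * s) ^ 2)⁻¹) :=
    (integrable_inv_one_add_sq.comp_mul_left' ha.ne').const_mul _
  have hval : ∫ s : ℝ, 2 * a ^ 2 * Real.pi⁻¹ * (1 + (a * s) ^ 2)⁻¹ = 2 * a := by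
    rw [integral_const_mul, Measure.integral_comp_mul_left (fun s : ℝ => (1 + s ^ 2)⁻¹) a,
      integral_univ_inv_one_add_sq, abs_of_pos (by positivity), smul_eq_mul]
    field_simp
  rw [lintegral_cauchyMeasure (by fun_prop), ← hval,
    ofReal_integral_eq_lintegral_ofReal hint (ae_of_all _ fun s => by positivity)]
  refine lintegral_mono fun s => ?_
  rw [← ENNReal.ofReal_mul (by positivity)]
  refine ENNReal.ofReal_le_ofReal ?_
  have hmin := min_one_le_two_mul_div_one_add (sq_nonneg (a * s))
  have hle : (1 + s ^ 2)⁻¹ * s ^ 2 ≤ 1 := by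
    rw [inv_mul_le_iff₀ (by positivity)]
    linarith
  calc Real.pi⁻¹ * (1 + s ^ 2)⁻¹ * min 1 ((a * s) ^ 2)
      ≤ Real.pi⁻¹ * (1 + s ^ 2)⁻¹ * (2 * (a * s) ^ 2 * (1 + (a * s) ^ 2)⁻¹) := by gcongr
    _ = ((1 + s ^ 2)⁻¹ * s ^ 2) * (2 * a ^ 2 * Real.pi⁻¹ * (1 + (a * s) ^ 2)⁻¹) := by ring
    _ ≤ 1 * (2 * a ^ 2 * Real.pi⁻¹ * (1 + (a * s) ^ 2)⁻¹) := by gcongr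
    _ = _ := one_mul _

lemma lintegral_sq_cauchyMeasure :
    ∫⁻ s, ENNReal.ofReal (s ^ 2) ∂(cauchyMeasure 0 1) = ∞ := by
  rw [lintegral_cauchyMeasure (by fun_prop), eq_top_iff]
  calc ∞ = ∫⁻ _ in Ioi (1 : ℝ), ENNReal.ofReal (Real.pi⁻¹ / 2) := by
        rw [setLIntegral_const, Real.volume_Ioi, ENNReal.mul_top]
        simpa using Real.pi_pos
    _ ≤ ∫⁻ s in Ioi (1 : ℝ),
          ENNReal.ofReal (Real.pi⁻¹ * (1 + s ^ 2)⁻¹) * ENNReal.ofReal (s ^ 2) := by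
        refine setLIntegral_mono' measurableSet_Ioi fun s hs => ?_
        rw [← ENNReal.ofReal_mul (by positivity), div_eq_mul_inv, mul_assoc]
        gcongr
        rw [inv_mul_eq_div, le_div_iff₀ (by positivity)]
        nlinarith [mem_Ioi.1 hs]
    _ ≤ _ := setLIntegral_le_lintegral _ _

end Cauchy

section DyadicGrid

/-- The dyadic point `j / 2 ^ m`. -/
def dyadicPoint (m j : ℕ) : ℝ≥0 := j / 2 ^ m

/-- The smallest dyadic point of level `m` that is at least `t`. -/
def dyadicCeil (m : ℕ) (t : ℝ≥0) : ℝ≥0 := dyadicPoint m ⌈t * 2 ^ m⌉₊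

/-- The dyadic points of level `m` in `[0, N]`. -/
def dyadicGrid (N m : ℕ) : Set ℝ≥0 := dyadicPoint m '' Iic (N * 2 ^ m)

lemma dyadicPoint_mono (m : ℕ) : Monotone (dyadicPoint m) := fun i j h => by
  unfold dyadicPoint
  gcongr

lemma dyadicPoint_add_one (m j : ℕ) :
    dyadicPoint m j + dyadicPoint m 1 = dyadicPoint m (j + 1) := by
  simp [dyadicPoint, add_div]

lemma coe_dyadicPoint_one (m : ℕ) : ((dyadicPoint m 1 : ℝ≥0) : ℝ) = (1 / 2) ^ m := by
  simp [dyadicPoint]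

lemma natCast_mul_dyadicPoint_one (N m : ℕ) :
    ((N * 2 ^ m : ℕ) : ℝ) * (dyadicPoint m 1 : ℝ≥0) = N := by
  simp [dyadicPoint]

lemma tendsto_dyadicPoint_one : Tendsto (fun m => ((dyadicPoint m 1 : ℝ≥0) : ℝ)) atTop (𝓝 0) := by
  simp_rw [coe_dyadicPoint_one]
  exact tendsto_pow_atTop_nhds_zero_of_lt_one (by norm_num) (by norm_num)

lemma dyadicCeil_mono (m : ℕ) : Monotone (dyadicCeil m) := fun s t h =>
  dyadicPoint_mono m (Nat.ceil_mono (by gcongr))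

lemma le_dyadicCeil (m : ℕ) (t : ℝ≥0) : t ≤ dyadicCeil m t := by
  rw [dyadicCeil, dyadicPoint, le_div_iff₀ (by positivity)]
  exact Nat.le_ceil _

lemma dyadicCeil_le (m : ℕ) (t : ℝ≥0) : dyadicCeil m t ≤ t + dyadicPoint m 1 := by
  rw [dyadicCeil, dyadicPoint, dyadicPoint, div_le_iff₀ (by positivity), add_mul,
    div_mul_cancel₀ _ (by positivity), Nat.cast_one]
  exact (Nat.ceil_lt_add_one zero_le).le

lemma tendsto_dyadicCeil (t : ℝ≥0) : Tendsto (fun m => dyadicCeil m t) atTop (𝓝[≥] t) := by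
  have hstep : Tendsto (fun m => dyadicPoint m 1) atTop (𝓝 0) :=
    NNReal.tendsto_coe.1 tendsto_dyadicPoint_one
  refine tendsto_nhdsWithin_iff.2 ⟨?_, Eventually.of_forall fun m => le_dyadicCeil m t⟩
  exact tendsto_of_tendsto_of_tendsto_of_le_of_le tendsto_const_nhds
    (by simpa using hstep.const_add t) (fun m => le_dyadicCeil m t) fun m => dyadicCeil_le m t

lemma dyadicGrid_subset_succ (N m : ℕ) : dyadicGrid N m ⊆ dyadicGrid N (m + 1) := by
  rintro _ ⟨j, hj, rfl⟩
  refine ⟨2 * j, ?_, ?_⟩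
  · simp only [mem_Iic] at hj ⊢
    rw [pow_succ]
    linarith
  · simp only [dyadicPoint, pow_succ]
    push_cast
    field_simp

lemma dyadicGrid_subset_Icc (N m : ℕ) : dyadicGrid N m ⊆ Icc 0 (N : ℝ≥0) := by
  rintro _ ⟨j, hj, rfl⟩
  refine ⟨zero_le, ?_⟩
  rw [dyadicPoint, div_le_iff₀ (by positivity)]
  exact_mod_cast hj

lemma dyadicCeil_mem_dyadicGrid {N m : ℕ} {t : ℝ≥0} (ht : t ≤ N) :
    dyadicCeil m t ∈ dyadicGrid N m := by
  refine ⟨_, Nat.ceil_le.2 ?_, rfl⟩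
  push_cast
  gcongr

variable {E : Type*} [SeminormedAddCommGroup E]

/-- The variation of `f` along the dyadic grid of level `m` on `[0, N]`. -/
def gridSum (f : ℝ≥0 → E) (N m : ℕ) : ℝ :=
  ∑ j ∈ Finset.range (N * 2 ^ m), ‖f (dyadicPoint m (j + 1)) - f (dyadicPoint m j)‖

lemma gridSum_nonneg (f : ℝ≥0 → E) (N m : ℕ) : 0 ≤ gridSum f N m :=
  Finset.sum_nonneg fun _ _ => norm_nonneg _

lemma ofReal_gridSum (f : ℝ≥0 → E) (N m : ℕ) :
    ENNReal.ofReal (gridSum f N m) = eVariationOn f (dyadicGrid N m) := by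
  rw [dyadicGrid, eVariationOn.image_range_of_monotone f (dyadicPoint_mono m), gridSum,
    ENNReal.ofReal_sum_of_nonneg fun _ _ => norm_nonneg _]
  refine Finset.sum_congr rfl fun j _ => ?_
  rw [edist_comm, edist_dist, dist_eq_norm]

lemma gridSum_mono (f : ℝ≥0 → E) (N : ℕ) : Monotone (gridSum f N) := by
  refine monotone_nat_of_le_succ fun m => ?_
  rw [← ENNReal.ofReal_le_ofReal_iff (gridSum_nonneg f N _), ofReal_gridSum, ofReal_gridSum]
  exact eVariationOn.mono f (dyadicGrid_subset_succ N m)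

lemma locallyBoundedVariationOn_of_bddAbove_gridSum {f : ℝ≥0 → E}
    (hf : ∀ t, ContinuousWithinAt f (Ici t) t) (hb : ∀ N, BddAbove (range (gridSum f N))) :
    LocallyBoundedVariationOn f univ := by
  intro a b _ _
  obtain ⟨N, hN⟩ := exists_nat_ge b
  obtain ⟨C, hC⟩ := hb N
  have hsub : univ ∩ Icc a b ⊆ Icc 0 (N : ℝ≥0) := fun x hx => ⟨zero_le, hx.2.2.trans hN⟩
  refine ne_top_of_le_ne_top ?_ (eVariationOn.mono f hsub)
  suffices h : eVariationOn f (Icc 0 (N : ℝ≥0)) ≤ ENNReal.ofReal C from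
    ne_top_of_le_ne_top ENNReal.ofReal_ne_top h
  by_contra! hlt
  -- By right continuity `f ∘ dyadicCeil m → f`, and the variation is lower semicontinuous.
  have hev := eVariationOn.lowerSemicontinuous_aux (F := fun m => f ∘ dyadicCeil m) (p := atTop)
    (fun x _ => (hf x).tendsto.comp (tendsto_dyadicCeil x)) hlt
  obtain ⟨m, hm⟩ := hev.exists
  refine hm.not_ge ?_
  calc eVariationOn (f ∘ dyadicCeil m) (Icc 0 (N : ℝ≥0))
      ≤ eVariationOn f (dyadicGrid N m) :=
        eVariationOn.comp_le_of_monotoneOn f _ ((dyadicCeil_mono m).monotoneOn _)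
          fun t ht => dyadicCeil_mem_dyadicGrid ht.2
    _ = ENNReal.ofReal (gridSum f N m) := (ofReal_gridSum f N m).symm
    _ ≤ ENNReal.ofReal C := ENNReal.ofReal_le_ofReal (hC ⟨m, rfl⟩)

lemma bddAbove_gridSum {f : ℝ≥0 → E} (hf : LocallyBoundedVariationOn f univ) (N : ℕ) :
    BddAbove (range (gridSum f N)) := by
  have hfin := hf 0 N (mem_univ _) (mem_univ _)
  refine ⟨(eVariationOn f (univ ∩ Icc 0 (N : ℝ≥0))).toReal, ?_⟩
  rintro _ ⟨m, rfl⟩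
  rw [← ENNReal.ofReal_le_iff_le_toReal hfin, ofReal_gridSum]
  exact eVariationOn.mono f (by rw [univ_inter]; exact dyadicGrid_subset_Icc N m)

variable {ι : Type*} [Fintype ι]

lemma norm_le_sum_abs (x : EuclideanSpace ℝ ι) : ‖x‖ ≤ ∑ k, |x k| := by
  have h0 : 0 ≤ ∑ k, |x k| := Finset.sum_nonneg fun k _ => abs_nonneg _
  refine (sq_le_sq₀ (norm_nonneg _) h0).1 ?_
  rw [EuclideanSpace.norm_sq_eq]
  exact Finset.sum_sq_le_sq_sum_of_nonneg fun k _ => norm_nonneg _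

lemma gridSum_le_sum_coord (f : ℝ≥0 → EuclideanSpace ℝ ι) (N m : ℕ) :
    gridSum f N m ≤ ∑ k, gridSum (fun t => f t k) N m := by
  simp only [gridSum]
  rw [Finset.sum_comm]
  refine Finset.sum_le_sum fun i _ => (norm_le_sum_abs _).trans_eq ?_
  simp

lemma gridSum_coord_le (f : ℝ≥0 → EuclideanSpace ℝ ι) (k : ι) (N m : ℕ) :
    gridSum (fun t => f t k) N m ≤ gridSum f N m :=
  Finset.sum_le_sum fun i _ =>
    PiLp.norm_apply_le (f (dyadicPoint m (i + 1)) - f (dyadicPoint m i)) k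

end DyadicGrid

section GridVariation

variable {Ω : Type*} [MeasurableSpace Ω] {P : Measure Ω} {E : Type*} [SeminormedAddCommGroup E]
  [MeasurableSpace E] {X : ℝ≥0 → Ω → E}

lemma identDistrib_dyadic_increment
    (hstat : ∀ s t : ℝ≥0, IdentDistrib (fun ω => X (s + t) ω - X s ω) (X t) P P) (m j : ℕ) :
    IdentDistrib (fun ω => X (dyadicPoint m (j + 1)) ω - X (dyadicPoint m j) ω)
      (X (dyadicPoint m 1)) P P := by
  simpa only [dyadicPoint_add_one] using hstat (dyadicPoint m j) (dyadicPoint m 1)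

variable [OpensMeasurableSpace E] [MeasurableSub₂ E]

lemma measurable_gridSum (hX : ∀ t, Measurable (X t)) (N m : ℕ) :
    Measurable fun ω => gridSum (fun t => X t ω) N m := by
  unfold gridSum
  fun_prop

lemma integrable_exp_neg [IsFiniteMeasure P] {f : Ω → ℝ} (hf : Measurable f)
    (h0 : ∀ ω, 0 ≤ f ω) : Integrable (fun ω => Real.exp (-f ω)) P :=
  Integrable.of_bound (by fun_prop) 1 (ae_of_all _ fun ω => by
    rw [Real.norm_eq_abs, Real.abs_exp]
    exact Real.exp_le_one_iff.2 (neg_nonpos.2 (h0 ω)))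

lemma one_sub_exp_neg_nonneg {y : ℝ} (hy : 0 ≤ y) : 0 ≤ 1 - Real.exp (-y) :=
  sub_nonneg.2 (Real.exp_le_one_iff.2 (neg_nonpos.2 hy))

lemma ofReal_one_sub_integral_exp_neg [IsProbabilityMeasure P] {f : Ω → ℝ} (hf : Measurable f)
    (h0 : ∀ ω, 0 ≤ f ω) :
    ENNReal.ofReal (1 - ∫ ω, Real.exp (-f ω) ∂P) =
      ∫⁻ ω, ENNReal.ofReal (1 - Real.exp (-f ω)) ∂P := by
  have hint := integrable_exp_neg (P := P) hf h0
  rw [← ofReal_integral_eq_lintegral_ofReal (f := fun ω => 1 - Real.exp (-f ω))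
    ((integrable_const 1).sub hint) (ae_of_all _ fun ω => one_sub_exp_neg_nonneg (h0 ω)),
    integral_sub (integrable_const 1) hint]
  simp

lemma one_sub_exp_neg_mul_sum_le {κ : Type*} (s : Finset κ) {a : κ → ℝ} (ha : ∀ j, 0 ≤ a j)
    {l : ℝ} (hl : 0 ≤ l) :
    1 - Real.exp (-(l * ∑ j ∈ s, a j)) ≤ ∑ j ∈ s, (1 - Real.exp (-(l * a j))) := by
  refine Finset.le_sum_of_subadditive_on_pred (fun y => 1 - Real.exp (-(l * y))) (fun y => 0 ≤ y)
    (by simp) (fun y z hy hz => ?_) (fun y z => add_nonneg) a fun j _ => ha j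
  rw [mul_add, neg_add, Real.exp_add]
  nlinarith [one_sub_exp_neg_nonneg (mul_nonneg hl hy), one_sub_exp_neg_nonneg (mul_nonneg hl hz)]

lemma lintegral_one_sub_exp_gridSum_le (hX : ∀ t, Measurable (X t))
    (hstat : ∀ s t : ℝ≥0, IdentDistrib (fun ω => X (s + t) ω - X s ω) (X t) P P)
    {l : ℝ} (hl : 0 ≤ l) (N m : ℕ) :
    ∫⁻ ω, ENNReal.ofReal (1 - Real.exp (-(l * gridSum (fun t => X t ω) N m))) ∂P ≤
      (N * 2 ^ m : ℕ) *
        ∫⁻ ω, ENNReal.ofReal (1 - Real.exp (-(l * ‖X (dyadicPoint m 1) ω‖))) ∂P := by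
  have hincr : ∀ j, ∫⁻ ω, ENNReal.ofReal (1 - Real.exp
      (-(l * ‖X (dyadicPoint m (j + 1)) ω - X (dyadicPoint m j) ω‖))) ∂P =
      ∫⁻ ω, ENNReal.ofReal (1 - Real.exp (-(l * ‖X (dyadicPoint m 1) ω‖))) ∂P := fun j =>
    ((identDistrib_dyadic_increment hstat m j).comp
      (u := fun x => ENNReal.ofReal (1 - Real.exp (-(l * ‖x‖)))) (by fun_prop)).lintegral_eq
  calc ∫⁻ ω, ENNReal.ofReal (1 - Real.exp (-(l * gridSum (fun t => X t ω) N m))) ∂P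
      ≤ ∫⁻ ω, ∑ j ∈ Finset.range (N * 2 ^ m), ENNReal.ofReal (1 - Real.exp
          (-(l * ‖X (dyadicPoint m (j + 1)) ω - X (dyadicPoint m j) ω‖))) ∂P := by
        refine lintegral_mono fun ω => ?_
        rw [← ENNReal.ofReal_sum_of_nonneg fun j _ => one_sub_exp_neg_nonneg (by positivity)]
        exact ENNReal.ofReal_le_ofReal
          (one_sub_exp_neg_mul_sum_le _ (fun j => norm_nonneg _) hl)
    _ = _ := by
        rw [lintegral_finsetSum _ (fun j _ => by fun_prop)]
        simp [hincr]

lemma integral_exp_neg_gridSum (hX : ∀ t, Measurable (X t)) (hind : HasIndepIncrements X P)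
    (hstat : ∀ s t : ℝ≥0, IdentDistrib (fun ω => X (s + t) ω - X s ω) (X t) P P) (N m : ℕ) :
    ∫ ω, Real.exp (-gridSum (fun t => X t ω) N m) ∂P =
      (∫ ω, Real.exp (-‖X (dyadicPoint m 1) ω‖) ∂P) ^ (N * 2 ^ m) := by
  have hincr : ∀ j, mgf (fun ω => ‖X (dyadicPoint m (j + 1)) ω - X (dyadicPoint m j) ω‖) P (-1) =
      ∫ ω, Real.exp (-‖X (dyadicPoint m 1) ω‖) ∂P := fun j => by
    simpa [mgf, Function.comp_def] using ((identDistrib_dyadic_increment hstat m j).comp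
      (u := fun x => Real.exp (-‖x‖)) (by fun_prop)).integral_eq
  have hnorm : iIndepFun
      (fun j ω => ‖X (dyadicPoint m (j + 1)) ω - X (dyadicPoint m j) ω‖) P :=
    (hind.nat (dyadicPoint_mono m)).comp (fun _ x => ‖x‖) fun _ => by fun_prop
  have hmgf := hnorm.mgf_sum (t := -1) (fun j => by fun_prop) (Finset.range (N * 2 ^ m))
  simp only [hincr, Finset.prod_const, Finset.card_range] at hmgf
  rw [← hmgf, mgf]
  refine integral_congr_ae (ae_of_all _ fun ω => ?_)
  simp [gridSum]

lemma measure_not_bddAbove_gridSum_le (hX : ∀ t, Measurable (X t)) {N : ℕ} {l : ℝ} (hl : 0 < l)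
    {c : ℕ → ℝ≥0∞} {C : ℝ≥0∞} (hc : Tendsto c atTop (𝓝 C))
    (hle : ∀ m, ∫⁻ ω, ENNReal.ofReal (1 - Real.exp (-(l * gridSum (fun t => X t ω) N m))) ∂P ≤
      c m) :
    P {ω | ¬BddAbove (range (gridSum (fun t => X t ω) N))} ≤ C := by
  let F : ℕ → Ω → ℝ≥0∞ := fun m ω =>
    ENNReal.ofReal (1 - Real.exp (-(l * gridSum (fun t => X t ω) N m)))
  have hF : ∀ m, Measurable (F m) := fun m => by
    have := measurable_gridSum hX N m
    fun_prop
  have hlim : ∀ ω, ¬BddAbove (range (gridSum (fun t => X t ω) N)) →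
      1 ≤ liminf (fun m => F m ω) atTop := fun ω hω => by
    have htop : Tendsto (gridSum (fun t => X t ω) N) atTop atTop :=
      tendsto_atTop_atTop_of_monotone' (gridSum_mono _ N) hω
    have hone : Tendsto (fun m => F m ω) atTop (𝓝 (ENNReal.ofReal (1 - 0))) :=
      ENNReal.tendsto_ofReal (tendsto_const_nhds.sub
        (Real.tendsto_exp_neg_atTop_nhds_zero.comp (htop.const_mul_atTop hl)))
    simp [hone.liminf_eq]
  calc P {ω | ¬BddAbove (range (gridSum (fun t => X t ω) N))}
      ≤ P {ω | 1 ≤ liminf (fun m => F m ω) atTop} := measure_mono hlim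
    _ ≤ ∫⁻ ω, liminf (fun m => F m ω) atTop ∂P := by
        simpa using mul_meas_ge_le_lintegral (μ := P) (Measurable.liminf hF) 1
    _ ≤ liminf (fun m => ∫⁻ ω, F m ω ∂P) atTop := lintegral_liminf_le hF
    _ ≤ liminf c atTop := liminf_le_liminf (Eventually.of_forall hle)
    _ = C := hc.liminf_eq

end GridVariation

section BoundedVariation

lemma lintegral_one_sub_cos_cauchyMeasure (x : ℝ) :
    ∫⁻ s, ENNReal.ofReal (1 - Real.cos (s * x)) ∂(cauchyMeasure 0 1) =
      ENNReal.ofReal (1 - Real.exp (-|x|)) := by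
  rw [← integral_one_sub_cos_cauchyMeasure, ofReal_integral_eq_lintegral_ofReal _
    (ae_of_all _ fun s => one_sub_cos_nonneg _)]
  refine Integrable.mono' (integrable_const 2) (by fun_prop) (ae_of_all _ fun s => ?_)
  rw [Real.norm_eq_abs, abs_of_nonneg (one_sub_cos_nonneg _)]
  linarith [Real.neg_one_le_cos (s * x)]

lemma lintegral_lintegral_one_sub_cos (ν : Measure ℝ) [SFinite ν] {l : ℝ} (hl : 0 ≤ l) :
    ∫⁻ s, ∫⁻ x, ENNReal.ofReal (1 - Real.cos (s * (l * x))) ∂ν ∂(cauchyMeasure 0 1) =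
      ∫⁻ x, ENNReal.ofReal (1 - Real.exp (-(l * |x|))) ∂ν := by
  rw [lintegral_lintegral_swap (by fun_prop)]
  simp_rw [lintegral_one_sub_cos_cauchyMeasure, abs_mul, abs_of_nonneg hl]

lemma lintegral_one_sub_re_charFun (Q : Measure ℝ) [IsProbabilityMeasure Q] {l : ℝ}
    (hl : 0 ≤ l) :
    ∫⁻ s, ENNReal.ofReal (1 - (charFun Q (s * l)).re) ∂(cauchyMeasure 0 1) =
      ∫⁻ x, ENNReal.ofReal (1 - Real.exp (-(l * |x|))) ∂Q := by
  rw [← lintegral_lintegral_one_sub_cos Q hl]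
  refine lintegral_congr fun s => ?_
  rw [← integral_one_sub_cos_eq_one_sub_re_charFun, ofReal_integral_eq_lintegral_ofReal _
    (ae_of_all _ fun x => one_sub_cos_nonneg _)]
  · simp only [mul_assoc]
  · refine Integrable.mono' (integrable_const 2) (by fun_prop) (ae_of_all _ fun x => ?_)
    rw [Real.norm_eq_abs, abs_of_nonneg (one_sub_cos_nonneg _)]
    linarith [Real.neg_one_le_cos (s * l * x)]

/-- The characteristic exponent of a Lévy process on the line of locally finite variation, with
drift `b` and Lévy measure `ν`. -/
def fvExponent (b : ℝ) (ν : Measure ℝ) (s : ℝ) : ℂ :=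
  Complex.I * (b * s : ℝ) + ∫ x, (Complex.exp (Complex.I * (s * x : ℝ)) - 1) ∂ν

/-- The constant in the linear growth bound `abs_im_fvExponent_le` for `fvExponent b ν`. -/
def fvRate (b : ℝ) (ν : Measure ℝ) : ℝ := |b| + ∫ x, min |x| 1 ∂ν

lemma fvRate_nonneg (b : ℝ) (ν : Measure ℝ) : 0 ≤ fvRate b ν :=
  add_nonneg (abs_nonneg b) (integral_nonneg fun x => by positivity)

variable {ν : Measure ℝ}

lemma norm_cexp_sub_one_le_min (s x : ℝ) :
    ‖Complex.exp (Complex.I * (s * x : ℝ)) - 1‖ ≤ (|s| + 2) * min |x| 1 := by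
  have hlin : ‖Complex.exp (Complex.I * (s * x : ℝ)) - 1‖ ≤ ‖s * x‖ :=
    Real.norm_exp_I_mul_ofReal_sub_one_le
  have htwo := norm_cexp_I_sub_one_le_two (s * x)
  rw [Real.norm_eq_abs, abs_mul] at hlin
  rcases le_total |x| 1 with h | h
  · rw [min_eq_left h]; nlinarith [abs_nonneg s, abs_nonneg x]
  · rw [min_eq_right h]; nlinarith [abs_nonneg s, abs_nonneg x]

lemma integrable_cexp_sub_one (hν : Integrable (fun x => min |x| 1) ν) (s : ℝ) :
    Integrable (fun x : ℝ => Complex.exp (Complex.I * (s * x : ℝ)) - 1) ν :=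
  Integrable.mono' (hν.const_mul _) (by fun_prop)
    (ae_of_all _ fun x => norm_cexp_sub_one_le_min s x)

lemma integrable_one_sub_cos (hν : Integrable (fun x => min |x| 1) ν) (s : ℝ) :
    Integrable (fun x => 1 - Real.cos (s * x)) ν := by
  refine (integrable_cexp_sub_one hν s).re.neg.congr (ae_of_all _ fun x => ?_)
  simp only [Pi.neg_apply, RCLike.re_eq_complex_re, re_cexp_I_mul_sub_one]
  ring

lemma re_fvExponent (hν : Integrable (fun x => min |x| 1) ν) (b s : ℝ) :
    (fvExponent b ν s).re = -∫ x, (1 - Real.cos (s * x)) ∂ν := by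
  have hre := integral_re (integrable_cexp_sub_one hν s)
  simp only [RCLike.re_eq_complex_re, re_cexp_I_mul_sub_one] at hre
  rw [fvExponent, Complex.add_re, ← hre, ← integral_neg]
  simp

lemma abs_im_fvExponent_le (hν : Integrable (fun x => min |x| 1) ν) (b s : ℝ) :
    |(fvExponent b ν s).im| ≤ (|s| + 2) * fvRate b ν := by
  have hjump : ‖∫ x, (Complex.exp (Complex.I * (s * x : ℝ)) - 1) ∂ν‖ ≤
      (|s| + 2) * ∫ x, min |x| 1 ∂ν := by
    rw [← integral_const_mul]
    exact norm_integral_le_of_norm_le (hν.const_mul _)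
      (ae_of_all _ fun x => norm_cexp_sub_one_le_min s x)
  have hdrift : ‖Complex.I * (b * s : ℝ)‖ ≤ (|s| + 2) * |b| := by
    simp only [norm_mul, Complex.norm_I, one_mul, Complex.norm_real, Real.norm_eq_abs,
      Complex.ofReal_mul]
    nlinarith [abs_nonneg b]
  rw [fvRate, mul_add]
  exact (Complex.abs_im_le_norm _).trans ((norm_add_le _ _).trans (add_le_add hdrift hjump))

lemma one_sub_re_cexp_le {z : ℂ} (hz : z.re ≤ 0) :
    1 - (Complex.exp z).re ≤ -z.re + min 2 (z.im ^ 2) := by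
  have hre : Real.exp z.re ≤ 1 := Real.exp_le_one_iff.2 hz
  have hcos : 1 - Real.cos z.im ≤ min 2 (z.im ^ 2) :=
    le_min (by linarith [Real.neg_one_le_cos z.im])
      (by nlinarith [sq_nonneg z.im, Real.one_sub_sq_div_two_le_cos (x := z.im)])
  rw [Complex.exp_re]
  nlinarith [Real.add_one_le_exp z.re, one_sub_cos_nonneg z.im]

lemma min_two_sq_le {y a c : ℝ} (hy : |y| ≤ |a| + 2 * |c|) :
    min 2 (y ^ 2) ≤ 2 * min 1 (a ^ 2) + 8 * c ^ 2 := by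
  rcases le_total 1 (a ^ 2) with h | h
  · rw [min_eq_left h]
    exact (min_le_left _ _).trans (by nlinarith [sq_nonneg c])
  · rw [min_eq_right h]
    refine (min_le_right _ _).trans ?_
    rw [← sq_abs y, ← sq_abs a, ← sq_abs c]
    nlinarith [abs_nonneg y, sq_nonneg (|a| - 2 * |c|)]

lemma one_sub_re_cexp_fvExponent_le (hν : Integrable (fun x => min |x| 1) ν) (b : ℝ) {h : ℝ}
    (hh : 0 ≤ h) (s l : ℝ) :
    1 - (Complex.exp (h * fvExponent b ν (s * l))).re ≤
      h * (∫ x, (1 - Real.cos (s * (l * x))) ∂ν) + 2 * min 1 ((h * fvRate b ν * l * s) ^ 2) +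
        8 * (h * fvRate b ν) ^ 2 := by
  set κ := fvRate b ν
  have hκ : 0 ≤ κ := fvRate_nonneg b ν
  have hre : ((h : ℂ) * fvExponent b ν (s * l)).re =
      -(h * ∫ x, (1 - Real.cos (s * (l * x))) ∂ν) := by
    simp only [Complex.re_ofReal_mul, re_fvExponent hν, mul_assoc, mul_neg]
  have him : |((h : ℂ) * fvExponent b ν (s * l)).im| ≤ |h * κ * l * s| + 2 * |h * κ| := by
    rw [Complex.im_ofReal_mul, abs_mul, abs_of_nonneg hh]
    refine (mul_le_mul_of_nonneg_left (abs_im_fvExponent_le hν b (s * l)) hh).trans_eq ?_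
    simp only [abs_mul, abs_of_nonneg hh, abs_of_nonneg hκ, κ]
    ring
  have hnonpos : ((h : ℂ) * fvExponent b ν (s * l)).re ≤ 0 := by
    rw [hre]
    exact neg_nonpos.2 (mul_nonneg hh (integral_nonneg fun x => one_sub_cos_nonneg _))
  linarith [one_sub_re_cexp_le hnonpos, min_two_sq_le him]

lemma ofReal_one_sub_re_cexp_fvExponent_le (hν : Integrable (fun x => min |x| 1) ν) (b : ℝ)
    {h : ℝ} (hh : 0 ≤ h) (s l : ℝ) :
    ENNReal.ofReal (1 - (Complex.exp (h * fvExponent b ν (s * l))).re) ≤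
      ENNReal.ofReal h * (∫⁻ x, ENNReal.ofReal (1 - Real.cos (s * (l * x))) ∂ν) +
        2 * ENNReal.ofReal (min 1 ((h * fvRate b ν * l * s) ^ 2)) +
        ENNReal.ofReal (8 * (h * fvRate b ν) ^ 2) := by
  have hcos : 0 ≤ ∫ x, (1 - Real.cos (s * (l * x))) ∂ν :=
    integral_nonneg fun x => one_sub_cos_nonneg _
  have hint : Integrable (fun x => 1 - Real.cos (s * (l * x))) ν := by
    simpa only [mul_assoc] using integrable_one_sub_cos hν (s * l)
  refine (ENNReal.ofReal_le_ofReal (one_sub_re_cexp_fvExponent_le hν b hh s l)).trans_eq ?_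
  rw [ENNReal.ofReal_add (by positivity) (by positivity),
    ENNReal.ofReal_add (by positivity) (by positivity), ENNReal.ofReal_mul hh,
    ENNReal.ofReal_mul zero_le_two, ENNReal.ofReal_ofNat,
    ofReal_integral_eq_lintegral_ofReal hint (ae_of_all _ fun x => one_sub_cos_nonneg _)]

lemma integrable_one_sub_exp (hν : Integrable (fun x => min |x| 1) ν) {l : ℝ} (hl : 0 ≤ l) :
    Integrable (fun x : ℝ => 1 - Real.exp (-(l * |x|))) ν := by
  refine Integrable.mono' (hν.const_mul (l + 1)) (by fun_prop) (ae_of_all _ fun x => ?_)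
  rw [Real.norm_eq_abs, abs_of_nonneg (one_sub_exp_neg_nonneg (by positivity))]
  have hlin := Real.add_one_le_exp (-(l * |x|))
  have hpos := Real.exp_pos (-(l * |x|))
  rcases le_total |x| 1 with h | h
  · rw [min_eq_left h]; nlinarith [abs_nonneg x]
  · rw [min_eq_right h]; nlinarith [abs_nonneg x]

lemma lintegral_one_sub_exp_le [SFinite ν] (hν : Integrable (fun x => min |x| 1) ν) {b h : ℝ}
    (hh : 0 ≤ h) {Q : Measure ℝ} [IsProbabilityMeasure Q]
    (hchar : ∀ s, charFun Q s = Complex.exp (h * fvExponent b ν s)) {l : ℝ} (hl : 0 ≤ l) :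
    ∫⁻ x, ENNReal.ofReal (1 - Real.exp (-(l * |x|))) ∂Q ≤
      ENNReal.ofReal (h * (∫ x, (1 - Real.exp (-(l * |x|))) ∂ν) + 4 * (h * fvRate b ν * l) +
        8 * (h * fvRate b ν) ^ 2) := by
  set κ := fvRate b ν
  have hκ : 0 ≤ κ := fvRate_nonneg b ν
  have hexp : 0 ≤ ∫ x, (1 - Real.exp (-(l * |x|))) ∂ν :=
    integral_nonneg fun x => one_sub_exp_neg_nonneg (by positivity)
  calc ∫⁻ x, ENNReal.ofReal (1 - Real.exp (-(l * |x|))) ∂Q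
      = ∫⁻ s, ENNReal.ofReal (1 - (charFun Q (s * l)).re) ∂(cauchyMeasure 0 1) :=
        (lintegral_one_sub_re_charFun Q hl).symm
    _ ≤ ∫⁻ s, (ENNReal.ofReal h * (∫⁻ x, ENNReal.ofReal (1 - Real.cos (s * (l * x))) ∂ν) +
          2 * ENNReal.ofReal (min 1 ((h * κ * l * s) ^ 2)) +
          ENNReal.ofReal (8 * (h * κ) ^ 2)) ∂(cauchyMeasure 0 1) := by
        simp_rw [hchar]
        exact lintegral_mono fun s => ofReal_one_sub_re_cexp_fvExponent_le hν b hh s l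
    _ = ENNReal.ofReal h * (∫⁻ x, ENNReal.ofReal (1 - Real.exp (-(l * |x|))) ∂ν) +
          2 * (∫⁻ s, ENNReal.ofReal (min 1 ((h * κ * l * s) ^ 2)) ∂(cauchyMeasure 0 1)) +
          ENNReal.ofReal (8 * (h * κ) ^ 2) := by
        rw [lintegral_add_right _ (by fun_prop), lintegral_add_right _ (by fun_prop),
          lintegral_const_mul' _ _ ENNReal.ofReal_ne_top, lintegral_const_mul' _ _ (by simp),
          lintegral_lintegral_one_sub_cos ν hl, lintegral_const, measure_univ, mul_one]
    _ ≤ ENNReal.ofReal h * (∫⁻ x, ENNReal.ofReal (1 - Real.exp (-(l * |x|))) ∂ν) +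
          2 * ENNReal.ofReal (2 * (h * κ * l)) + ENNReal.ofReal (8 * (h * κ) ^ 2) := by
        gcongr
        exact lintegral_min_sq_cauchyMeasure_le (by positivity)
    _ = _ := by
        rw [ENNReal.ofReal_add (by positivity) (by positivity),
          ENNReal.ofReal_add (by positivity) (by positivity), ENNReal.ofReal_mul hh,
          ofReal_integral_eq_lintegral_ofReal (integrable_one_sub_exp hν hl)
            (ae_of_all _ fun x => one_sub_exp_neg_nonneg (by positivity)),
          show 4 * (h * κ * l) = 2 * (2 * (h * κ * l)) by ring,
          ENNReal.ofReal_mul (q := 2 * (h * κ * l)) zero_le_two,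
          ENNReal.ofReal_ofNat]

lemma tendsto_integral_one_sub_exp (hν : Integrable (fun x => min |x| 1) ν) :
    Tendsto (fun l : ℝ => ∫ x, (1 - Real.exp (-(l * |x|))) ∂ν) (𝓝[>] 0) (𝓝 0) := by
  suffices hlim : Tendsto (fun l : ℝ => ∫ x, (1 - Real.exp (-(l * |x|))) ∂ν) (𝓝[>] 0)
      (𝓝 (∫ _, (0 : ℝ) ∂ν)) by simpa only [integral_zero] using hlim
  refine tendsto_integral_filter_of_dominated_convergence (fun x => 1 - Real.exp (-(1 * |x|)))
    (Eventually.of_forall fun l => by fun_prop) ?_ (integrable_one_sub_exp hν zero_le_one)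
    (ae_of_all _ fun x => ?_)
  · filter_upwards [Ioc_mem_nhdsGT one_pos] with l hl
    refine ae_of_all _ fun x => ?_
    rw [Real.norm_eq_abs,
      abs_of_nonneg (one_sub_exp_neg_nonneg (mul_nonneg hl.1.le (abs_nonneg x)))]
    gcongr
    exact hl.2
  · have hcont : Continuous fun l : ℝ => 1 - Real.exp (-(l * |x|)) := by fun_prop
    simpa using (hcont.tendsto 0).mono_left nhdsWithin_le_nhds

variable {Ω : Type*} [MeasurableSpace Ω] {P : Measure Ω} {X : ℝ≥0 → Ω → ℝ}

lemma measure_not_bddAbove_gridSum_le_fvExponent [IsProbabilityMeasure P] [SFinite ν]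
    (hν : Integrable (fun x => min |x| 1) ν) (hX : ∀ t, Measurable (X t))
    (hstat : ∀ s t : ℝ≥0, IdentDistrib (fun ω => X (s + t) ω - X s ω) (X t) P P) {b : ℝ}
    (hchar : ∀ (h : ℝ≥0) (s : ℝ),
      charFun (P.map (X h)) s = Complex.exp ((h : ℝ) * fvExponent b ν s))
    (N : ℕ) {l : ℝ} (hl : 0 < l) :
    P {ω | ¬BddAbove (range (gridSum (fun t => X t ω) N))} ≤
      ENNReal.ofReal (N * ((∫ x, (1 - Real.exp (-(l * |x|))) ∂ν) + 4 * (fvRate b ν * l))) := by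
  set κ := fvRate b ν
  set J := ∫ x, (1 - Real.exp (-(l * |x|))) ∂ν
  refine measure_not_bddAbove_gridSum_le hX hl
    (c := fun m => ENNReal.ofReal (N * (J + 4 * (κ * l)) +
      N * (8 * κ ^ 2 * (dyadicPoint m 1 : ℝ≥0)))) (ENNReal.tendsto_ofReal ?_) fun m => ?_
  · have hstep := (tendsto_dyadicPoint_one.const_mul (8 * κ ^ 2)).const_mul (N : ℝ)
    simpa using hstep.const_add (N * (J + 4 * (κ * l)))
  have := Measure.isProbabilityMeasure_map (μ := P) (hX (dyadicPoint m 1)).aemeasurable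
  set δ : ℝ := ((dyadicPoint m 1 : ℝ≥0) : ℝ)
  have hstep : ∫⁻ ω, ENNReal.ofReal (1 - Real.exp (-(l * ‖X (dyadicPoint m 1) ω‖))) ∂P ≤
      ENNReal.ofReal (δ * J + 4 * (δ * κ * l) + 8 * (δ * κ) ^ 2) := by
    simp_rw [Real.norm_eq_abs]
    rw [← lintegral_map (μ := P) (f := fun x => ENNReal.ofReal (1 - Real.exp (-(l * |x|))))
      (by fun_prop) (hX (dyadicPoint m 1))]
    exact lintegral_one_sub_exp_le hν (NNReal.coe_nonneg _) (hchar _) hl.le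
  refine (lintegral_one_sub_exp_gridSum_le hX hstat hl.le N m).trans ?_
  refine (mul_le_mul_right hstep _).trans_eq ?_
  rw [← ENNReal.ofReal_natCast, ← ENNReal.ofReal_mul (by positivity)]
  congr 1
  linear_combination (J + 4 * (κ * l) + 8 * κ ^ 2 * δ) * natCast_mul_dyadicPoint_one N m

theorem ae_bddAbove_gridSum [IsProbabilityMeasure P] [SFinite ν]
    (hν : Integrable (fun x => min |x| 1) ν) (hX : ∀ t, Measurable (X t))
    (hstat : ∀ s t : ℝ≥0, IdentDistrib (fun ω => X (s + t) ω - X s ω) (X t) P P) {b : ℝ}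
    (hchar : ∀ (h : ℝ≥0) (s : ℝ),
      charFun (P.map (X h)) s = Complex.exp ((h : ℝ) * fvExponent b ν s)) (N : ℕ) :
    ∀ᵐ ω ∂P, BddAbove (range (gridSum (fun t => X t ω) N)) := by
  have hlim : Tendsto (fun l : ℝ => ENNReal.ofReal
      (N * ((∫ x, (1 - Real.exp (-(l * |x|))) ∂ν) + 4 * (fvRate b ν * l)))) (𝓝[>] 0) (𝓝 0) := by
    have hl : Tendsto (fun l : ℝ => l) (𝓝[>] 0) (𝓝 0) := nhdsWithin_le_nhds
    simpa using ENNReal.tendsto_ofReal (((tendsto_integral_one_sub_exp hν).add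
      ((hl.const_mul (fvRate b ν)).const_mul 4)).const_mul (N : ℝ))
  refine le_antisymm (ge_of_tendsto hlim ?_) zero_le
  filter_upwards [self_mem_nhdsWithin] with l hl
  exact measure_not_bddAbove_gridSum_le_fvExponent hν hX hstat hchar N hl

end BoundedVariation

section BoundedVariationConverse

variable {Ω : Type*} [MeasurableSpace Ω] {P : Measure Ω}

lemma exists_nat_measure_forall_le_ne_zero [NeZero P] {f : ℕ → Ω → ℝ}
    (hf : ∀ᵐ ω ∂P, BddAbove (range fun m => f m ω)) :
    ∃ K : ℕ, P {ω | ∀ m, f m ω ≤ K} ≠ 0 := by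
  by_contra! hnull
  have hunion : ∀ᵐ ω ∂P, ω ∈ ⋃ K : ℕ, {ω | ∀ m, f m ω ≤ K} := by
    filter_upwards [hf] with ω ⟨C, hC⟩
    obtain ⟨K, hK⟩ := exists_nat_ge C
    exact mem_iUnion.2 ⟨K, fun m => (hC ⟨m, rfl⟩).trans hK⟩
  have hfalse : ∀ᵐ _ ∂P, False := by
    filter_upwards [hunion, measure_eq_zero_iff_ae_notMem.1 (measure_iUnion_null hnull)]
      with _ hin hout using hout hin
  exact NeZero.ne P (by simpa using hfalse)

lemma exists_pos_le_integral_exp_neg [IsProbabilityMeasure P] {f : ℕ → Ω → ℝ}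
    (hf : ∀ m, Measurable (f m)) (h0 : ∀ m ω, 0 ≤ f m ω)
    (hb : ∀ᵐ ω ∂P, BddAbove (range fun m => f m ω)) :
    ∃ c : ℝ, 0 < c ∧ ∀ m, c ≤ ∫ ω, Real.exp (-f m ω) ∂P := by
  obtain ⟨K, hK⟩ := exists_nat_measure_forall_le_ne_zero hb
  refine ⟨Real.exp (-K) * P.real {ω | ∀ m, f m ω ≤ K},
    mul_pos (Real.exp_pos _) (ENNReal.toReal_pos hK (measure_ne_top _ _)), fun m => ?_⟩
  refine le_trans ?_ (mul_meas_ge_le_integral_of_nonneg (ae_of_all _ fun ω => (Real.exp_pos _).le)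
    (integrable_exp_neg (hf m) (h0 m)) (Real.exp (-K)))
  exact mul_le_mul_of_nonneg_left
    (measureReal_mono fun ω hω => Real.exp_le_exp.2 (neg_le_neg (hω m))) (Real.exp_pos _).le

lemma mul_one_sub_le_neg_log {p c : ℝ} (hp : 0 < p) (hc : 0 < c) {n : ℕ} (hcp : c ≤ p ^ n) :
    n * (1 - p) ≤ -Real.log c := by
  have hlog := Real.log_le_log hc hcp
  rw [Real.log_pow] at hlog
  nlinarith [mul_le_mul_of_nonneg_left (Real.log_le_sub_one_of_pos hp) n.cast_nonneg]

lemma exists_one_sub_integral_exp_neg_le {E : Type*} [SeminormedAddCommGroup E]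
    [MeasurableSpace E] [OpensMeasurableSpace E] [MeasurableSub₂ E] {X : ℝ≥0 → Ω → E}
    [IsProbabilityMeasure P] (hX : ∀ t, Measurable (X t)) (hind : HasIndepIncrements X P)
    (hstat : ∀ s t : ℝ≥0, IdentDistrib (fun ω => X (s + t) ω - X s ω) (X t) P P)
    (hb : ∀ᵐ ω ∂P, BddAbove (range (gridSum (fun t => X t ω) 1))) :
    ∃ C : ℝ, ∀ m, 1 - ∫ ω, Real.exp (-‖X (dyadicPoint m 1) ω‖) ∂P ≤
      C * (dyadicPoint m 1 : ℝ≥0) := by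
  obtain ⟨c, hc, hle⟩ := exists_pos_le_integral_exp_neg (fun m => measurable_gridSum hX 1 m)
    (fun m ω => gridSum_nonneg _ _ _) hb
  refine ⟨-Real.log c, fun m => ?_⟩
  have hpos : 0 < ∫ ω, Real.exp (-‖X (dyadicPoint m 1) ω‖) ∂P :=
    integral_exp_pos (integrable_exp_neg (by fun_prop) fun ω => norm_nonneg _)
  have hlog := mul_one_sub_le_neg_log hpos hc ((hle m).trans_eq
    (integral_exp_neg_gridSum hX hind hstat 1 m))
  rw [coe_dyadicPoint_one, one_div, inv_pow, ← div_eq_mul_inv, le_div_iff₀ (by positivity),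
    mul_comm]
  simpa using hlog

lemma tendsto_one_sub_re_cexp_div (z : ℂ) {h : ℕ → ℝ} (h0 : ∀ m, 0 < h m)
    (hlim : Tendsto h atTop (𝓝 0)) :
    Tendsto (fun m => (1 - (Complex.exp (h m * z)).re) / h m) atTop (𝓝 (-z.re)) := by
  have hderiv : HasDerivAt (fun t : ℝ => Complex.exp (t * z)) z 0 := by
    simpa using ((Complex.ofRealCLM.hasDerivAt (x := 0)).mul_const z).cexp
  have hslope := hderiv.tendsto_slope_zero.comp
    (tendsto_nhdsWithin_iff.2 ⟨hlim, Eventually.of_forall fun m => (h0 m).ne'⟩)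
  refine ((Complex.continuous_re.tendsto _).comp hslope).neg.congr fun m => ?_
  simp only [Function.comp_apply, zero_add, Complex.ofReal_zero, zero_mul, Complex.exp_zero,
    Complex.smul_re, Complex.sub_re, Complex.one_re, smul_eq_mul]
  rw [div_eq_inv_mul]
  ring

variable {X : ℝ≥0 → Ω → ℝ}

theorem lintegral_neg_re_exponent_lt_top [IsProbabilityMeasure P] (hX : ∀ t, Measurable (X t))
    (hind : HasIndepIncrements X P)
    (hstat : ∀ s t : ℝ≥0, IdentDistrib (fun ω => X (s + t) ω - X s ω) (X t) P P)
    (hb : ∀ᵐ ω ∂P, BddAbove (range (gridSum (fun t => X t ω) 1))) {ψ : ℝ → ℂ}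
    (hchar : ∀ (h : ℝ≥0) (s : ℝ), charFun (P.map (X h)) s = Complex.exp ((h : ℝ) * ψ s)) :
    ∫⁻ s, ENNReal.ofReal (-(ψ s).re) ∂(cauchyMeasure 0 1) < ∞ := by
  obtain ⟨C, hC⟩ := exists_one_sub_integral_exp_neg_le hX hind hstat hb
  let δ : ℕ → ℝ := fun m => (dyadicPoint m 1 : ℝ≥0)
  have hδ : ∀ m, 0 < δ m := fun m => by simp [δ, dyadicPoint]
  let F : ℕ → ℝ → ℝ := fun m s => (1 - (charFun (P.map (X (dyadicPoint m 1))) s).re) / δ m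
  have hlim : ∀ s, Tendsto (fun m => F m s) atTop (𝓝 (-(ψ s).re)) := fun s => by
    simp only [F, hchar]
    exact tendsto_one_sub_re_cexp_div _ hδ tendsto_dyadicPoint_one
  have hbound : ∀ m, ∫⁻ s, ENNReal.ofReal (F m s) ∂(cauchyMeasure 0 1) ≤ ENNReal.ofReal C := by
    intro m
    have hprob := Measure.isProbabilityMeasure_map (μ := P) (hX (dyadicPoint m 1)).aemeasurable
    have hcauchy := lintegral_one_sub_re_charFun (P.map (X (dyadicPoint m 1))) zero_le_one
    simp only [mul_one, one_mul] at hcauchy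
    rw [lintegral_map (by fun_prop) (hX _),
      ← ofReal_one_sub_integral_exp_neg (by fun_prop) fun ω => abs_nonneg _] at hcauchy
    simp_rw [F, ENNReal.ofReal_div_of_pos (hδ m), div_eq_mul_inv]
    rw [lintegral_mul_const' _ _ (by simpa using hδ m), hcauchy, ← div_eq_mul_inv,
      ← ENNReal.ofReal_div_of_pos (hδ m)]
    exact ENNReal.ofReal_le_ofReal ((div_le_iff₀ (hδ m)).2 (hC m))
  calc ∫⁻ s, ENNReal.ofReal (-(ψ s).re) ∂(cauchyMeasure 0 1)
      = ∫⁻ s, liminf (fun m => ENNReal.ofReal (F m s)) atTop ∂(cauchyMeasure 0 1) :=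
        lintegral_congr fun s => ((ENNReal.tendsto_ofReal (hlim s)).liminf_eq).symm
    _ ≤ liminf (fun m => ∫⁻ s, ENNReal.ofReal (F m s) ∂(cauchyMeasure 0 1)) atTop :=
        lintegral_liminf_le fun m => ((measurable_const.sub
          (Complex.measurable_re.comp measurable_charFun)).div_const _).ennreal_ofReal
    _ ≤ liminf (fun _ => ENNReal.ofReal C) atTop :=
        liminf_le_liminf (Eventually.of_forall hbound)
    _ < ∞ := by simp

end BoundedVariationConverse

section SFinite

lemma sFinite_of_lintegral_lt_top {α : Type*} [MeasurableSpace α] {ν : Measure α} {f : α → ℝ≥0∞}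
    (hf : Measurable f) (h0 : ∀ᵐ x ∂ν, f x ≠ 0) (htop : ∀ x, f x ≠ ∞) (hint : ∫⁻ x, f x ∂ν ≠ ∞) :
    SFinite ν := by
  have := isFiniteMeasure_withDensity hint
  rw [← withDensity_inv_same hf h0 (ae_of_all _ htop)]
  infer_instance

variable {ι : Type*} [Fintype ι]

lemma IsLevyMeasure.sFinite {ν : Measure (EuclideanSpace ℝ ι)} (hν : IsLevyMeasure ν) :
    SFinite ν := by
  refine sFinite_of_lintegral_lt_top (f := fun x => ENNReal.ofReal (min (‖x‖ ^ 2) 1)) (by fun_prop)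
    ?_ (fun _ => ENNReal.ofReal_ne_top) hν.2.ne
  filter_upwards [compl_mem_ae_iff.2 hν.1] with x hx
  rw [ne_eq, ENNReal.ofReal_eq_zero, not_le]
  exact lt_min (pow_pos (norm_pos_iff.2 hx) 2) one_pos

lemma IsThorinMeasure.ae_mem {U : Measure (EuclideanSpace ℝ ι)} (hU : IsThorinMeasure U) :
    ∀ᵐ u ∂U, u ∈ puncturedOrthant ι := mem_ae_iff.2 hU.1

/-- The weight against which a Thorin measure integrates, as a function of `‖u‖`. -/
def thorinWeight (x : ℝ) : ℝ := min (1 + max 0 (-Real.log x)) (1 / x)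

lemma measurable_thorinWeight : Measurable thorinWeight := by
  unfold thorinWeight
  fun_prop

lemma thorinWeight_pos {x : ℝ} (hx : 0 < x) : 0 < thorinWeight x :=
  lt_min (by linarith [le_max_left 0 (-Real.log x)]) (by positivity)

lemma IsThorinMeasure.sFinite {U : Measure (EuclideanSpace ℝ ι)} (hU : IsThorinMeasure U) :
    SFinite U := by
  refine sFinite_of_lintegral_lt_top
    (f := fun u => ENNReal.ofReal (thorinWeight ‖u‖))
    (measurable_thorinWeight.comp measurable_norm).ennreal_ofReal ?_
    (fun _ => ENNReal.ofReal_ne_top) hU.2.ne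
  filter_upwards [hU.ae_mem] with u hu
  simp only [ne_eq, ENNReal.ofReal_eq_zero, not_le]
  exact thorinWeight_pos (norm_pos_iff.2 hu.2)

end SFinite

section ThorinLevyMeasure

/-- The Lévy measure `exp (-r) / r dr` of the gamma process. -/
def gammaLevyMeasure : Measure ℝ :=
  (volume.restrict (Ioi 0)).withDensity fun r => ENNReal.ofReal (Real.exp (-r) / r)

instance : SFinite gammaLevyMeasure := by unfold gammaLevyMeasure; infer_instance

lemma lintegral_gammaLevyMeasure {f : ℝ → ℝ≥0∞} (hf : Measurable f) :
    ∫⁻ r, f r ∂gammaLevyMeasure = ∫⁻ r in Ioi 0, ENNReal.ofReal (Real.exp (-r) / r) * f r := by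
  rw [gammaLevyMeasure, lintegral_withDensity_eq_lintegral_mul _ (by fun_prop) hf]
  rfl

lemma ae_gammaLevyMeasure_pos : ∀ᵐ r ∂gammaLevyMeasure, 0 < r :=
  (withDensity_absolutelyContinuous _ _).ae_le (ae_restrict_mem measurableSet_Ioi)

lemma integrableOn_exp_neg_div_mul_one_sub_exp {a : ℝ} (ha : 0 ≤ a) :
    IntegrableOn (fun r : ℝ => Real.exp (-r) / r * (1 - Real.exp (-(a * r)))) (Ioi 0) := by
  refine Integrable.mono' ((integrableOn_exp_neg_Ioi 0).const_mul a) (by fun_prop) ?_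
  filter_upwards [ae_restrict_mem measurableSet_Ioi] with r (hr : 0 < r)
  have hnonneg : 0 ≤ 1 - Real.exp (-(a * r)) := one_sub_exp_neg_nonneg (by positivity)
  rw [Real.norm_eq_abs, abs_of_nonneg (by positivity)]
  calc Real.exp (-r) / r * (1 - Real.exp (-(a * r))) ≤ Real.exp (-r) / r * (a * r) := by
        gcongr
        linarith [Real.add_one_le_exp (-(a * r))]
    _ = a * Real.exp (-r) := by field_simp

lemma integral_exp_neg_div_mul_one_sub_exp {a : ℝ} (ha : 0 ≤ a) :
    ∫ r in Ioi 0, Real.exp (-r) / r * (1 - Real.exp (-(a * r))) = Real.log (1 + a) := by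
  have hcont : Continuous fun x : ℝ => Real.exp (-x) := by fun_prop
  have heq : ∀ r : ℝ, Real.exp (-r) / r * (1 - Real.exp (-(a * r))) =
      r⁻¹ • (Real.exp (-(1 * r)) - Real.exp (-((1 + a) * r))) := fun r => by
    rw [smul_eq_mul, show -((1 + a) * r) = -r + -(a * r) by ring, Real.exp_add]
    ring_nf
  have hint := integrableOn_exp_neg_div_mul_one_sub_exp ha
  simp only [heq] at hint ⊢
  rw [Frullani.integral_Ioi_eq (f := fun x : ℝ => Real.exp (-x)) (a := 1) (b := 1 + a)
    (L := 1) (R := 0) (hcont.locallyIntegrable.locallyIntegrableOn _) one_pos (by linarith)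
    (by simpa only [neg_zero, Real.exp_zero] using
      (hcont.tendsto 0).mono_left (nhdsWithin_le_nhds (s := Ioi 0)))
    Real.tendsto_exp_neg_atTop_nhds_zero hint]
  simp

lemma lintegral_one_sub_exp_gammaLevyMeasure {a : ℝ} (ha : 0 ≤ a) :
    ∫⁻ r, ENNReal.ofReal (1 - Real.exp (-(a * r))) ∂gammaLevyMeasure =
      ENNReal.ofReal (Real.log (1 + a)) := by
  rw [lintegral_gammaLevyMeasure (by fun_prop), ← integral_exp_neg_div_mul_one_sub_exp ha,
    ofReal_integral_eq_lintegral_ofReal (integrableOn_exp_neg_div_mul_one_sub_exp ha)]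
  · refine setLIntegral_congr_fun measurableSet_Ioi fun r (hr : 0 < r) => ?_
    rw [ENNReal.ofReal_mul (by positivity)]
  · filter_upwards [ae_restrict_mem measurableSet_Ioi] with r (hr : 0 < r)
    exact mul_nonneg (by positivity) (one_sub_exp_neg_nonneg (by positivity))

variable {ι : Type*} [Fintype ι]

/-- The Lévy measure of a Thorin subordinator with Thorin measure `U`: on each ray `ℝ₊ u` it is the
Lévy measure of a gamma process of rate `‖u‖`, mixed over `U(du)`. -/
def thorinLevyMeasure (U : Measure (EuclideanSpace ℝ ι)) : Measure (EuclideanSpace ℝ ι) :=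
  (U.prod gammaLevyMeasure).map fun p => (p.2 / ‖p.1‖ ^ 2) • p.1

lemma measurable_thorinMap :
    Measurable fun p : EuclideanSpace ℝ ι × ℝ => (p.2 / ‖p.1‖ ^ 2) • p.1 := by
  fun_prop

lemma lintegral_thorinLevyMeasure (U : Measure (EuclideanSpace ℝ ι)) [SFinite U]
    {f : EuclideanSpace ℝ ι → ℝ≥0∞} (hf : Measurable f) :
    ∫⁻ x, f x ∂(thorinLevyMeasure U) =
      ∫⁻ u, ∫⁻ r, f ((r / ‖u‖ ^ 2) • u) ∂gammaLevyMeasure ∂U := by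
  rw [thorinLevyMeasure, lintegral_map hf measurable_thorinMap,
    lintegral_prod (fun p => f ((p.2 / ‖p.1‖ ^ 2) • p.1))
      (hf.comp measurable_thorinMap).aemeasurable]

lemma measurableSet_puncturedOrthant : MeasurableSet (puncturedOrthant ι) := by
  have : puncturedOrthant ι = (⋂ i, {u : EuclideanSpace ℝ ι | 0 ≤ u i}) ∩ {0}ᶜ := by
    ext u; simp [puncturedOrthant]
  rw [this]
  exact (MeasurableSet.iInter fun i => measurableSet_le measurable_const (by fun_prop)).inter
    (measurableSet_singleton 0).compl

variable {U : Measure (EuclideanSpace ℝ ι)}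

lemma ae_thorinLevyMeasure_mem (hU : IsThorinMeasure U) :
    ∀ᵐ x ∂(thorinLevyMeasure U), x ∈ puncturedOrthant ι := by
  have := hU.sFinite
  have hzero : ∫⁻ x, (puncturedOrthant ι)ᶜ.indicator 1 x ∂(thorinLevyMeasure U) = 0 := by
    rw [lintegral_thorinLevyMeasure U
      (measurable_one.indicator measurableSet_puncturedOrthant.compl)]
    refine lintegral_eq_zero_of_ae_eq_zero ?_
    filter_upwards [hU.ae_mem] with u hu
    refine lintegral_eq_zero_of_ae_eq_zero ?_
    filter_upwards [ae_gammaLevyMeasure_pos] with r hr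
    have hn : 0 < ‖u‖ := norm_pos_iff.2 hu.2
    have hmem : (r / ‖u‖ ^ 2) • u ∈ puncturedOrthant ι :=
      ⟨fun i => mul_nonneg (by positivity) (hu.1 i), smul_ne_zero (by positivity) hu.2⟩
    simp [hmem]
  rw [lintegral_indicator_one measurableSet_puncturedOrthant.compl] at hzero
  exact mem_ae_iff.2 hzero

lemma inner_nonneg_of_nonneg {l u : EuclideanSpace ℝ ι} (hl : ∀ i, 0 ≤ l i) (hu : ∀ i, 0 ≤ u i) :
    0 ≤ inner ℝ l u := by
  rw [PiLp.inner_apply]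
  exact Finset.sum_nonneg fun i _ => by
    simpa using mul_nonneg (hu i) (hl i)

lemma norm_sq_add_inner_div_norm_sq {l u : EuclideanSpace ℝ ι} (hu : u ≠ 0) :
    (‖u‖ ^ 2 + inner ℝ l u) / ‖u‖ ^ 2 = 1 + inner ℝ l u / ‖u‖ ^ 2 := by
  have : ‖u‖ ≠ 0 := norm_ne_zero_iff.2 hu
  field_simp

lemma lintegral_one_sub_exp_thorinLevyMeasure (hU : IsThorinMeasure U) {l : EuclideanSpace ℝ ι}
    (hl : ∀ i, 0 ≤ l i) :
    ∫⁻ x, ENNReal.ofReal (1 - Real.exp (-(inner ℝ l x))) ∂(thorinLevyMeasure U) =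
      ∫⁻ u, ENNReal.ofReal (Real.log ((‖u‖ ^ 2 + inner ℝ l u) / ‖u‖ ^ 2)) ∂U := by
  have := hU.sFinite
  rw [lintegral_thorinLevyMeasure U (by fun_prop)]
  refine lintegral_congr_ae ?_
  filter_upwards [hU.ae_mem] with u hu
  rw [norm_sq_add_inner_div_norm_sq hu.2, ← lintegral_one_sub_exp_gammaLevyMeasure
    (div_nonneg (inner_nonneg_of_nonneg hl hu.1) (by positivity))]
  refine lintegral_congr fun r => ?_
  rw [inner_smul_right]
  ring_nf

lemma log_one_add_div_le {a x : ℝ} (ha : 0 ≤ a) (hx : 0 < x) :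
    Real.log (1 + a / x) ≤ (1 + a) * thorinWeight x := by
  have hlog : Real.log (1 + a / x) ≤ a / x := by
    linarith [Real.log_le_sub_one_of_pos (show 0 < 1 + a / x by positivity)]
  have hmax := le_max_left 0 (-Real.log x)
  rw [thorinWeight, mul_min_of_nonneg _ _ (by positivity)]
  refine le_min ?_ (hlog.trans ?_)
  · rcases le_total x 1 with h | h
    · calc Real.log (1 + a / x) ≤ Real.log ((1 + a) / x) := by
            refine Real.log_le_log (by positivity) ?_
            rw [add_div, add_le_add_iff_right, le_div_iff₀ hx]
            linarith
        _ = Real.log (1 + a) - Real.log x := Real.log_div (by positivity) hx.ne'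
        _ ≤ (1 + a) * (1 + max 0 (-Real.log x)) := by
            nlinarith [Real.log_le_sub_one_of_pos (show 0 < 1 + a by positivity),
              le_max_right 0 (-Real.log x)]
    · nlinarith [div_le_self ha h]
  · rw [mul_one_div]
    gcongr
    linarith

lemma log_thorinKernel_le {l u : EuclideanSpace ℝ ι} (hl : ∀ i, 0 ≤ l i)
    (hu : u ∈ puncturedOrthant ι) :
    Real.log ((‖u‖ ^ 2 + inner ℝ l u) / ‖u‖ ^ 2) ≤ (1 + ‖l‖) * thorinWeight ‖u‖ := by
  have hpos : 0 < ‖u‖ := norm_pos_iff.2 hu.2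
  have hinner := inner_nonneg_of_nonneg hl hu.1
  have hle : inner ℝ l u / ‖u‖ ^ 2 ≤ ‖l‖ / ‖u‖ := by
    rw [div_le_div_iff₀ (by positivity) hpos]
    nlinarith [real_inner_le_norm l u]
  rw [norm_sq_add_inner_div_norm_sq hu.2]
  exact (Real.log_le_log (by positivity) (by linarith)).trans
    (log_one_add_div_le (norm_nonneg l) hpos)

lemma lintegral_log_thorinKernel_lt_top (hU : IsThorinMeasure U) {l : EuclideanSpace ℝ ι}
    (hl : ∀ i, 0 ≤ l i) :
    ∫⁻ u, ENNReal.ofReal (Real.log ((‖u‖ ^ 2 + inner ℝ l u) / ‖u‖ ^ 2)) ∂U < ∞ := by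
  calc _ ≤ ∫⁻ u, ENNReal.ofReal (1 + ‖l‖) *
        ENNReal.ofReal (thorinWeight ‖u‖) ∂U := by
        refine lintegral_mono_ae ?_
        filter_upwards [hU.ae_mem] with u hu
        rw [← ENNReal.ofReal_mul (by positivity)]
        exact ENNReal.ofReal_le_ofReal (log_thorinKernel_le hl hu)
    _ < ∞ := by
        rw [lintegral_const_mul' _ _ ENNReal.ofReal_ne_top]
        exact ENNReal.mul_lt_top ENNReal.ofReal_lt_top hU.2

/-- The vector `(1, …, 1)`. -/
def ones (ι : Type*) : EuclideanSpace ℝ ι := WithLp.toLp 2 fun _ => 1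

lemma inner_ones (x : EuclideanSpace ℝ ι) : inner ℝ (ones ι) x = ∑ i, x i := by
  simp [ones, PiLp.inner_apply]

lemma norm_le_inner_ones {x : EuclideanSpace ℝ ι} (hx : ∀ i, 0 ≤ x i) :
    ‖x‖ ≤ inner ℝ (ones ι) x := by
  rw [inner_ones]
  exact (norm_le_sum_abs x).trans_eq (Finset.sum_congr rfl fun i _ => abs_of_nonneg (hx i))

lemma min_one_le_two_mul_one_sub_exp {s : ℝ} (hs : 0 ≤ s) :
    min s 1 ≤ 2 * (1 - Real.exp (-s)) := by
  have hexp : Real.exp (-s) ≤ 1 / (1 + s) := by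
    rw [Real.exp_neg, ← one_div]
    exact one_div_le_one_div_of_le (by positivity) (by linarith [Real.add_one_le_exp s])
  have hmin : min s 1 ≤ 2 * (1 - 1 / (1 + s)) := by
    rw [one_sub_div (by positivity), add_sub_cancel_left, ← mul_div_assoc,
      le_div_iff₀ (by positivity)]
    rcases le_total s 1 with h | h
    · rw [min_eq_left h]; nlinarith
    · rw [min_eq_right h]; linarith
  linarith

lemma integrable_min_norm_thorinLevyMeasure (hU : IsThorinMeasure U) :
    Integrable (fun x => min ‖x‖ 1) (thorinLevyMeasure U) := by
  refine ⟨by fun_prop, ?_⟩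
  rw [hasFiniteIntegral_iff_ofReal (ae_of_all _ fun x => by positivity)]
  calc ∫⁻ x, ENNReal.ofReal (min ‖x‖ 1) ∂(thorinLevyMeasure U)
      ≤ ∫⁻ x, ENNReal.ofReal 2 * ENNReal.ofReal (1 - Real.exp (-(inner ℝ (ones ι) x)))
          ∂(thorinLevyMeasure U) := by
        refine lintegral_mono_ae ?_
        filter_upwards [ae_thorinLevyMeasure_mem hU] with x hx
        rw [← ENNReal.ofReal_mul zero_le_two]
        refine ENNReal.ofReal_le_ofReal ?_
        have hle := norm_le_inner_ones hx.1
        exact (min_le_min_right _ hle).trans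
          (min_one_le_two_mul_one_sub_exp ((norm_nonneg x).trans hle))
    _ < ∞ := by
        rw [lintegral_const_mul' _ _ (by simp),
          lintegral_one_sub_exp_thorinLevyMeasure hU (fun _ => by simp [ones])]
        exact ENNReal.mul_lt_top (by simp)
          (lintegral_log_thorinKernel_lt_top hU fun _ => by simp [ones])

lemma isLevyMeasure_of_integrable_min {ν : Measure (EuclideanSpace ℝ ι)} (h0 : ν {0} = 0)
    (hint : Integrable (fun x => min ‖x‖ 1) ν) : IsLevyMeasure ν := by
  refine ⟨h0, ?_⟩
  have hsq : Integrable (fun x => min (‖x‖ ^ 2) 1) ν := by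
    refine Integrable.mono' hint (by fun_prop) (ae_of_all _ fun x => ?_)
    rw [Real.norm_eq_abs, abs_of_nonneg (by positivity)]
    rcases le_total ‖x‖ 1 with h | h
    · rw [min_eq_left h]; exact (min_le_left _ _).trans (by nlinarith [norm_nonneg x])
    · rw [min_eq_right h]; exact min_le_right _ _
  exact (hasFiniteIntegral_iff_ofReal (ae_of_all _ fun x => by positivity)).1 hsq.2

lemma integrableOn_puncturedBall_of_integrable_min {ν : Measure (EuclideanSpace ℝ ι)}
    (hint : Integrable (fun x => min ‖x‖ 1) ν) : IntegrableOn (fun x => x) (puncturedBall ι) ν := by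
  refine Integrable.mono' hint.integrableOn (by fun_prop) ?_
  refine (ae_restrict_iff' measurableSet_puncturedBall).2 (ae_of_all _ fun x hx => ?_)
  have : ‖x‖ ≤ 1 := by simpa using hx.1
  rw [min_eq_left this]

lemma isLevyMeasure_thorinLevyMeasure (hU : IsThorinMeasure U) :
    IsLevyMeasure (thorinLevyMeasure U) := by
  refine isLevyMeasure_of_integrable_min ?_ (integrable_min_norm_thorinLevyMeasure hU)
  refine measure_mono_null ?_ (mem_ae_iff.1 (ae_thorinLevyMeasure_mem hU))
  rintro _ rfl h
  exact h.2 rfl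

lemma integral_one_sub_exp_thorinLevyMeasure (hU : IsThorinMeasure U) {l : EuclideanSpace ℝ ι}
    (hl : ∀ i, 0 ≤ l i) :
    ∫ x, (1 - Real.exp (-(inner ℝ l x))) ∂(thorinLevyMeasure U) =
      ∫ u, Real.log ((‖u‖ ^ 2 + inner ℝ l u) / ‖u‖ ^ 2) ∂U := by
  rw [integral_eq_lintegral_of_nonneg_ae ?_ (by fun_prop), integral_eq_lintegral_of_nonneg_ae ?_
    (Measurable.aestronglyMeasurable (by fun_prop)), lintegral_one_sub_exp_thorinLevyMeasure hU hl]
  · filter_upwards [hU.ae_mem] with u hu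
    rw [norm_sq_add_inner_div_norm_sq hu.2]
    exact Real.log_nonneg (by
      have := div_nonneg (inner_nonneg_of_nonneg hl hu.1) (sq_nonneg ‖u‖)
      linarith)
  · filter_upwards [ae_thorinLevyMeasure_mem hU] with x hx
    exact one_sub_exp_neg_nonneg (inner_nonneg_of_nonneg hl hx.1)

end ThorinLevyMeasure
section LaplaceContinuation

variable {ι : Type*} [Fintype ι]

lemma norm_one_sub_cexp_neg_le {w : ℂ} (hw : 0 ≤ w.re) : ‖1 - Complex.exp (-w)‖ ≤ ‖w‖ := by
  have hconv : Convex ℝ {z : ℂ | z.re ≤ 0} := convex_halfSpace_re_le 0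
  have hmvt := hconv.norm_image_sub_le_of_norm_hasDerivWithin_le (f := Complex.exp)
    (f' := Complex.exp) (C := 1) (x := -w) (y := 0)
    (fun z _ => (Complex.hasDerivAt_exp z).hasDerivWithinAt) (fun z hz => by
      rw [Complex.norm_exp]; exact Real.exp_le_one_iff.2 hz) (by simpa using hw) (by simp)
  simpa using hmvt

lemma norm_one_sub_cexp_neg_le_two {w : ℂ} (hw : 0 ≤ w.re) : ‖1 - Complex.exp (-w)‖ ≤ 2 := by
  refine (norm_sub_le _ _).trans ?_
  rw [Complex.norm_exp, norm_one]
  have : Real.exp (-w).re ≤ 1 := Real.exp_le_one_iff.2 (by simpa using hw)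
  linarith

/-- The complex linear form `x ↦ ⟨ε (1, …, 1) + z θ, x⟩`. On the nonnegative orthant the tilt by
`ε` keeps its real part positive for `z` in a strip around the imaginary axis. -/
def tiltedForm (ε : ℝ) (θ : EuclideanSpace ℝ ι) (z : ℂ) (x : EuclideanSpace ℝ ι) : ℂ :=
  (ε * inner ℝ (ones ι) x : ℝ) + z * (inner ℝ θ x : ℝ)

@[fun_prop]
lemma measurable_tiltedForm (ε : ℝ) (θ : EuclideanSpace ℝ ι) (z : ℂ) :
    Measurable (tiltedForm ε θ z) := by
  unfold tiltedForm; fun_prop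

lemma continuous_tiltedForm_tilt (θ : EuclideanSpace ℝ ι) (z : ℂ) (x : EuclideanSpace ℝ ι) :
    Continuous fun ε => tiltedForm ε θ z x := by
  unfold tiltedForm; fun_prop

lemma hasDerivAt_tiltedForm (ε : ℝ) (θ x : EuclideanSpace ℝ ι) (z : ℂ) :
    HasDerivAt (fun z => tiltedForm ε θ z x) (inner ℝ θ x : ℝ) z := by
  have h := ((hasDerivAt_id z).mul_const ((inner ℝ θ x : ℝ) : ℂ)).const_add
    ((ε * inner ℝ (ones ι) x : ℝ) : ℂ)
  rwa [one_mul] at h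

lemma tiltedForm_ofReal (ε r : ℝ) (θ x : EuclideanSpace ℝ ι) :
    tiltedForm ε θ r x = (inner ℝ (ε • ones ι + r • θ) x : ℝ) := by
  simp [tiltedForm, inner_add_left, inner_smul_left]

lemma tiltedForm_zero_neg_I (θ x : EuclideanSpace ℝ ι) :
    tiltedForm 0 θ (-Complex.I) x = -(Complex.I * (inner ℝ θ x : ℝ)) := by
  simp [tiltedForm]

lemma norm_tiltedForm_le {ε : ℝ} (hε : 0 ≤ ε) (θ : EuclideanSpace ℝ ι) (z : ℂ)
    (x : EuclideanSpace ℝ ι) :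
    ‖tiltedForm ε θ z x‖ ≤ (ε * ‖ones ι‖ + ‖z‖ * ‖θ‖) * ‖x‖ := by
  refine (norm_add_le _ _).trans ?_
  rw [norm_mul, Complex.norm_real, Complex.norm_real, norm_mul, Real.norm_of_nonneg hε, add_mul,
    mul_assoc, mul_assoc]
  gcongr <;> exact norm_inner_le_norm _ _

lemma norm_one_sub_cexp_tiltedForm_le {ε : ℝ} (hε : 0 ≤ ε) (θ : EuclideanSpace ℝ ι) (z : ℂ)
    {x : EuclideanSpace ℝ ι} (hre : 0 ≤ (tiltedForm ε θ z x).re) :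
    ‖1 - Complex.exp (-tiltedForm ε θ z x)‖ ≤ (ε * ‖ones ι‖ + ‖z‖ * ‖θ‖ + 2) * min ‖x‖ 1 := by
  have hsmall := (norm_one_sub_cexp_neg_le hre).trans (norm_tiltedForm_le hε θ z x)
  have hlarge := norm_one_sub_cexp_neg_le_two hre
  have hconst : 0 ≤ ε * ‖ones ι‖ + ‖z‖ * ‖θ‖ := by positivity
  rcases le_total ‖x‖ 1 with h | h
  · rw [min_eq_left h]; nlinarith [norm_nonneg x]
  · rw [min_eq_right h]; nlinarith

/-- The half width of the strip on which `tiltedForm` has positive real part. -/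
def tiltWidth (ε : ℝ) (θ : EuclideanSpace ℝ ι) : ℝ := ε / (2 * (‖θ‖ + 1))

lemma tiltWidth_pos {ε : ℝ} (hε : 0 < ε) (θ : EuclideanSpace ℝ ι) : 0 < tiltWidth ε θ := by
  unfold tiltWidth; positivity

lemma tiltWidth_mul_le {ε : ℝ} (hε : 0 < ε) (θ : EuclideanSpace ℝ ι) :
    tiltWidth ε θ * ‖θ‖ ≤ ε / 2 := by
  unfold tiltWidth
  rw [div_mul_eq_mul_div, div_le_div_iff₀ (by positivity) two_pos]
  nlinarith [norm_nonneg θ]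

/-- The strip around the imaginary axis on which the tilted Laplace exponent is holomorphic. -/
def tiltStrip (ε : ℝ) (θ : EuclideanSpace ℝ ι) : Set ℂ := {z | |z.re| < tiltWidth ε θ}

lemma isOpen_tiltStrip (ε : ℝ) (θ : EuclideanSpace ℝ ι) : IsOpen (tiltStrip ε θ) :=
  isOpen_lt (by fun_prop) continuous_const

lemma isPreconnected_tiltStrip (ε : ℝ) (θ : EuclideanSpace ℝ ι) :
    IsPreconnected (tiltStrip ε θ) := by
  have hinter : tiltStrip ε θ = {z | -tiltWidth ε θ < z.re} ∩ {z | z.re < tiltWidth ε θ} := by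
    ext z; simp [tiltStrip, abs_lt]
  rw [hinter]
  exact ((convex_halfSpace_re_gt _).inter (convex_halfSpace_re_lt _)).isPreconnected

lemma mem_tiltStrip_of_re_eq_zero {ε : ℝ} (hε : 0 < ε) (θ : EuclideanSpace ℝ ι) {z : ℂ}
    (hz : z.re = 0) : z ∈ tiltStrip ε θ := by
  simpa [tiltStrip, hz] using tiltWidth_pos hε θ

lemma re_tiltedForm_ge {ε : ℝ} (hε : 0 < ε) {θ : EuclideanSpace ℝ ι} {z : ℂ}
    (hz : z ∈ tiltStrip ε θ) {x : EuclideanSpace ℝ ι} (hx : ∀ i, 0 ≤ x i) :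
    ε / 2 * ‖x‖ ≤ (tiltedForm ε θ z x).re := by
  have habs : |z.re * inner ℝ θ x| ≤ ε / 2 * ‖x‖ := by
    rw [abs_mul]
    calc |z.re| * |inner ℝ θ x| ≤ tiltWidth ε θ * (‖θ‖ * ‖x‖) :=
          mul_le_mul hz.le (abs_real_inner_le_norm θ x) (abs_nonneg _) (tiltWidth_pos hε θ).le
      _ = tiltWidth ε θ * ‖θ‖ * ‖x‖ := by ring
      _ ≤ ε / 2 * ‖x‖ := by gcongr; exact tiltWidth_mul_le hε θ
  have hones := norm_le_inner_ones hx
  have hneg := (abs_le.1 habs).1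
  simp only [tiltedForm, Complex.add_re, Complex.ofReal_re, Complex.re_mul_ofReal]
  nlinarith

lemma re_tiltedForm_nonneg {ε : ℝ} (hε : 0 < ε) {θ : EuclideanSpace ℝ ι} {z : ℂ}
    (hz : z ∈ tiltStrip ε θ) {x : EuclideanSpace ℝ ι} (hx : ∀ i, 0 ≤ x i) :
    0 ≤ (tiltedForm ε θ z x).re :=
  le_trans (by positivity) (re_tiltedForm_ge hε hz hx)

lemma smul_ones_add_smul_nonneg {ε : ℝ} (hε : 0 < ε) {θ : EuclideanSpace ℝ ι} {r : ℝ}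
    (hr : |r| < tiltWidth ε θ) (i : ι) : 0 ≤ (ε • ones ι + r • θ) i := by
  have habs : |r * θ i| ≤ ε := by
    rw [abs_mul]
    calc |r| * |θ i| ≤ tiltWidth ε θ * ‖θ‖ :=
          mul_le_mul hr.le (PiLp.norm_apply_le θ i) (abs_nonneg _) (tiltWidth_pos hε θ).le
      _ ≤ ε / 2 := tiltWidth_mul_le hε θ
      _ ≤ ε := by linarith
  have hneg := (abs_le.1 habs).1
  simp only [ones, PiLp.add_apply, PiLp.smul_apply, smul_eq_mul, mul_one]
  linarith

lemma mul_exp_neg_le_min {ε x : ℝ} (hε : 0 < ε) (hx : 0 ≤ x) :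
    x * Real.exp (-(ε / 2 * x)) ≤ (1 + 2 / ε) * min x 1 := by
  have hεx : 0 ≤ ε / 2 * x := by positivity
  have hexp : Real.exp (-(ε / 2 * x)) ≤ 1 := Real.exp_le_one_iff.2 (by linarith)
  have h2ε : 0 < 2 / ε := by positivity
  rcases le_total x 1 with h | h
  · rw [min_eq_left h]; nlinarith
  · rw [min_eq_right h, mul_one, Real.exp_neg, ← div_eq_mul_inv, div_le_iff₀ (Real.exp_pos _)]
    have hcancel : 2 / ε * (ε / 2 * x) = x := by field_simp
    nlinarith [Real.add_one_le_exp (ε / 2 * x), Real.exp_pos (ε / 2 * x)]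

lemma norm_deriv_cexp_tiltedForm_le {ε : ℝ} (hε : 0 < ε) {θ : EuclideanSpace ℝ ι} {z : ℂ}
    (hz : z ∈ tiltStrip ε θ) {x : EuclideanSpace ℝ ι} (hx : ∀ i, 0 ≤ x i) :
    ‖((inner ℝ θ x : ℝ) : ℂ) * Complex.exp (-tiltedForm ε θ z x)‖ ≤
      ‖θ‖ * (1 + 2 / ε) * min ‖x‖ 1 := by
  have hexp : Real.exp (-(tiltedForm ε θ z x).re) ≤ Real.exp (-(ε / 2 * ‖x‖)) :=
    Real.exp_le_exp.2 (neg_le_neg (re_tiltedForm_ge hε hz hx))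
  rw [norm_mul, Complex.norm_exp, Complex.norm_real, Complex.neg_re, mul_assoc]
  calc ‖inner ℝ θ x‖ * Real.exp (-(tiltedForm ε θ z x).re)
      ≤ (‖θ‖ * ‖x‖) * Real.exp (-(ε / 2 * ‖x‖)) := by
        gcongr
        exact norm_inner_le_norm _ _
    _ = ‖θ‖ * (‖x‖ * Real.exp (-(ε / 2 * ‖x‖))) := by ring
    _ ≤ _ := mul_le_mul_of_nonneg_left (mul_exp_neg_le_min hε (norm_nonneg x)) (norm_nonneg θ)

/-- The Laplace exponent `∫ (1 - exp (-⟨l, x⟩)) ν(dx)` along the complex line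
`l = ε (1, …, 1) + z θ`. -/
def tiltedExponent (ν : Measure (EuclideanSpace ℝ ι)) (ε : ℝ) (θ : EuclideanSpace ℝ ι) (z : ℂ) :
    ℂ :=
  ∫ x, (1 - Complex.exp (-tiltedForm ε θ z x)) ∂ν

variable {ν : Measure (EuclideanSpace ℝ ι)}

lemma tiltedExponent_ofReal (ε r : ℝ) (θ : EuclideanSpace ℝ ι) :
    tiltedExponent ν ε θ r = (∫ x, (1 - Real.exp (-inner ℝ (ε • ones ι + r • θ) x)) ∂ν : ℝ) := by
  simp_rw [tiltedExponent, tiltedForm_ofReal, ← integral_complex_ofReal]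
  norm_cast

lemma integrable_one_sub_cexp_tiltedForm (hν : Integrable (fun x => min ‖x‖ 1) ν)
    (hpos : ∀ᵐ x ∂ν, ∀ i, 0 ≤ x i) {ε : ℝ} (hε : 0 < ε) {θ : EuclideanSpace ℝ ι} {z : ℂ}
    (hz : z ∈ tiltStrip ε θ) :
    Integrable (fun x => 1 - Complex.exp (-tiltedForm ε θ z x)) ν := by
  refine Integrable.mono' (hν.const_mul (ε * ‖ones ι‖ + ‖z‖ * ‖θ‖ + 2)) (by fun_prop) ?_
  filter_upwards [hpos] with x hx
  exact norm_one_sub_cexp_tiltedForm_le hε.le θ z (re_tiltedForm_nonneg hε hz hx)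

lemma differentiableOn_tiltedExponent (hν : Integrable (fun x => min ‖x‖ 1) ν)
    (hpos : ∀ᵐ x ∂ν, ∀ i, 0 ≤ x i) {ε : ℝ} (hε : 0 < ε) (θ : EuclideanSpace ℝ ι) :
    DifferentiableOn ℂ (tiltedExponent ν ε θ) (tiltStrip ε θ) := by
  intro z hz
  have hderiv := hasDerivAt_integral_of_dominated_loc_of_deriv_le (μ := ν)
    (F := fun z x => 1 - Complex.exp (-tiltedForm ε θ z x))
    (F' := fun z x => (inner ℝ θ x : ℝ) * Complex.exp (-tiltedForm ε θ z x))
    (bound := fun x => ‖θ‖ * (1 + 2 / ε) * min ‖x‖ 1) ((isOpen_tiltStrip ε θ).mem_nhds hz)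
    (Eventually.of_forall fun z => by fun_prop)
    (integrable_one_sub_cexp_tiltedForm hν hpos hε hz) (by fun_prop) ?_ (hν.const_mul _) ?_
  · exact hderiv.2.differentiableAt.differentiableWithinAt
  · filter_upwards [hpos] with x hx w hw using norm_deriv_cexp_tiltedForm_le hε hw hx
  · refine ae_of_all _ fun x w _ => ?_
    have hneg : HasDerivAt (fun z => -tiltedForm ε θ z x) (-(inner ℝ θ x : ℝ)) w :=
      (hasDerivAt_tiltedForm ε θ x w).neg
    convert hneg.cexp.const_sub 1 using 1
    ring

lemma tendsto_tiltedExponent (hν : Integrable (fun x => min ‖x‖ 1) ν)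
    (hpos : ∀ᵐ x ∂ν, ∀ i, 0 ≤ x i) (θ : EuclideanSpace ℝ ι) :
    Tendsto (fun ε => tiltedExponent ν ε θ (-Complex.I)) (𝓝[>] 0)
      (𝓝 (∫ x, (1 - Complex.exp (Complex.I * (inner ℝ θ x : ℝ))) ∂ν)) := by
  refine tendsto_integral_filter_of_dominated_convergence
    (fun x => (‖ones ι‖ + ‖θ‖ + 2) * min ‖x‖ 1) (Eventually.of_forall fun ε => by fun_prop) ?_
    (hν.const_mul _) (ae_of_all _ fun x => ?_)
  · filter_upwards [Ioc_mem_nhdsGT one_pos] with ε hε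
    filter_upwards [hpos] with x hx
    have hmem : -Complex.I ∈ tiltStrip ε θ := mem_tiltStrip_of_re_eq_zero hε.1 θ (by simp)
    refine (norm_one_sub_cexp_tiltedForm_le hε.1.le θ _
      (re_tiltedForm_nonneg hε.1 hmem hx)).trans ?_
    rw [norm_neg, Complex.norm_I, one_mul]
    gcongr
    exact mul_le_of_le_one_left (norm_nonneg _) hε.2
  · have hcont : Continuous fun ε => 1 - Complex.exp (-tiltedForm ε θ (-Complex.I) x) := by
      have := continuous_tiltedForm_tilt θ (-Complex.I) x
      fun_prop
    have hlim := (hcont.tendsto 0).mono_left (nhdsWithin_le_nhds (s := Ioi 0))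
    rwa [tiltedForm_zero_neg_I, neg_neg] at hlim

lemma integrable_min_norm_one_of_isFiniteMeasure [IsFiniteMeasure ν] :
    Integrable (fun x => min ‖x‖ 1) ν :=
  Integrable.mono' (integrable_const 1) (by fun_prop) (ae_of_all _ fun x => by
    rw [Real.norm_eq_abs, abs_of_nonneg (by positivity)]; exact min_le_right _ _)

lemma integrable_exp_neg_inner [IsFiniteMeasure ν] (hpos : ∀ᵐ x ∂ν, ∀ i, 0 ≤ x i)
    {l : EuclideanSpace ℝ ι} (hl : ∀ i, 0 ≤ l i) :
    Integrable (fun x => Real.exp (-inner ℝ l x)) ν := by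
  refine Integrable.mono' (integrable_const 1) (by fun_prop) ?_
  filter_upwards [hpos] with x hx
  rw [Real.norm_eq_abs, Real.abs_exp]
  exact Real.exp_le_one_iff.2 (neg_nonpos.2 (inner_nonneg_of_nonneg hl hx))

variable {ρ : Measure (EuclideanSpace ℝ ι)} [IsProbabilityMeasure ρ] {t : ℝ}
  {d : EuclideanSpace ℝ ι}

lemma one_sub_tiltedExponent_ofReal_eq (hρ : ∀ᵐ x ∂ρ, ∀ i, 0 ≤ x i)
    (hlap : ∀ l : EuclideanSpace ℝ ι, (∀ i, 0 ≤ l i) → ∫ x, Real.exp (-inner ℝ l x) ∂ρ =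
      Real.exp (-(t * inner ℝ d l + t * ∫ x, (1 - Real.exp (-inner ℝ l x)) ∂ν)))
    {ε : ℝ} (hε : 0 < ε) {θ : EuclideanSpace ℝ ι} {r : ℝ} (hr : |r| < tiltWidth ε θ) :
    1 - tiltedExponent ρ ε θ r =
      Complex.exp (-(t * (tiltedForm ε θ r d + tiltedExponent ν ε θ r))) := by
  have hl := smul_ones_add_smul_nonneg hε hr
  have hρexp : ∫ x, (1 - Real.exp (-inner ℝ (ε • ones ι + r • θ) x)) ∂ρ =
      1 - ∫ x, Real.exp (-inner ℝ (ε • ones ι + r • θ) x) ∂ρ := by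
    rw [integral_sub (integrable_const 1) (integrable_exp_neg_inner hρ hl)]
    simp
  rw [tiltedExponent_ofReal, tiltedExponent_ofReal, tiltedForm_ofReal, hρexp, hlap _ hl,
    real_inner_comm d, mul_add]
  norm_cast
  rw [sub_sub_cancel]

lemma frequently_ofReal_nhdsNE_zero {p : ℂ → Prop} (h : ∀ᶠ r : ℝ in 𝓝 0, p r) :
    ∃ᶠ z in 𝓝[≠] (0 : ℂ), p z := by
  have hmap : Tendsto (fun r : ℝ => (r : ℂ)) (𝓝[≠] 0) (𝓝[≠] 0) := by
    refine tendsto_nhdsWithin_iff.2 ⟨?_, ?_⟩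
    · exact (Complex.continuous_ofReal.tendsto' 0 0 (by simp)).mono_left nhdsWithin_le_nhds
    · filter_upwards [self_mem_nhdsWithin] with r hr
      simpa using hr
  exact hmap.frequently (h.filter_mono nhdsWithin_le_nhds).frequently

lemma eqOn_one_sub_tiltedExponent (hρ : ∀ᵐ x ∂ρ, ∀ i, 0 ≤ x i)
    (hν : Integrable (fun x => min ‖x‖ 1) ν) (hpos : ∀ᵐ x ∂ν, ∀ i, 0 ≤ x i)
    (hlap : ∀ l : EuclideanSpace ℝ ι, (∀ i, 0 ≤ l i) → ∫ x, Real.exp (-inner ℝ l x) ∂ρ =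
      Real.exp (-(t * inner ℝ d l + t * ∫ x, (1 - Real.exp (-inner ℝ l x)) ∂ν)))
    {ε : ℝ} (hε : 0 < ε) (θ : EuclideanSpace ℝ ι) :
    EqOn (fun z => 1 - tiltedExponent ρ ε θ z)
      (fun z => Complex.exp (-(t * (tiltedForm ε θ z d + tiltedExponent ν ε θ z))))
      (tiltStrip ε θ) := by
  have hopen := isOpen_tiltStrip ε θ
  have hform : Differentiable ℂ fun z => tiltedForm ε θ z d :=
    fun z => (hasDerivAt_tiltedForm ε θ d z).differentiableAt
  have hleft := ((differentiableOn_const (1 : ℂ)).sub (differentiableOn_tiltedExponent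
    integrable_min_norm_one_of_isFiniteMeasure hρ hε θ)).analyticOnNhd hopen
  have hright := ((hform.differentiableOn.add
    (differentiableOn_tiltedExponent hν hpos hε θ)).const_mul (t : ℂ)).neg.cexp.analyticOnNhd hopen
  refine hleft.eqOn_of_preconnected_of_frequently_eq hright (isPreconnected_tiltStrip ε θ)
    (mem_tiltStrip_of_re_eq_zero hε θ Complex.zero_re) (frequently_ofReal_nhdsNE_zero ?_)
  filter_upwards [Metric.ball_mem_nhds (0 : ℝ) (tiltWidth_pos hε θ)] with r hr
  exact one_sub_tiltedExponent_ofReal_eq hρ hlap hε (by simpa using hr)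

lemma charFun_eq_one_sub_integral (θ : EuclideanSpace ℝ ι) :
    charFun ρ θ = 1 - ∫ x, (1 - Complex.exp (Complex.I * (inner ℝ θ x : ℝ))) ∂ρ := by
  have hint : Integrable (fun x => Complex.exp (Complex.I * (inner ℝ θ x : ℝ))) ρ :=
    Integrable.mono' (integrable_const 1) (by fun_prop) (ae_of_all _ fun x => by
      rw [Complex.norm_exp_I_mul_ofReal])
  rw [integral_sub (integrable_const 1) hint, charFun_apply]
  simp [real_inner_comm, mul_comm]

theorem charFun_of_laplace (hρ : ∀ᵐ x ∂ρ, ∀ i, 0 ≤ x i)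
    (hν : Integrable (fun x => min ‖x‖ 1) ν) (hpos : ∀ᵐ x ∂ν, ∀ i, 0 ≤ x i)
    (hlap : ∀ l : EuclideanSpace ℝ ι, (∀ i, 0 ≤ l i) → ∫ x, Real.exp (-inner ℝ l x) ∂ρ =
      Real.exp (-(t * inner ℝ d l + t * ∫ x, (1 - Real.exp (-inner ℝ l x)) ∂ν)))
    (θ : EuclideanSpace ℝ ι) :
    charFun ρ θ = Complex.exp (t * (Complex.I * (inner ℝ d θ : ℝ) +
      ∫ x, (Complex.exp (Complex.I * (inner ℝ θ x : ℝ)) - 1) ∂ν)) := by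
  have hleft := (tendsto_tiltedExponent (ν := ρ) integrable_min_norm_one_of_isFiniteMeasure
    hρ θ).const_sub 1
  have hform : Tendsto (fun ε => tiltedForm ε θ (-Complex.I) d) (𝓝[>] 0)
      (𝓝 (tiltedForm 0 θ (-Complex.I) d)) :=
    ((continuous_tiltedForm_tilt θ (-Complex.I) d).tendsto 0).mono_left nhdsWithin_le_nhds
  have hright := ((hform.add (tendsto_tiltedExponent hν hpos θ)).const_mul (t : ℂ)).neg.cexp
  have heq : ∀ᶠ ε : ℝ in 𝓝[>] 0, 1 - tiltedExponent ρ ε θ (-Complex.I) =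
      Complex.exp (-(t * (tiltedForm ε θ (-Complex.I) d + tiltedExponent ν ε θ (-Complex.I)))) := by
    filter_upwards [self_mem_nhdsWithin] with ε (hε : 0 < ε)
    exact eqOn_one_sub_tiltedExponent hρ hν hpos hlap hε θ
      (mem_tiltStrip_of_re_eq_zero hε θ (by simp))
  rw [charFun_eq_one_sub_integral, tendsto_nhds_unique (hleft.congr' heq) hright,
    tiltedForm_zero_neg_I, real_inner_comm, ← mul_neg, neg_add, neg_neg, ← integral_neg]
  simp only [neg_sub]

end LaplaceContinuation

section ThorinSubordinator

variable {ι : Type*} [Fintype ι] {Ω : Type*} [MeasurableSpace Ω] {P : Measure Ω}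
  {T : ℝ≥0 → Ω → EuclideanSpace ℝ ι} {d : EuclideanSpace ℝ ι} {U : Measure (EuclideanSpace ℝ ι)}

lemma IsSubordinator.ae_nonneg (hT : IsSubordinator P T) (t : ℝ≥0) :
    ∀ᵐ x ∂(P.map (T t)), ∀ i, 0 ≤ x i := by
  rw [ae_map_iff (hT.1.measurable t).aemeasurable]
  · filter_upwards [hT.1.zero, hT.2] with ω hzero hmono i
    simpa [hzero] using hmono i (zero_le (a := t))
  · simp only [ofPred_forall]
    exact MeasurableSet.iInter fun i => measurableSet_le measurable_const (by fun_prop)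

lemma quadForm_zero (θ : EuclideanSpace ℝ ι) : quadForm 0 θ = 0 := by simp [quadForm]

lemma IsThorinSubordinator.laplace_eq [IsProbabilityMeasure P] (hT : IsThorinSubordinator P T d U)
    (t : ℝ≥0) {l : EuclideanSpace ℝ ι} (hl : ∀ i, 0 ≤ l i) :
    ∫ x, Real.exp (-inner ℝ l x) ∂(P.map (T t)) = Real.exp (-(t * inner ℝ d l +
      t * ∫ x, (1 - Real.exp (-inner ℝ l x)) ∂(thorinLevyMeasure U))) := by
  have hmeas := hT.subordinator.1.measurable t
  have := Measure.isProbabilityMeasure_map (μ := P) hmeas.aemeasurable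
  have hint := integrable_exp_neg_inner (hT.subordinator.ae_nonneg t) hl
  rw [integral_one_sub_exp_thorinLevyMeasure hT.thorin hl, ← hT.laplace t l hl, neg_neg,
    ← integral_map hmeas.aemeasurable (f := fun x => Real.exp (-inner ℝ l x)) (by fun_prop),
    Real.exp_log (integral_exp_pos hint)]

theorem IsThorinSubordinator.triplet [IsProbabilityMeasure P] (hT : IsThorinSubordinator P T d U)
    {m : EuclideanSpace ℝ ι} {S : Matrix ι ι ℝ} {τ : Measure (EuclideanSpace ℝ ι)}
    (hL : IsLevy P T m S τ) :
    τ = thorinLevyMeasure U ∧ m = d + ∫ x in puncturedBall ι, x ∂(thorinLevyMeasure U) := by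
  have hint := integrable_min_norm_thorinLevyMeasure hT.thorin
  have hlev := isLevyMeasure_thorinLevyMeasure hT.thorin
  have hpos : ∀ᵐ x ∂(thorinLevyMeasure U), ∀ i, 0 ≤ x i := by
    filter_upwards [ae_thorinLevyMeasure_mem hT.thorin] with x hx using hx.1
  have hexp : ∀ θ, levyExponent m S τ θ = levyExponent
      (d + ∫ x in puncturedBall ι, x ∂(thorinLevyMeasure U)) 0 (thorinLevyMeasure U) θ := by
    intro θ
    refine eq_of_forall_cexp_mul_eq fun t => ?_
    have := Measure.isProbabilityMeasure_map (μ := P)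
      (hT.subordinator.1.measurable t).aemeasurable
    rw [← hL.charFun_eq, charFun_of_laplace (hT.subordinator.ae_nonneg t) hint hpos
        (fun l hl => hT.laplace_eq t hl),
      levyExponent_add_integral_puncturedBall hlev
        (integrableOn_puncturedBall_of_integrable_min hint), quadForm_zero]
    simp
  obtain ⟨hm, -, hτ⟩ := levyTriplet_unique (quadForm_nonneg hL.covariance)
    (fun a => (quadForm_zero a).ge) hL.levyMeasure hlev hexp
  exact ⟨hτ, hm⟩

end ThorinSubordinator

section ThorinTail

variable {ι : Type*} [Fintype ι] {U : Measure (EuclideanSpace ℝ ι)} {q y : ℝ}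

lemma IsThorinMeasure.measure_closedBall_lt_top (hU : IsThorinMeasure U) :
    U (Metric.closedBall 0 1) < ∞ := by
  refine lt_of_le_of_lt ?_ hU.2
  calc U (Metric.closedBall 0 1) = ∫⁻ _ in Metric.closedBall 0 1, 1 ∂U := by simp
    _ ≤ ∫⁻ u in Metric.closedBall 0 1, ENNReal.ofReal (thorinWeight ‖u‖) ∂U := by
        refine lintegral_mono_ae ?_
        filter_upwards [ae_restrict_of_ae hU.ae_mem, ae_restrict_mem measurableSet_closedBall]
          with u hu hball
        have hle : ‖u‖ ≤ 1 := by simpa using hball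
        rw [← ENNReal.ofReal_one]
        refine ENNReal.ofReal_le_ofReal (le_min ?_ ?_)
        · linarith [le_max_left 0 (-Real.log ‖u‖)]
        · rwa [le_div_iff₀ (norm_pos_iff.2 hu.2), one_mul]
    _ ≤ _ := setLIntegral_le_lintegral _ _

/-- The `q`-th moment of the jumps of size at most `1` of a gamma process with rate `y`. -/
def gammaSmallMoment (q y : ℝ) : ℝ≥0∞ :=
  ∫⁻ r in Ioc 0 y, ENNReal.ofReal (Real.exp (-r) / r * (r / y) ^ q)

lemma norm_div_norm_sq_smul {u : EuclideanSpace ℝ ι} (hu : u ≠ 0) {r : ℝ} (hr : 0 < r) :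
    ‖(r / ‖u‖ ^ 2) • u‖ = r / ‖u‖ := by
  have : 0 < ‖u‖ := norm_pos_iff.2 hu
  rw [norm_smul, Real.norm_of_nonneg (by positivity)]
  field_simp

lemma div_norm_sq_smul_mem_puncturedBall {u : EuclideanSpace ℝ ι} (hu : u ≠ 0) {r : ℝ}
    (hr : 0 < r) : (r / ‖u‖ ^ 2) • u ∈ puncturedBall ι ↔ r ≤ ‖u‖ := by
  have hpos : 0 < ‖u‖ := norm_pos_iff.2 hu
  have hne : (r / ‖u‖ ^ 2) • u ≠ 0 := smul_ne_zero (by positivity) hu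
  simp [puncturedBall, hne, norm_div_norm_sq_smul hu hr, div_le_one hpos]

lemma lintegral_puncturedBall_thorinLevyMeasure (hU : IsThorinMeasure U) (q : ℝ) :
    ∫⁻ x in puncturedBall ι, ENNReal.ofReal (‖x‖ ^ q) ∂(thorinLevyMeasure U) =
      ∫⁻ u, gammaSmallMoment q ‖u‖ ∂U := by
  have := hU.sFinite
  have hmeas : Measurable ((puncturedBall ι).indicator fun x => ENNReal.ofReal (‖x‖ ^ q)) :=
    Measurable.indicator (by fun_prop) measurableSet_puncturedBall
  rw [← lintegral_indicator measurableSet_puncturedBall, lintegral_thorinLevyMeasure U hmeas]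
  refine lintegral_congr_ae ?_
  filter_upwards [hU.ae_mem] with u hu
  rw [lintegral_gammaLevyMeasure (f := fun r => (puncturedBall ι).indicator
    (fun x => ENNReal.ofReal (‖x‖ ^ q)) ((r / ‖u‖ ^ 2) • u)) (hmeas.comp (by fun_prop)),
    gammaSmallMoment, ← Iic_inter_Ioi, ← setLIntegral_indicator measurableSet_Iic]
  refine setLIntegral_congr_fun measurableSet_Ioi fun r (hr : 0 < r) => ?_
  have hmem := div_norm_sq_smul_mem_puncturedBall hu.2 hr
  by_cases hru : r ≤ ‖u‖
  · rw [indicator_of_mem (hmem.2 hru), indicator_of_mem (mem_Iic.2 hru),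
      norm_div_norm_sq_smul hu.2 hr, ← ENNReal.ofReal_mul (by positivity)]
  · rw [indicator_of_notMem (fun h => hru (hmem.1 h)), indicator_of_notMem (mem_Iic.not.2 hru),
      mul_zero]

lemma gammaSmallMoment_eq (q : ℝ) (hy : 0 < y) :
    gammaSmallMoment q y = ENNReal.ofReal (1 / y ^ q) *
      ∫⁻ r in Ioc 0 y, ENNReal.ofReal (Real.exp (-r) * r ^ (q - 1)) := by
  rw [gammaSmallMoment, ← lintegral_const_mul' _ _ ENNReal.ofReal_ne_top]
  refine setLIntegral_congr_fun measurableSet_Ioc fun r hr => ?_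
  have hr0 := hr.1
  rw [← ENNReal.ofReal_mul (by positivity), Real.div_rpow hr0.le hy.le, Real.rpow_sub_one hr0.ne']
  congr 1
  field_simp

lemma lintegral_Ioc_rpow_sub_one (hq : 0 < q) (hy : 0 ≤ y) :
    ∫⁻ r in Ioc 0 y, ENNReal.ofReal (r ^ (q - 1)) = ENNReal.ofReal (y ^ q / q) := by
  have hint : IntervalIntegrable (fun r : ℝ => r ^ (q - 1)) volume 0 y :=
    intervalIntegral.intervalIntegrable_rpow' (by linarith)
  have hval : ∫ r in Ioc 0 y, r ^ (q - 1) = y ^ q / q := by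
    rw [← intervalIntegral.integral_of_le hy, integral_rpow (Or.inl (by linarith)),
      sub_add_cancel, Real.zero_rpow hq.ne', sub_zero]
  rw [← hval, ofReal_integral_eq_lintegral_ofReal
    ((intervalIntegrable_iff_integrableOn_Ioc_of_le hy).1 hint)]
  filter_upwards [ae_restrict_mem measurableSet_Ioc] with r hr using Real.rpow_nonneg hr.1.le _

lemma gammaSmallMoment_le_one_div (hq : 0 < q) (hy : 0 < y) :
    gammaSmallMoment q y ≤ ENNReal.ofReal (1 / q) := by
  have := Real.rpow_pos_of_pos hy q
  calc gammaSmallMoment q y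
      ≤ ENNReal.ofReal (1 / y ^ q) * ∫⁻ r in Ioc 0 y, ENNReal.ofReal (r ^ (q - 1)) := by
        rw [gammaSmallMoment_eq q hy]
        refine mul_le_mul_right (setLIntegral_mono' measurableSet_Ioc fun r hr =>
          ENNReal.ofReal_le_ofReal ?_) _
        exact mul_le_of_le_one_left (Real.rpow_nonneg hr.1.le _)
          (Real.exp_le_one_iff.2 (by linarith [hr.1]))
    _ = ENNReal.ofReal (1 / q) := by
        rw [lintegral_Ioc_rpow_sub_one hq hy.le, ← ENNReal.ofReal_mul (by positivity)]
        field_simp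

lemma gammaSmallMoment_le (q : ℝ) (hy : 0 < y) :
    gammaSmallMoment q y ≤ ENNReal.ofReal (1 / y ^ q) *
      ∫⁻ r in Ioi 0, ENNReal.ofReal (Real.exp (-r) * r ^ (q - 1)) := by
  rw [gammaSmallMoment_eq q hy]
  exact mul_le_mul_right (lintegral_mono_set Ioc_subset_Ioi_self) _

lemma le_gammaSmallMoment (hq : 0 < q) (hy : 1 ≤ y) :
    ENNReal.ofReal (Real.exp (-1) / q) * ENNReal.ofReal (1 / y ^ q) ≤ gammaSmallMoment q y := by
  rw [gammaSmallMoment_eq q (by linarith), mul_comm]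
  gcongr
  calc ENNReal.ofReal (Real.exp (-1) / q)
      = ∫⁻ r in Ioc (0 : ℝ) 1, ENNReal.ofReal (Real.exp (-1)) * ENNReal.ofReal (r ^ (q - 1)) := by
        rw [lintegral_const_mul' _ _ ENNReal.ofReal_ne_top,
          lintegral_Ioc_rpow_sub_one hq zero_le_one, ← ENNReal.ofReal_mul (Real.exp_pos _).le,
          Real.one_rpow, mul_one_div]
    _ ≤ ∫⁻ r in Ioc (0 : ℝ) 1, ENNReal.ofReal (Real.exp (-r) * r ^ (q - 1)) := by
        refine setLIntegral_mono' measurableSet_Ioc fun r hr => ?_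
        rw [← ENNReal.ofReal_mul (Real.exp_pos _).le]
        have hexp : Real.exp (-1) ≤ Real.exp (-r) := Real.exp_le_exp.2 (neg_le_neg hr.2)
        exact ENNReal.ofReal_le_ofReal
          (mul_le_mul_of_nonneg_right hexp (Real.rpow_nonneg hr.1.le _))
    _ ≤ _ := lintegral_mono_set (Ioc_subset_Ioc_right hy)

lemma smallJumpsFinite_thorinLevyMeasure (hU : IsThorinMeasure U) (hq : 0 < q)
    (h : ThorinTailFinite U q) : SmallJumpsFinite (thorinLevyMeasure U) q := by
  have hΓ : ∫⁻ r in Ioi 0, ENNReal.ofReal (Real.exp (-r) * r ^ (q - 1)) < ∞ :=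
    (Real.GammaIntegral_convergent hq).lintegral_lt_top
  rw [SmallJumpsFinite, lintegral_puncturedBall_thorinLevyMeasure hU,
    ← lintegral_add_compl _ (measurableSet_closedBall (x := (0 : EuclideanSpace ℝ ι)) (ε := 1))]
  refine ENNReal.add_lt_top.2 ⟨?_, ?_⟩
  · calc ∫⁻ u in Metric.closedBall 0 1, gammaSmallMoment q ‖u‖ ∂U
        ≤ ∫⁻ u in Metric.closedBall 0 1, ENNReal.ofReal (1 / q) ∂U := by
          refine lintegral_mono_ae (ae_restrict_of_ae ?_)
          filter_upwards [hU.ae_mem] with u hu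
            using gammaSmallMoment_le_one_div hq (norm_pos_iff.2 hu.2)
      _ < ∞ := by
          rw [setLIntegral_const]
          exact ENNReal.mul_lt_top ENNReal.ofReal_lt_top hU.measure_closedBall_lt_top
  · calc ∫⁻ u in (Metric.closedBall 0 1)ᶜ, gammaSmallMoment q ‖u‖ ∂U
        ≤ ∫⁻ u in (Metric.closedBall 0 1)ᶜ, (ENNReal.ofReal (1 / ‖u‖ ^ q) *
            ∫⁻ r in Ioi 0, ENNReal.ofReal (Real.exp (-r) * r ^ (q - 1))) ∂U := by
          refine lintegral_mono_ae (ae_restrict_of_ae ?_)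
          filter_upwards [hU.ae_mem] with u hu
            using gammaSmallMoment_le q (norm_pos_iff.2 hu.2)
      _ < ∞ := by
          rw [lintegral_mul_const' _ _ hΓ.ne]
          exact ENNReal.mul_lt_top h hΓ

lemma thorinTailFinite_of_smallJumpsFinite (hU : IsThorinMeasure U) (hq : 0 < q)
    (h : SmallJumpsFinite (thorinLevyMeasure U) q) : ThorinTailFinite U q := by
  rw [SmallJumpsFinite, lintegral_puncturedBall_thorinLevyMeasure hU] at h
  have hlt : ENNReal.ofReal (Real.exp (-1) / q) *
      ∫⁻ u in (Metric.closedBall 0 1)ᶜ, ENNReal.ofReal (1 / ‖u‖ ^ q) ∂U < ∞ := by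
    rw [← lintegral_const_mul' _ _ ENNReal.ofReal_ne_top]
    refine lt_of_le_of_lt ?_ h
    refine (setLIntegral_mono' measurableSet_closedBall.compl fun u hu => ?_).trans
      (setLIntegral_le_lintegral _ _)
    exact le_gammaSmallMoment hq (le_of_lt (by simpa using hu))
  refine ENNReal.lt_top_of_mul_ne_top_right hlt.ne ?_
  rw [ne_eq, ENNReal.ofReal_eq_zero, not_le]
  positivity

theorem thorinTailFinite_iff (hU : IsThorinMeasure U) (hq : 0 < q) :
    ThorinTailFinite U q ↔ SmallJumpsFinite (thorinLevyMeasure U) q :=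
  ⟨smallJumpsFinite_thorinLevyMeasure hU hq, thorinTailFinite_of_smallJumpsFinite hU hq⟩

end ThorinTail

section Coordinates

variable {ι : Type*} [Fintype ι] {Ω : Type*} [MeasurableSpace Ω] {P : Measure Ω}

lemma charFun_map_coord [DecidableEq ι] {Z : Ω → EuclideanSpace ℝ ι} (hZ : Measurable Z) (k : ι)
    (r : ℝ) :
    charFun (P.map fun ω => Z ω k) r = charFun (P.map Z) (EuclideanSpace.single k r) := by
  rw [charFun_apply_real, charFun_apply, integral_map (by fun_prop) (by fun_prop),
    integral_map hZ.aemeasurable (by fun_prop)]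
  simp [EuclideanSpace.inner_single_right]

lemma quadForm_single [DecidableEq ι] (S : Matrix ι ι ℝ) (k : ι) (r : ℝ) :
    quadForm S (EuclideanSpace.single k r) = S k k * r ^ 2 := by
  rw [quadForm, Finset.sum_eq_single k (fun l _ hl => by simp [hl]) (by simp),
    Finset.sum_eq_single k (fun l _ hl => by simp [hl]) (by simp)]
  simp only [PiLp.single_apply, if_true]
  ring

lemma posSemidef_diag_pos {S : Matrix ι ι ℝ} [DecidableEq ι] (hS : S.PosSemidef) (hu : IsUnit S)
    (k : ι) : 0 < S k k :=
  (hS.posDef_iff_isUnit.2 hu).diag_pos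

end Coordinates

section MeasurableTime

variable {ι : Type*} [Fintype ι] {Ω : Type*} [MeasurableSpace Ω] {P : Measure Ω}
  {B : ℝ≥0 → Ω → EuclideanSpace ℝ ι}

lemma IsLevyProcess.measurable_uncurry_dyadicCeil (hB : IsLevyProcess P B) (m : ℕ) (i : ι) :
    Measurable fun p : ℝ≥0 × Ω => B (dyadicCeil m p.1) p.2 i := by
  have hgrid : Measurable fun p : ℕ × Ω => B (dyadicPoint m p.1) p.2 i :=
    measurable_from_prod_countable_right fun j => by
      have := hB.measurable (dyadicPoint m j)
      change Measurable fun ω => B (dyadicPoint m j) ω i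
      fun_prop
  have hindex : Measurable fun p : ℝ≥0 × Ω => (⌈p.1 * 2 ^ m⌉₊, p.2) :=
    Measurable.prodMk (Nat.measurable_ceil.comp (by fun_prop)) measurable_snd
  have hcomp := hgrid.comp hindex
  simp only [Function.comp_def] at hcomp
  unfold dyadicCeil
  exact hcomp

/-- The approximation of `multiTime` from the right along dyadic times. -/
def dyadicMultiTime (B : ℝ≥0 → Ω → EuclideanSpace ℝ ι) (m : ℕ) (p : EuclideanSpace ℝ ι × Ω) :
    EuclideanSpace ℝ ι :=
  WithLp.toLp 2 fun i => B (dyadicCeil m (p.1 i).toNNReal) p.2 i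

lemma IsLevyProcess.measurable_dyadicMultiTime (hB : IsLevyProcess P B) (m : ℕ) :
    Measurable (dyadicMultiTime B m) := by
  refine (WithLp.measurable_toLp 2 _).comp (measurable_pi_lambda _ fun i => ?_)
  have htime : Measurable fun p : EuclideanSpace ℝ ι × Ω => ((p.1 i).toNNReal, p.2) := by fun_prop
  have hcomp := (hB.measurable_uncurry_dyadicCeil m i).comp htime
  simp only [Function.comp_def] at hcomp
  exact hcomp

lemma IsLevyProcess.ae_tendsto_dyadicMultiTime (hB : IsLevyProcess P B) :
    ∀ᵐ ω ∂P, ∀ t, Tendsto (fun m => dyadicMultiTime B m (t, ω)) atTop (𝓝 (multiTime B t ω)) := by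
  filter_upwards [hB.cadlag] with ω hω t
  refine ((PiLp.continuous_toLp 2 (fun _ : ι => ℝ)).tendsto _).comp (tendsto_pi_nhds.2 fun i => ?_)
  exact ((PiLp.continuous_apply 2 (fun _ : ι => ℝ) i).tendsto _).comp
    ((hω (t i).toNNReal).1.tendsto.comp (tendsto_dyadicCeil (t i).toNNReal))

theorem IsLevyProcess.exists_measurable_multiTime (hB : IsLevyProcess P B) :
    ∃ g : EuclideanSpace ℝ ι × Ω → EuclideanSpace ℝ ι, Measurable g ∧
      ∀ᵐ ω ∂P, ∀ t, multiTime B t ω = g (t, ω) := by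
  refine ⟨fun p => limUnder atTop fun m => dyadicMultiTime B m p,
    (StronglyMeasurable.limUnder
      fun m => (hB.measurable_dyadicMultiTime m).stronglyMeasurable).measurable, ?_⟩
  filter_upwards [hB.ae_tendsto_dyadicMultiTime] with ω hω t
  exact (hω t).limUnder_eq.symm

lemma IsLevyProcess.measurable_multiTime (hB : IsLevyProcess P B) (t : EuclideanSpace ℝ ι) :
    Measurable (multiTime B t) := by
  refine (WithLp.measurable_toLp 2 _).comp (measurable_pi_lambda _ fun i => ?_)
  have := hB.measurable (t i).toNNReal
  fun_prop

end MeasurableTime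

section Brownian

variable {ι : Type*} [Fintype ι] {Ω : Type*} [MeasurableSpace Ω] {P : Measure Ω}
  {B : ℝ≥0 → Ω → EuclideanSpace ℝ ι} {μ : EuclideanSpace ℝ ι} {S : Matrix ι ι ℝ}

lemma IsBrownianMotion.map_coord_eq_gaussianReal [IsProbabilityMeasure P]
    (hB : IsBrownianMotion P B μ S) (s : ℝ≥0) (k : ι) :
    P.map (fun ω => B s ω k) = gaussianReal (s * μ k) (s * (S k k).toNNReal) := by
  classical
  have hm := hB.isLevyProcess.measurable s
  have : IsProbabilityMeasure (P.map fun ω => B s ω k) :=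
    Measure.isProbabilityMeasure_map (by fun_prop)
  refine Measure.ext_of_charFun (funext fun r => ?_)
  rw [charFun_map_coord hm, hB.charFun_eq, charFun_gaussianReal, levyExponent_eq, quadForm_single]
  congr 1
  simp only [integral_zero_measure, EuclideanSpace.inner_single_right, NNReal.coe_mul,
    Real.coe_toNNReal _ hB.covariance.diag_nonneg, conj_trivial]
  push_cast
  ring

lemma integral_sq_gaussianReal (m : ℝ) (v : ℝ≥0) : ∫ x, x ^ 2 ∂(gaussianReal m v) = v + m ^ 2 := by
  have h := variance_eq_sub (memLp_id_gaussianReal (μ := m) (v := v) 2)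
  rw [variance_id_gaussianReal] at h
  simp only [Pi.pow_apply, id_eq, integral_id_gaussianReal] at h
  linarith

lemma IsBrownianMotion.lintegral_sq_coord [IsProbabilityMeasure P]
    (hB : IsBrownianMotion P B μ S) (s : ℝ≥0) (k : ι) :
    ∫⁻ ω, ENNReal.ofReal ((B s ω k) ^ 2) ∂P = ENNReal.ofReal (s * S k k + (s * μ k) ^ 2) := by
  have hm := hB.isLevyProcess.measurable s
  have hint : Integrable (fun x : ℝ => x ^ 2) (gaussianReal (s * μ k) (s * (S k k).toNNReal)) :=
    (memLp_id_gaussianReal 2).integrable_sq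
  rw [← lintegral_map (μ := P) (f := fun x : ℝ => ENNReal.ofReal (x ^ 2))
      (g := fun ω => B s ω k) (by fun_prop) (by fun_prop),
    hB.map_coord_eq_gaussianReal, ← ofReal_integral_eq_lintegral_ofReal hint
    (ae_of_all _ fun x => sq_nonneg x), integral_sq_gaussianReal, NNReal.coe_mul,
    Real.coe_toNNReal _ hB.covariance.diag_nonneg]

lemma norm_sq_multiTime {Ω : Type*} (B : ℝ≥0 → Ω → EuclideanSpace ℝ ι) (t : EuclideanSpace ℝ ι)
    (ω : Ω) :
    ‖multiTime B t ω‖ ^ 2 = ∑ i, (B (t i).toNNReal ω i) ^ 2 := by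
  simp [EuclideanSpace.norm_sq_eq, multiTime]

/-- The constant `C` in the bound `E ‖B(t)‖² ≤ C ‖t‖`, `‖t‖ ≤ 1`, for a Brownian motion with
drift `μ` and covariance `S`. -/
def momentConst (μ : EuclideanSpace ℝ ι) (S : Matrix ι ι ℝ) : ℝ := ∑ k, (S k k + (μ k) ^ 2)

lemma momentConst_nonneg (hS : S.PosSemidef) : 0 ≤ momentConst μ S :=
  Finset.sum_nonneg fun _ _ => add_nonneg hS.diag_nonneg (sq_nonneg _)

lemma IsBrownianMotion.lintegral_norm_sq_le [IsProbabilityMeasure P]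
    (hB : IsBrownianMotion P B μ S) {t : EuclideanSpace ℝ ι} (ht : ∀ i, 0 ≤ t i) (ht1 : ‖t‖ ≤ 1) :
    ∫⁻ ω, ENNReal.ofReal (‖multiTime B t ω‖ ^ 2) ∂P ≤ ENNReal.ofReal (momentConst μ S * ‖t‖) := by
  have hS (i : ι) : 0 ≤ S i i := hB.covariance.diag_nonneg
  calc ∫⁻ ω, ENNReal.ofReal (‖multiTime B t ω‖ ^ 2) ∂P
      = ∑ i, ∫⁻ ω, ENNReal.ofReal ((B (t i).toNNReal ω i) ^ 2) ∂P := by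
        simp_rw [norm_sq_multiTime,
          ENNReal.ofReal_sum_of_nonneg fun i (_ : i ∈ Finset.univ) => sq_nonneg _]
        refine lintegral_finsetSum _ fun i _ => ?_
        have := hB.isLevyProcess.measurable (t i).toNNReal
        fun_prop
    _ = ENNReal.ofReal (∑ i, (t i * S i i + (t i * μ i) ^ 2)) := by
        rw [ENNReal.ofReal_sum_of_nonneg fun i _ =>
          add_nonneg (mul_nonneg (ht i) (hS i)) (sq_nonneg _)]
        simp_rw [hB.lintegral_sq_coord, Real.coe_toNNReal _ (ht _)]
    _ ≤ ENNReal.ofReal (momentConst μ S * ‖t‖) := by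
        rw [momentConst, Finset.sum_mul]
        refine ENNReal.ofReal_le_ofReal (Finset.sum_le_sum fun i _ => ?_)
        have hle : t i ≤ ‖t‖ := (le_abs_self _).trans (PiLp.norm_apply_le t i)
        have hsq : t i ^ 2 ≤ ‖t‖ := by nlinarith [ht i]
        nlinarith [hS i, sq_nonneg (μ i)]

lemma rpow_le_add_mul {q a y : ℝ} (hq0 : 0 ≤ q) (hq1 : q ≤ 1) (ha : 0 < a) (hy : 0 ≤ y) :
    y ^ q ≤ a ^ q + a ^ (q - 1) * y := by
  rcases le_total y a with hya | hay
  · exact (Real.rpow_le_rpow hy hya hq0).trans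
      (le_add_of_nonneg_right (mul_nonneg (Real.rpow_nonneg ha.le _) hy))
  · have hy0 : 0 < y := ha.trans_le hay
    calc y ^ q = y ^ (q - 1) * y := by rw [Real.rpow_sub_one hy0.ne', div_mul_cancel₀ _ hy0.ne']
      _ ≤ a ^ (q - 1) * y :=
        mul_le_mul_of_nonneg_right (Real.rpow_le_rpow_of_nonpos ha hay (by linarith)) hy
      _ ≤ _ := le_add_of_nonneg_left (Real.rpow_nonneg ha.le _)

theorem IsBrownianMotion.lintegral_rpow_le [IsProbabilityMeasure P]
    (hB : IsBrownianMotion P B μ S) {q : ℝ} (hq0 : 0 ≤ q) (hq1 : q ≤ 1) {t : EuclideanSpace ℝ ι}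
    (ht : t ∈ puncturedOrthant ι) (ht1 : ‖t‖ ≤ 1) :
    ∫⁻ ω, ENNReal.ofReal (‖multiTime B t ω‖ ^ (2 * q)) ∂P ≤
      ENNReal.ofReal (1 + momentConst μ S) * ENNReal.ofReal (‖t‖ ^ q) := by
  have ht0 : 0 < ‖t‖ := norm_pos_iff.2 ht.2
  have hC := momentConst_nonneg (μ := μ) hB.covariance
  have hp := Real.rpow_nonneg ht0.le q
  have hp1 := Real.rpow_nonneg ht0.le (q - 1)
  calc ∫⁻ ω, ENNReal.ofReal (‖multiTime B t ω‖ ^ (2 * q)) ∂P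
      ≤ ∫⁻ ω, (ENNReal.ofReal (‖t‖ ^ q) + ENNReal.ofReal (‖t‖ ^ (q - 1)) *
          ENNReal.ofReal (‖multiTime B t ω‖ ^ 2)) ∂P := by
        refine lintegral_mono fun ω => ?_
        rw [← ENNReal.ofReal_mul hp1, ← ENNReal.ofReal_add hp (by positivity)]
        refine ENNReal.ofReal_le_ofReal ?_
        rw [Real.rpow_mul (norm_nonneg _), Real.rpow_two]
        exact rpow_le_add_mul hq0 hq1 ht0 (sq_nonneg _)
    _ = ENNReal.ofReal (‖t‖ ^ q) + ENNReal.ofReal (‖t‖ ^ (q - 1)) *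
          ∫⁻ ω, ENNReal.ofReal (‖multiTime B t ω‖ ^ 2) ∂P := by
        rw [lintegral_add_left measurable_const, lintegral_const_mul' _ _ ENNReal.ofReal_ne_top,
          lintegral_const, measure_univ, mul_one]
    _ ≤ ENNReal.ofReal (‖t‖ ^ q) + ENNReal.ofReal (‖t‖ ^ (q - 1)) *
          ENNReal.ofReal (momentConst μ S * ‖t‖) := by
        gcongr
        exact hB.lintegral_norm_sq_le ht.1 ht1
    _ = _ := by
        rw [← ENNReal.ofReal_mul hp1, ← ENNReal.ofReal_add hp (by positivity),
          ← ENNReal.ofReal_mul (by positivity), Real.rpow_sub_one ht0.ne']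
        congr 1
        field_simp

lemma gaussianPDFReal_le (m : ℝ) {v : ℝ≥0} (hv : v ≠ 0) (x : ℝ) :
    gaussianPDFReal m v x ≤ 1 / (2 * √v) := by
  have hv0 : (0 : ℝ) < v := by positivity
  have hexp : Real.exp (-(x - m) ^ 2 / (2 * v)) ≤ 1 := by
    refine Real.exp_le_one_iff.2 (div_nonpos_of_nonpos_of_nonneg ?_ (by positivity))
    linarith [sq_nonneg (x - m)]
  have hsqrt : 2 * √v ≤ √(2 * Real.pi * v) := by
    refine Real.le_sqrt_of_sq_le ?_
    rw [mul_pow, Real.sq_sqrt hv0.le]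
    nlinarith [Real.pi_gt_three]
  have : 0 < 2 * √(v : ℝ) := by positivity
  rw [gaussianPDFReal_def]
  calc (√(2 * Real.pi * v))⁻¹ * Real.exp (-(x - m) ^ 2 / (2 * v))
      ≤ (2 * √(v : ℝ))⁻¹ * 1 := by gcongr
    _ = _ := by rw [mul_one, one_div]

lemma gaussianReal_Ioo_le (m : ℝ) {v : ℝ≥0} (hv : v ≠ 0) (a : ℝ) :
    gaussianReal m v (Ioo (-a) a) ≤ ENNReal.ofReal (a / √v) := by
  have : (0 : ℝ) < v := by positivity
  rw [gaussianReal_apply _ hv]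
  calc ∫⁻ x in Ioo (-a) a, gaussianPDF m v x
      ≤ ∫⁻ _ in Ioo (-a) a, ENNReal.ofReal (1 / (2 * √v)) :=
        lintegral_mono fun x => ENNReal.ofReal_le_ofReal (gaussianPDFReal_le m hv x)
    _ = ENNReal.ofReal (a / √v) := by
        rw [setLIntegral_const, Real.volume_Ioo, ← ENNReal.ofReal_mul (by positivity)]
        congr 1
        field

lemma IsBrownianMotion.measure_one_lt_norm_le [IsProbabilityMeasure P]
    (hB : IsBrownianMotion P B μ S) {t : EuclideanSpace ℝ ι} (ht : ∀ i, 0 ≤ t i) (ht1 : ‖t‖ ≤ 1) :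
    P {ω | 1 < ‖multiTime B t ω‖} ≤ ENNReal.ofReal (momentConst μ S * ‖t‖) := by
  have hmeas := hB.isLevyProcess.measurable_multiTime t
  calc P {ω | 1 < ‖multiTime B t ω‖}
      ≤ P {ω | 1 ≤ ENNReal.ofReal (‖multiTime B t ω‖ ^ 2)} :=
        measure_mono fun ω hω => ENNReal.one_le_ofReal.2 (one_le_pow₀ (le_of_lt hω))
    _ ≤ ∫⁻ ω, ENNReal.ofReal (‖multiTime B t ω‖ ^ 2) ∂P := by
        simpa only [one_mul] using mul_meas_ge_le_lintegral (μ := P)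
          (f := fun ω => ENNReal.ofReal (‖multiTime B t ω‖ ^ 2)) (by fun_prop) 1
    _ ≤ _ := hB.lintegral_norm_sq_le ht ht1

lemma IsBrownianMotion.measure_abs_coord_lt_le [IsProbabilityMeasure P]
    (hB : IsBrownianMotion P B μ S) {k : ι} {σ : ℝ} (hσ : 0 < σ) (hk : σ ≤ S k k) {s : ℝ≥0}
    (hs : 0 < s) :
    P {ω | |B s ω k| < √(s * σ) / 2} ≤ ENNReal.ofReal (1 / 2) := by
  have hm := hB.isLevyProcess.measurable s
  have hmk : Measurable fun ω => B s ω k := by fun_prop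
  have hSk : 0 < S k k := hσ.trans_le hk
  have : (0 : ℝ) < s := hs
  have hv : s * (S k k).toNNReal ≠ 0 := mul_ne_zero hs.ne' (Real.toNNReal_pos.2 hSk).ne'
  have hpre : {ω | |B s ω k| < √(s * σ) / 2} =
      (fun ω => B s ω k) ⁻¹' Ioo (-(√(s * σ) / 2)) (√(s * σ) / 2) := by
    ext ω; simp only [mem_ofPred_eq, abs_lt, mem_preimage, mem_Ioo]
  rw [hpre, ← Measure.map_apply hmk measurableSet_Ioo, hB.map_coord_eq_gaussianReal]
  refine (gaussianReal_Ioo_le _ hv _).trans (ENNReal.ofReal_le_ofReal ?_)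
  rw [NNReal.coe_mul, Real.coe_toNNReal _ hSk.le, div_le_iff₀ (by positivity)]
  have : √(s * σ) ≤ √(s * S k k) := Real.sqrt_le_sqrt (by gcongr)
  linarith

lemma exists_norm_le_card_mul [Nonempty ι] {t : EuclideanSpace ℝ ι} (ht : ∀ i, 0 ≤ t i) :
    ∃ k, ‖t‖ ≤ Fintype.card ι * t k := by
  obtain ⟨k, -, hk⟩ := Finset.exists_max_image Finset.univ (fun k => t k) Finset.univ_nonempty
  refine ⟨k, (norm_le_inner_ones ht).trans ?_⟩
  rw [inner_ones]
  simpa [nsmul_eq_mul] using Finset.sum_le_card_nsmul Finset.univ (fun i => t i) (t k) hk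

lemma le_measure_diff [IsProbabilityMeasure P] {A N : Set Ω}
    (hA : P Aᶜ ≤ ENNReal.ofReal (1 / 4)) (hN : P N ≤ ENNReal.ofReal (1 / 2)) :
    ENNReal.ofReal (1 / 4) ≤ P (A \ N) := by
  have hsum : (1 : ℝ≥0∞) ≤ P (A \ N) + ENNReal.ofReal (3 / 4) :=
    calc (1 : ℝ≥0∞) = P ((A \ N) ∪ (Aᶜ ∪ N)) := by
          rw [show (A \ N) ∪ (Aᶜ ∪ N) = univ by ext; simp; tauto, measure_univ]
      _ ≤ P (A \ N) + (P Aᶜ + P N) :=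
        (measure_union_le _ _).trans (by gcongr; exact measure_union_le _ _)
      _ ≤ P (A \ N) + (ENNReal.ofReal (1 / 4) + ENNReal.ofReal (1 / 2)) := by gcongr
      _ = _ := by rw [← ENNReal.ofReal_add (by norm_num) (by norm_num)]; norm_num
  have hone : ENNReal.ofReal (1 / 4) + ENNReal.ofReal (3 / 4) = 1 := by
    rw [← ENNReal.ofReal_add (by norm_num) (by norm_num)]
    norm_num
  rw [← hone] at hsum
  exact (ENNReal.add_le_add_iff_right ENNReal.ofReal_ne_top).1 hsum

lemma div_mul_norm_le_norm_sq_multiTime {Ω : Type*} {B : ℝ≥0 → Ω → EuclideanSpace ℝ ι} {σ N : ℝ}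
    (hσ : 0 ≤ σ) (hN : 0 < N) {t : EuclideanSpace ℝ ι} {k : ι} (ht : 0 ≤ t k)
    (htk : ‖t‖ ≤ N * t k) {ω : Ω} (hω : √(t k * σ) / 2 ≤ |B (t k).toNNReal ω k|) :
    σ / (4 * N) * ‖t‖ ≤ ‖multiTime B t ω‖ ^ 2 :=
  calc σ / (4 * N) * ‖t‖ ≤ σ / (4 * N) * (N * t k) := by gcongr
    _ = (√(t k * σ) / 2) ^ 2 := by
        rw [div_pow, Real.sq_sqrt (by positivity)]
        field
    _ ≤ |B (t k).toNNReal ω k| ^ 2 := by gcongr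
    _ ≤ ‖multiTime B t ω‖ ^ 2 := by
        rw [norm_sq_multiTime, sq_abs]
        exact Finset.single_le_sum (f := fun i => (B (t i).toNNReal ω i) ^ 2)
          (fun i _ => sq_nonneg _) (Finset.mem_univ k)

lemma IsBrownianMotion.le_lintegral_rpow [IsProbabilityMeasure P]
    (hB : IsBrownianMotion P B μ S) {σ q : ℝ} (hσ : 0 < σ) (hq : 0 ≤ q) {N : ℝ} (hN : 0 < N)
    {t : EuclideanSpace ℝ ι} (ht : t ∈ puncturedOrthant ι) (ht1 : ‖t‖ ≤ 1)
    (htC : momentConst μ S * ‖t‖ ≤ 1 / 4) {k : ι} (hk : σ ≤ S k k) (htk : ‖t‖ ≤ N * t k) :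
    ENNReal.ofReal (1 / 4 * (σ / (4 * N)) ^ q) * ENNReal.ofReal (‖t‖ ^ q) ≤
      ∫⁻ ω in {ω | ‖multiTime B t ω‖ ≤ 1}, ENNReal.ofReal (‖multiTime B t ω‖ ^ (2 * q)) ∂P := by
  have htk0 : 0 < t k := pos_of_mul_pos_right ((norm_pos_iff.2 ht.2).trans_le htk) hN.le
  have hcoe : ((t k).toNNReal : ℝ) = t k := Real.coe_toNNReal _ htk0.le
  have hm := hB.isLevyProcess.measurable (t k).toNNReal
  have hmeas := hB.isLevyProcess.measurable_multiTime t
  set A := {ω | ‖multiTime B t ω‖ ≤ 1}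
  set N₀ := {ω | |B (t k).toNNReal ω k| < √((t k).toNNReal * σ) / 2}
  have hA : MeasurableSet A := measurableSet_le hmeas.norm measurable_const
  have hN₀ : MeasurableSet N₀ := measurableSet_lt (by fun_prop) measurable_const
  have hAc : P Aᶜ ≤ ENNReal.ofReal (1 / 4) := by
    simpa only [A, compl_ofPred, not_le] using
      (hB.measure_one_lt_norm_le ht.1 ht1).trans (ENNReal.ofReal_le_ofReal htC)
  -- With probability at least `1/4`, `‖B(t)‖ ≤ 1` while `B_k(t_k)` is not abnormally small.
  have hprob : ENNReal.ofReal (1 / 4) ≤ P (A \ N₀) :=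
    le_measure_diff hAc (hB.measure_abs_coord_lt_le hσ hk (Real.toNNReal_pos.2 htk0))
  have hlow : ∀ ω ∈ A \ N₀, (σ / (4 * N)) ^ q * ‖t‖ ^ q ≤ ‖multiTime B t ω‖ ^ (2 * q) :=
    fun ω hω => by
      have hω' : √(t k * σ) / 2 ≤ |B (t k).toNNReal ω k| := by
        simpa only [N₀, mem_ofPred_eq, not_lt, hcoe] using hω.2
      rw [← Real.mul_rpow (by positivity) (norm_nonneg _), Real.rpow_mul (norm_nonneg _),
        Real.rpow_two]
      exact Real.rpow_le_rpow (by positivity)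
        (div_mul_norm_le_norm_sq_multiTime hσ.le hN htk0.le htk hω') hq
  calc ENNReal.ofReal (1 / 4 * (σ / (4 * N)) ^ q) * ENNReal.ofReal (‖t‖ ^ q)
      = ENNReal.ofReal ((σ / (4 * N)) ^ q * ‖t‖ ^ q) * ENNReal.ofReal (1 / 4) := by
        rw [← ENNReal.ofReal_mul (by positivity), ← ENNReal.ofReal_mul (by positivity)]
        congr 1; ring
    _ ≤ ∫⁻ _ in A \ N₀, ENNReal.ofReal ((σ / (4 * N)) ^ q * ‖t‖ ^ q) ∂P := by
        rw [setLIntegral_const]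
        gcongr
    _ ≤ ∫⁻ ω in A \ N₀, ENNReal.ofReal (‖multiTime B t ω‖ ^ (2 * q)) ∂P :=
        setLIntegral_mono' (hA.diff hN₀) fun ω hω => ENNReal.ofReal_le_ofReal (hlow ω hω)
    _ ≤ _ := lintegral_mono_set sdiff_subset

theorem IsBrownianMotion.exists_le_lintegral_rpow [IsProbabilityMeasure P]
    (hB : IsBrownianMotion P B μ S) (hS : ∀ k, 0 < S k k) {q : ℝ} (hq : 0 ≤ q) :
    ∃ δ > 0, ∃ c > 0, δ ≤ 1 ∧ ∀ t ∈ puncturedOrthant ι, ‖t‖ ≤ δ →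
      ENNReal.ofReal c * ENNReal.ofReal (‖t‖ ^ q) ≤
        ∫⁻ ω in {ω | ‖multiTime B t ω‖ ≤ 1}, ENNReal.ofReal (‖multiTime B t ω‖ ^ (2 * q)) ∂P := by
  rcases isEmpty_or_nonempty ι with hι | hι
  · exact ⟨1, one_pos, 1, one_pos, le_rfl, fun t ht => absurd (Subsingleton.elim t 0) ht.2⟩
  obtain ⟨k₀, -, hk₀⟩ := Finset.exists_min_image Finset.univ (fun k => S k k) Finset.univ_nonempty
  have hσ := hS k₀
  have hC := momentConst_nonneg (μ := μ) hB.covariance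
  have hN : (0 : ℝ) < Fintype.card ι := by exact_mod_cast Fintype.card_pos
  have hδ : 1 / (4 * (momentConst μ S + 1)) ≤ 1 := by
    rw [div_le_one (by positivity)]
    linarith
  refine ⟨1 / (4 * (momentConst μ S + 1)), by positivity,
    1 / 4 * (S k₀ k₀ / (4 * Fintype.card ι)) ^ q, by positivity, hδ, fun t ht htδ => ?_⟩
  obtain ⟨k, hk⟩ := exists_norm_le_card_mul ht.1
  refine hB.le_lintegral_rpow hσ hq hN ht (htδ.trans hδ) ?_ (hk₀ k (Finset.mem_univ k)) hk
  calc momentConst μ S * ‖t‖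
      ≤ (momentConst μ S + 1) * (1 / (4 * (momentConst μ S + 1))) := by gcongr; linarith
    _ = 1 / 4 := by field_simp

end Brownian

section Pair

variable {ι : Type*}

/-- The projection of `ℝ^{2n}` to its last `n` coordinates. -/
def lastBlock (x : EuclideanSpace ℝ (ι ⊕ ι)) : EuclideanSpace ℝ ι :=
  WithLp.toLp 2 fun i => x (Sum.inr i)

@[fun_prop]
lemma measurable_lastBlock : Measurable (lastBlock (ι := ι)) := by
  refine (WithLp.measurable_toLp 2 _).comp (measurable_pi_lambda _ fun i => ?_)
  fun_prop

@[simp]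
lemma lastBlock_pair (t x : EuclideanSpace ℝ ι) : lastBlock (pair t x) = x := rfl

lemma measurable_pair : Measurable fun p : EuclideanSpace ℝ ι × EuclideanSpace ℝ ι =>
    pair p.1 p.2 := by
  refine (WithLp.measurable_toLp 2 _).comp (measurable_pi_lambda _ fun i => ?_)
  rcases i with i | i
  · simp only [Sum.elim_inl]; fun_prop
  · simp only [Sum.elim_inr]; fun_prop

variable [Fintype ι]

lemma norm_lastBlock_le (x : EuclideanSpace ℝ (ι ⊕ ι)) : ‖lastBlock x‖ ≤ ‖x‖ := by
  refine (sq_le_sq₀ (norm_nonneg _) (norm_nonneg _)).1 ?_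
  rw [EuclideanSpace.real_norm_sq_eq x, EuclideanSpace.real_norm_sq_eq, Fintype.sum_sum_type]
  exact le_add_of_nonneg_left (Finset.sum_nonneg fun i _ => sq_nonneg _)

lemma inner_pair_zero (θ : EuclideanSpace ℝ ι) (x : EuclideanSpace ℝ (ι ⊕ ι)) :
    inner ℝ (pair 0 θ) x = (inner ℝ θ (lastBlock x) : ℝ) := by
  simp [PiLp.inner_apply, Fintype.sum_sum_type, pair, lastBlock]

lemma quadForm_fromBlocks_pair (D : Matrix ι ι ℝ) (θ : EuclideanSpace ℝ ι) :
    quadForm (Matrix.fromBlocks 0 0 0 D) (pair 0 θ) = quadForm D θ := by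
  simp [quadForm, Fintype.sum_sum_type, pair]

end Pair

section LastBlock

variable {ι : Type*} {ζ : Measure (EuclideanSpace ℝ (ι ⊕ ι))}

/-- The Lévy measure of the last block of coordinates of a Lévy process with Lévy measure `ζ`. -/
def lastBlockLevyMeasure (ζ : Measure (EuclideanSpace ℝ (ι ⊕ ι))) :
    Measure (EuclideanSpace ℝ ι) :=
  (ζ.map lastBlock).restrict {0}ᶜ

lemma indicator_compl_singleton_eq_self {α E : Type*} [Zero E] {a : α} {f : α → E}
    (ha : f a = 0) : ({a}ᶜ : Set α).indicator f = f :=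
  indicator_eq_self.2 fun _ hx h => hx (mem_singleton_iff.1 h ▸ ha)

lemma lintegral_lastBlockLevyMeasure [Finite ι] (ζ : Measure (EuclideanSpace ℝ (ι ⊕ ι)))
    {f : EuclideanSpace ℝ ι → ℝ≥0∞} (hf : Measurable f) (h0 : f 0 = 0) :
    ∫⁻ y, f y ∂(lastBlockLevyMeasure ζ) = ∫⁻ x, f (lastBlock x) ∂ζ := by
  rw [lastBlockLevyMeasure, ← lintegral_indicator (measurableSet_singleton _).compl,
    indicator_compl_singleton_eq_self h0, lintegral_map hf measurable_lastBlock]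

lemma integral_lastBlockLevyMeasure [Finite ι] {F : Type*} [NormedAddCommGroup F] [NormedSpace ℝ F]
    (ζ : Measure (EuclideanSpace ℝ (ι ⊕ ι)))
    {f : EuclideanSpace ℝ ι → F} (hf : StronglyMeasurable f) (h0 : f 0 = 0) :
    ∫ y, f y ∂(lastBlockLevyMeasure ζ) = ∫ x, f (lastBlock x) ∂ζ := by
  rw [lastBlockLevyMeasure, ← integral_indicator (measurableSet_singleton _).compl,
    indicator_compl_singleton_eq_self h0,
    integral_map measurable_lastBlock.aemeasurable hf.aestronglyMeasurable]

variable [Fintype ι]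

lemma isLevyMeasure_lastBlockLevyMeasure (hζ : IsLevyMeasure ζ) :
    IsLevyMeasure (lastBlockLevyMeasure ζ) := by
  refine ⟨by simp [lastBlockLevyMeasure], ?_⟩
  rw [lintegral_lastBlockLevyMeasure ζ (by fun_prop) (by simp)]
  refine lt_of_le_of_lt (lintegral_mono fun x => ENNReal.ofReal_le_ofReal ?_) hζ.2
  have := norm_lastBlock_le x
  gcongr

/-- The set where the last block is small but the whole vector is not, so that only the whole
vector escapes the truncation in the Lévy-Khintchine formula. -/
def truncationGap (ι : Type*) [Fintype ι] : Set (EuclideanSpace ℝ (ι ⊕ ι)) :=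
  {x | ‖lastBlock x‖ ≤ 1 ∧ 1 < ‖x‖}

lemma measurableSet_truncationGap : MeasurableSet (truncationGap ι) :=
  (measurableSet_le measurable_lastBlock.norm measurable_const).inter
    (measurableSet_lt measurable_const measurable_norm)

lemma integrableOn_lastBlock_truncationGap (hζ : IsLevyMeasure ζ) :
    IntegrableOn lastBlock (truncationGap ι) ζ := by
  refine Integrable.mono' hζ.integrable_min.integrableOn
    measurable_lastBlock.aestronglyMeasurable ?_
  refine (ae_restrict_iff' measurableSet_truncationGap).2 (ae_of_all _ fun x hx => ?_)
  rw [min_eq_right (one_le_pow₀ hx.2.le)]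
  exact hx.1

lemma levyIntegrand_pair_zero (θ : EuclideanSpace ℝ ι) (x : EuclideanSpace ℝ (ι ⊕ ι)) :
    levyIntegrand (pair 0 θ) x = levyIntegrand θ (lastBlock x) +
      (truncationGap ι).indicator (fun x => Complex.I * (inner ℝ θ (lastBlock x) : ℝ)) x := by
  classical
  have hle := norm_lastBlock_le x
  rw [levyIntegrand, levyIntegrand, inner_pair_zero, indicator_apply]
  by_cases hx : ‖x‖ ≤ 1
  · simp [truncationGap, hx, hle.trans hx]
  · by_cases hlast : ‖lastBlock x‖ ≤ 1
    · simp [truncationGap, hx, hlast, not_le.1 hx]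
    · simp [truncationGap, hx, hlast]

lemma integral_levyIntegrand_pair_zero (hζ : IsLevyMeasure ζ) (θ : EuclideanSpace ℝ ι) :
    ∫ x, levyIntegrand (pair 0 θ) x ∂ζ = ∫ y, levyIntegrand θ y ∂(lastBlockLevyMeasure ζ) +
      Complex.I * (inner ℝ (∫ x in truncationGap ι, lastBlock x ∂ζ) θ : ℝ) := by
  have hgap := integrableOn_lastBlock_truncationGap hζ
  have hind : Integrable ((truncationGap ι).indicator
      fun x => Complex.I * (inner ℝ θ (lastBlock x) : ℝ)) ζ :=
    (integrable_indicator_iff measurableSet_truncationGap).2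
      (((hgap.const_inner θ).ofReal (𝕜 := ℂ)).const_mul Complex.I)
  have hlast : Integrable (fun x => levyIntegrand θ (lastBlock x)) ζ :=
    ((hζ.integrable_levyIntegrand (pair 0 θ)).sub hind).congr
      (ae_of_all _ fun x => by simp [levyIntegrand_pair_zero])
  simp_rw [levyIntegrand_pair_zero]
  rw [integral_add hlast hind, integral_lastBlockLevyMeasure ζ
    (measurable_levyIntegrand θ).stronglyMeasurable (by simp [levyIntegrand]),
    integral_indicator measurableSet_truncationGap, integral_const_mul,
    integral_complex_ofReal, integral_inner hgap θ, real_inner_comm]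

lemma levyExponent_pair_zero (hζ : IsLevyMeasure ζ) (m₁ m₂ θ : EuclideanSpace ℝ ι)
    (D : Matrix ι ι ℝ) :
    levyExponent (pair m₁ m₂) (Matrix.fromBlocks 0 0 0 D) ζ (pair 0 θ) =
      levyExponent (m₂ + ∫ x in truncationGap ι, lastBlock x ∂ζ) D (lastBlockLevyMeasure ζ) θ := by
  rw [levyExponent_eq, levyExponent_eq, integral_levyIntegrand_pair_zero hζ,
    quadForm_fromBlocks_pair, inner_add_left, real_inner_comm (pair 0 θ) (pair m₁ m₂),
    inner_pair_zero, lastBlock_pair, real_inner_comm θ m₂]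
  push_cast
  ring

lemma charFun_map_lastBlock {Ω : Type*} [MeasurableSpace Ω] {P : Measure Ω}
    {Z : Ω → EuclideanSpace ℝ (ι ⊕ ι)} (hZ : Measurable Z) (θ : EuclideanSpace ℝ ι) :
    charFun (P.map fun ω => lastBlock (Z ω)) θ = charFun (P.map Z) (pair 0 θ) := by
  have hlast : Measurable fun ω => lastBlock (Z ω) := measurable_lastBlock.comp hZ
  rw [charFun_apply, charFun_apply, integral_map hZ.aemeasurable (by fun_prop),
    integral_map hlast.aemeasurable (by fun_prop)]
  simp_rw [real_inner_comm θ, real_inner_comm (pair 0 θ), inner_pair_zero]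

end LastBlock

section TimeMixture

variable {ι : Type*} [Fintype ι] {Ω : Type*} [MeasurableSpace Ω] {P : Measure Ω}
  {B : ℝ≥0 → Ω → EuclideanSpace ℝ ι} {τ : Measure (EuclideanSpace ℝ ι)}
  {ζ : Measure (EuclideanSpace ℝ (ι ⊕ ι))}

/-- `ζ(dt, dx) = P(B(t) ∈ dx) τ(dt)` on the punctured orthant: the Lévy measure of `(T, B ⊙ T)`
when `τ` is the Lévy measure of `T`. -/
def IsTimeMixture (P : Measure Ω) (B : ℝ≥0 → Ω → EuclideanSpace ℝ ι)
    (τ : Measure (EuclideanSpace ℝ ι)) (ζ : Measure (EuclideanSpace ℝ (ι ⊕ ι))) : Prop :=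
  ∀ A, MeasurableSet A → ζ A =
    ∫⁻ t in puncturedOrthant ι, P {ω | pair t (multiTime B t ω) ∈ A} ∂τ

namespace IsTimeMixture

lemma exists_eq_map_prod [IsProbabilityMeasure P] (hζ : IsTimeMixture P B τ ζ)
    (hB : IsLevyProcess P B) :
    ∃ Φ : EuclideanSpace ℝ ι × Ω → EuclideanSpace ℝ (ι ⊕ ι), Measurable Φ ∧
      (∀ᵐ ω ∂P, ∀ t, Φ (t, ω) = pair t (multiTime B t ω)) ∧
      ζ = ((τ.restrict (puncturedOrthant ι)).prod P).map Φ := by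
  obtain ⟨g, hg, hgB⟩ := hB.exists_measurable_multiTime
  have hΦ : Measurable fun p : EuclideanSpace ℝ ι × Ω => pair p.1 (g p) :=
    measurable_pair.comp (measurable_fst.prodMk hg)
  refine ⟨fun p => pair p.1 (g p), hΦ, ?_, ?_⟩
  · filter_upwards [hgB] with ω hω t
    rw [hω]
  · ext A hA
    rw [hζ A hA, Measure.map_apply hΦ hA, Measure.prod_apply (hΦ hA)]
    refine lintegral_congr fun t => measure_congr ?_
    filter_upwards [hgB] with ω hω
    refine propext ?_
    change pair t (multiTime B t ω) ∈ A ↔ pair t (g (t, ω)) ∈ A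
    rw [hω]

variable [IsProbabilityMeasure P]

lemma lintegral_eq (hζ : IsTimeMixture P B τ ζ) (hB : IsLevyProcess P B)
    {f : EuclideanSpace ℝ (ι ⊕ ι) → ℝ≥0∞} (hf : Measurable f) :
    ∫⁻ x, f x ∂ζ = ∫⁻ t in puncturedOrthant ι, ∫⁻ ω, f (pair t (multiTime B t ω)) ∂P ∂τ := by
  obtain ⟨Φ, hΦ, hae, rfl⟩ := hζ.exists_eq_map_prod hB
  rw [lintegral_map hf hΦ, lintegral_prod (fun p => f (Φ p)) (hf.comp hΦ).aemeasurable]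
  refine lintegral_congr fun t => lintegral_congr_ae ?_
  filter_upwards [hae] with ω hω
  rw [hω]

lemma integral_eq [SFinite τ] {F : Type*} [NormedAddCommGroup F] [NormedSpace ℝ F]
    (hζ : IsTimeMixture P B τ ζ) (hB : IsLevyProcess P B)
    {f : EuclideanSpace ℝ (ι ⊕ ι) → F} (hf : Integrable f ζ) :
    ∫ x, f x ∂ζ = ∫ t in puncturedOrthant ι, ∫ ω, f (pair t (multiTime B t ω)) ∂P ∂τ := by
  obtain ⟨Φ, hΦ, hae, rfl⟩ := hζ.exists_eq_map_prod hB
  rw [integral_map hΦ.aemeasurable hf.aestronglyMeasurable, integral_prod (fun p => f (Φ p))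
    ((integrable_map_measure hf.aestronglyMeasurable hΦ.aemeasurable).1 hf)]
  refine integral_congr_ae (ae_of_all _ fun t => integral_congr_ae ?_)
  filter_upwards [hae] with ω hω
  rw [hω]

end IsTimeMixture

theorem IsVGG.exists_isTimeMixture {Y : ℝ≥0 → Ω → EuclideanSpace ℝ ι}
    {d μ m : EuclideanSpace ℝ ι} {S Q : Matrix ι ι ℝ} {U υ : Measure (EuclideanSpace ℝ ι)}
    (hY : IsVGG.{w} P Y d μ S U) (hL : IsLevy P Y m Q υ) :
    ∃ (ΩB : Type w) (_ : MeasurableSpace ΩB) (PB : Measure ΩB)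
      (B : ℝ≥0 → ΩB → EuclideanSpace ℝ ι) (ζ : Measure (EuclideanSpace ℝ (ι ⊕ ι))),
      IsProbabilityMeasure PB ∧ IsBrownianMotion PB B μ S ∧ IsThorinMeasure U ∧
      IsTimeMixture PB B (thorinLevyMeasure U) ζ ∧ IsLevyMeasure ζ ∧
      m = weakMean₂ PB B μ d (thorinLevyMeasure U) + ∫ x in truncationGap ι, lastBlock x ∂ζ ∧
      (∀ a, quadForm Q a = quadForm (diamondMat d S) a) ∧ υ = lastBlockLevyMeasure ζ := by
  obtain ⟨-, ΩB, ΩT, ΩZ, iB, iT, iZ, PB, PT, PZ, B, T, Z, hPB, hPT, -, hT,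
    ⟨hB, d', τ, ⟨-, -, mT, QT, hLT, -, hd⟩, ζ, hζ, hLZ⟩, hid⟩ := hY
  obtain ⟨rfl, rfl⟩ := hT.triplet hLT
  obtain rfl : d' = d := by rwa [add_sub_cancel_right] at hd
  have hD (a : EuclideanSpace ℝ ι) : 0 ≤ quadForm (diamondMat d' S) a := by
    rw [← quadForm_fromBlocks_pair]
    exact quadForm_nonneg hLZ.covariance _
  have hchar (t : ℝ≥0) (θ : EuclideanSpace ℝ ι) : charFun (P.map (Y t)) θ =
      Complex.exp ((t : ℝ) * levyExponent (weakMean₂ PB B μ d' (thorinLevyMeasure U) +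
        ∫ x in truncationGap ι, lastBlock x ∂ζ) (diamondMat d' S) (lastBlockLevyMeasure ζ) θ) := by
    have hmap : P.map (Y t) = PZ.map fun ω => lastBlock (Z t ω) :=
      (hid.comp (measurable_pi_apply t)).map_eq
    rw [hmap, charFun_map_lastBlock (hLZ.isLevyProcess.measurable t), hLZ.charFun_eq,
      levyExponent_pair_zero hLZ.levyMeasure]
  exact ⟨ΩB, iB, PB, B, ζ, hPB, hB, hT.thorin, hζ, hLZ.levyMeasure,
    hL.triplet_unique hD (isLevyMeasure_lastBlockLevyMeasure hLZ.levyMeasure) hchar⟩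

end TimeMixture

section SmallJumps

variable {ι : Type*} [Fintype ι] {Ω : Type*} [MeasurableSpace Ω] {P : Measure Ω}
  [IsProbabilityMeasure P] {B : ℝ≥0 → Ω → EuclideanSpace ℝ ι} {μ : EuclideanSpace ℝ ι}
  {S : Matrix ι ι ℝ} {τ : Measure (EuclideanSpace ℝ ι)} {ζ : Measure (EuclideanSpace ℝ (ι ⊕ ι))}
  {q : ℝ}

lemma IsLevyMeasure.smallJumpsFinite {ν : Measure (EuclideanSpace ℝ ι)} (hν : IsLevyMeasure ν)
    {p : ℝ} (hp : 2 ≤ p) : SmallJumpsFinite ν p := by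
  refine lt_of_le_of_lt ?_ hν.2
  refine (setLIntegral_mono' measurableSet_puncturedBall fun x hx =>
    ENNReal.ofReal_le_ofReal ?_).trans (setLIntegral_le_lintegral _ _)
  have hle : ‖x‖ ≤ 1 := by simpa using hx.1
  rw [min_eq_left (pow_le_one₀ (norm_nonneg _) hle), ← Real.rpow_two]
  exact Real.rpow_le_rpow_of_exponent_ge (norm_pos_iff.2 hx.2) hle hp

lemma IsTimeMixture.lintegral_puncturedBall_lastBlock (hζ : IsTimeMixture P B τ ζ)
    (hB : IsLevyProcess P B) {p : ℝ} (hp : p ≠ 0) :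
    ∫⁻ y in puncturedBall ι, ENNReal.ofReal (‖y‖ ^ p) ∂(lastBlockLevyMeasure ζ) =
      ∫⁻ t in puncturedOrthant ι, ∫⁻ ω in {ω | ‖multiTime B t ω‖ ≤ 1},
        ENNReal.ofReal (‖multiTime B t ω‖ ^ p) ∂P ∂τ := by
  classical
  have hmeas : Measurable ((puncturedBall ι).indicator fun y => ENNReal.ofReal (‖y‖ ^ p)) :=
    Measurable.indicator (by fun_prop) measurableSet_puncturedBall
  rw [← lintegral_indicator measurableSet_puncturedBall, lintegral_lastBlockLevyMeasure ζ hmeas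
    (by simp [puncturedBall]), hζ.lintegral_eq hB (f := fun x => (puncturedBall ι).indicator
    (fun y => ENNReal.ofReal (‖y‖ ^ p)) (lastBlock x)) (hmeas.comp measurable_lastBlock)]
  refine lintegral_congr fun t => ?_
  rw [← lintegral_indicator (measurableSet_le (hB.measurable_multiTime t).norm measurable_const)]
  refine lintegral_congr fun ω => ?_
  by_cases h0 : multiTime B t ω = 0
  · simp [puncturedBall, h0, Real.zero_rpow hp]
  · simp [indicator_apply, puncturedBall, h0]

lemma IsBrownianMotion.setLIntegral_rpow_le (hB : IsBrownianMotion P B μ S) (hq0 : 0 ≤ q)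
    (hq1 : q ≤ 1) {t : EuclideanSpace ℝ ι} (ht : t ∈ puncturedOrthant ι) :
    ∫⁻ ω in {ω | ‖multiTime B t ω‖ ≤ 1}, ENNReal.ofReal (‖multiTime B t ω‖ ^ (2 * q)) ∂P ≤
      ENNReal.ofReal (1 + momentConst μ S) *
        (puncturedBall ι).indicator (fun x => ENNReal.ofReal (‖x‖ ^ q)) t +
      ENNReal.ofReal (min ‖t‖ 1) := by
  rcases le_or_gt ‖t‖ 1 with ht1 | ht1
  · rw [indicator_of_mem (show t ∈ puncturedBall ι from ⟨by simpa using ht1, ht.2⟩)]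
    exact le_add_right ((setLIntegral_le_lintegral _ _).trans (hB.lintegral_rpow_le hq0 hq1 ht ht1))
  · rw [min_eq_right ht1.le, ENNReal.ofReal_one]
    refine le_add_left ?_
    have hball : MeasurableSet {ω | ‖multiTime B t ω‖ ≤ 1} :=
      measurableSet_le (hB.isLevyProcess.measurable_multiTime t).norm measurable_const
    calc ∫⁻ ω in {ω | ‖multiTime B t ω‖ ≤ 1}, ENNReal.ofReal (‖multiTime B t ω‖ ^ (2 * q)) ∂P
        ≤ ∫⁻ _ in {ω | ‖multiTime B t ω‖ ≤ 1}, 1 ∂P :=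
          setLIntegral_mono' hball fun ω hω => ENNReal.ofReal_le_one.2
            (Real.rpow_le_one (norm_nonneg _) hω (by linarith))
      _ ≤ 1 := by rw [setLIntegral_one]; exact prob_le_one

lemma IsBrownianMotion.exists_le_setLIntegral_rpow (hB : IsBrownianMotion P B μ S)
    (hS : ∀ k, 0 < S k k) (hq : 0 ≤ q) :
    ∃ c > 0, ∃ C, ∀ t ∈ puncturedOrthant ι,
      ENNReal.ofReal c * (puncturedBall ι).indicator (fun x => ENNReal.ofReal (‖x‖ ^ q)) t ≤
        (∫⁻ ω in {ω | ‖multiTime B t ω‖ ≤ 1},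
          ENNReal.ofReal (‖multiTime B t ω‖ ^ (2 * q)) ∂P) +
        ENNReal.ofReal C * ENNReal.ofReal (min ‖t‖ 1) := by
  obtain ⟨δ, hδ, c, hc, -, hle⟩ := hB.exists_le_lintegral_rpow hS hq
  refine ⟨c, hc, c / δ, fun t ht => ?_⟩
  by_cases hmem : t ∈ puncturedBall ι
  · have ht1 : ‖t‖ ≤ 1 := by simpa using hmem.1
    rw [indicator_of_mem hmem]
    rcases le_or_gt ‖t‖ δ with htδ | htδ
    · exact le_add_right (hle t ht htδ)
    · refine le_add_left ?_
      rw [← ENNReal.ofReal_mul hc.le, ← ENNReal.ofReal_mul (by positivity), min_eq_left ht1]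
      refine ENNReal.ofReal_le_ofReal ?_
      calc c * ‖t‖ ^ q ≤ c * 1 := by gcongr; exact Real.rpow_le_one (norm_nonneg _) ht1 hq
        _ ≤ c * (‖t‖ / δ) := by gcongr; exact (one_le_div hδ).2 htδ.le
        _ = c / δ * ‖t‖ := by ring
  · simp [indicator_of_notMem hmem]

theorem IsTimeMixture.smallJumpsFinite_lastBlock (hζ : IsTimeMixture P B τ ζ)
    (hB : IsBrownianMotion P B μ S) (hlevy : IsLevyMeasure ζ)
    (hτ : Integrable (fun t => min ‖t‖ 1) τ) (hq : 0 < q) (h : SmallJumpsFinite τ q) :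
    SmallJumpsFinite (lastBlockLevyMeasure ζ) (2 * q) := by
  rcases le_total 1 q with hq1 | hq1
  · exact (isLevyMeasure_lastBlockLevyMeasure hlevy).smallJumpsFinite (by linarith)
  have hmin : ∫⁻ t, ENNReal.ofReal (min ‖t‖ 1) ∂τ < ∞ := hτ.lintegral_lt_top
  rw [SmallJumpsFinite, hζ.lintegral_puncturedBall_lastBlock hB.isLevyProcess (by positivity)]
  calc _ ≤ ∫⁻ t in puncturedOrthant ι, (ENNReal.ofReal (1 + momentConst μ S) *
          (puncturedBall ι).indicator (fun x => ENNReal.ofReal (‖x‖ ^ q)) t +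
          ENNReal.ofReal (min ‖t‖ 1)) ∂τ :=
        setLIntegral_mono' measurableSet_puncturedOrthant
          fun t ht => hB.setLIntegral_rpow_le hq.le hq1 ht
    _ ≤ ∫⁻ t, (ENNReal.ofReal (1 + momentConst μ S) *
          (puncturedBall ι).indicator (fun x => ENNReal.ofReal (‖x‖ ^ q)) t +
          ENNReal.ofReal (min ‖t‖ 1)) ∂τ := setLIntegral_le_lintegral _ _
    _ < ∞ := by
        rw [lintegral_add_right _ (by fun_prop), lintegral_const_mul' _ _ ENNReal.ofReal_ne_top,
          lintegral_indicator measurableSet_puncturedBall]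
        exact ENNReal.add_lt_top.2 ⟨ENNReal.mul_lt_top ENNReal.ofReal_lt_top h, hmin⟩

theorem IsTimeMixture.smallJumpsFinite_of_lastBlock (hζ : IsTimeMixture P B τ ζ)
    (hB : IsBrownianMotion P B μ S) (hS : ∀ k, 0 < S k k) (hτ₀ : ∀ᵐ t ∂τ, t ∈ puncturedOrthant ι)
    (hτ : Integrable (fun t => min ‖t‖ 1) τ) (hq : 0 < q)
    (h : SmallJumpsFinite (lastBlockLevyMeasure ζ) (2 * q)) : SmallJumpsFinite τ q := by
  have hmin : ∫⁻ t, ENNReal.ofReal (min ‖t‖ 1) ∂τ < ∞ := hτ.lintegral_lt_top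
  rw [SmallJumpsFinite, hζ.lintegral_puncturedBall_lastBlock hB.isLevyProcess (by positivity),
    Measure.restrict_eq_self_of_ae_mem hτ₀] at h
  obtain ⟨c, hc, C, hle⟩ := hB.exists_le_setLIntegral_rpow hS hq.le
  have hlt : ENNReal.ofReal c *
      ∫⁻ t in puncturedBall ι, ENNReal.ofReal (‖t‖ ^ q) ∂τ < ∞ := by
    rw [← lintegral_indicator measurableSet_puncturedBall,
      ← lintegral_const_mul' _ _ ENNReal.ofReal_ne_top]
    refine lt_of_le_of_lt (lintegral_mono_ae (hτ₀.mono hle)) ?_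
    rw [lintegral_add_right _ (by fun_prop), lintegral_const_mul' _ _ ENNReal.ofReal_ne_top]
    exact ENNReal.add_lt_top.2 ⟨h, ENNReal.mul_lt_top ENNReal.ofReal_lt_top hmin⟩
  exact ENNReal.lt_top_of_mul_ne_top_right hlt.ne (ENNReal.ofReal_pos.2 hc).ne'

end SmallJumps

section CoordinateProcesses

variable {ι : Type*} [Fintype ι] {Ω : Type*} [MeasurableSpace Ω] {P : Measure Ω}
  {X : ℝ≥0 → Ω → EuclideanSpace ℝ ι} {b m : EuclideanSpace ℝ ι} {Q : Matrix ι ι ℝ}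
  {ν : Measure (EuclideanSpace ℝ ι)}

lemma min_abs_coord_le (x : EuclideanSpace ℝ ι) (k : ι) : min |x k| 1 ≤ min ‖x‖ 1 :=
  min_le_min_right 1 (PiLp.norm_apply_le x k)

lemma min_sum_one_le {κ : Type*} (s : Finset κ) {a : κ → ℝ} (ha : ∀ k, 0 ≤ a k) :
    min (∑ k ∈ s, a k) 1 ≤ ∑ k ∈ s, min (a k) 1 := by
  by_cases h : ∃ k ∈ s, 1 ≤ a k
  · obtain ⟨k, hk, h1⟩ := h
    calc min (∑ k ∈ s, a k) 1 ≤ 1 := min_le_right _ _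
      _ = min (a k) 1 := (min_eq_right h1).symm
      _ ≤ ∑ k ∈ s, min (a k) 1 := Finset.single_le_sum (f := fun k => min (a k) 1)
        (fun k _ => le_min (ha k) zero_le_one) hk
  · push Not at h
    refine (min_le_left _ _).trans (Finset.sum_le_sum fun k hk => ?_)
    rw [min_eq_left (h k hk).le]

lemma integrable_min_norm_of_coord (h : ∀ k, Integrable (fun x => min |x k| 1) ν) :
    Integrable (fun x => min ‖x‖ 1) ν := by
  refine Integrable.mono' (integrable_finsetSum Finset.univ fun k _ => h k) (by fun_prop)
    (ae_of_all _ fun x => ?_)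
  rw [Real.norm_eq_abs, abs_of_nonneg (by positivity)]
  exact (min_le_min_right 1 (norm_le_sum_abs x)).trans (min_sum_one_le _ fun k => abs_nonneg _)

lemma IsLevyProcess.measurable_coord (hX : IsLevyProcess P X) (k : ι) (t : ℝ≥0) :
    Measurable fun ω => X t ω k := by
  have := hX.measurable t
  fun_prop

lemma IsLevyProcess.hasIndepIncrements_coord (hX : IsLevyProcess P X) (k : ι) :
    HasIndepIncrements (fun t ω => X t ω k) P := fun n t ht =>
  (hX.indep n t ht).comp (fun _ x => x k) (fun _ => by fun_prop)

lemma IsLevyProcess.identDistrib_coord (hX : IsLevyProcess P X) (k : ι) (s t : ℝ≥0) :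
    IdentDistrib (fun ω => X (s + t) ω k - X s ω k) (fun ω => X t ω k) P P :=
  (hX.stationary s t).comp (u := fun x : EuclideanSpace ℝ ι => x k) (by fun_prop)

lemma IsLevy.charFun_coord_eq_fvExponent
    (hL : IsLevy P X (b + ∫ x in puncturedBall ι, x ∂ν) Q ν)
    (hQ : ∀ a, quadForm Q a = 0) (hint : IntegrableOn (fun x => x) (puncturedBall ι) ν)
    (k : ι) (h : ℝ≥0) (s : ℝ) :
    charFun (P.map fun ω => X h ω k) s =
      Complex.exp ((h : ℝ) * fvExponent (b k) (ν.map fun x => x k) s) := by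
  classical
  have hk : Measurable fun x : EuclideanSpace ℝ ι => x k := by fun_prop
  rw [charFun_map_coord (hL.isLevyProcess.measurable h), hL.charFun_eq, fvExponent,
    integral_map hk.aemeasurable (by fun_prop),
    levyExponent_add_integral_puncturedBall hL.levyMeasure hint, hQ]
  simp [EuclideanSpace.inner_single_left, EuclideanSpace.inner_single_right, mul_comm (s : ℂ) (b k)]

theorem IsLevy.hasFiniteVariationPaths [IsProbabilityMeasure P]
    (hL : IsLevy P X (b + ∫ x in puncturedBall ι, x ∂ν) Q ν)
    (hQ : ∀ a, quadForm Q a = 0) (hν : Integrable (fun x => min ‖x‖ 1) ν) :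
    HasFiniteVariationPaths P X := by
  classical
  have := hL.levyMeasure.sFinite
  have hcoord (k : ι) : Integrable (fun r => min |r| 1) (ν.map fun x => x k) := by
    rw [integrable_map_measure (by fun_prop) (by fun_prop)]
    refine Integrable.mono' hν (by fun_prop) (ae_of_all _ fun x => ?_)
    rw [Function.comp_apply, Real.norm_eq_abs, abs_of_nonneg (by positivity)]
    exact min_abs_coord_le x k
  have hgrid (k : ι) (N : ℕ) : ∀ᵐ ω ∂P, BddAbove (range (gridSum (fun t => X t ω k) N)) :=
    ae_bddAbove_gridSum (X := fun t ω => X t ω k) (hcoord k)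
      (hL.isLevyProcess.measurable_coord k) (hL.isLevyProcess.identDistrib_coord k)
      (hL.charFun_coord_eq_fvExponent hQ (integrableOn_puncturedBall_of_integrable_min hν) k) N
  filter_upwards [hL.isLevyProcess.cadlag, ae_all_iff.2 fun k => ae_all_iff.2 (hgrid k)]
    with ω hω hb
  refine locallyBoundedVariationOn_of_bddAbove_gridSum (fun t => (hω t).1) fun N => ?_
  choose C hC using fun k => hb k N
  refine ⟨∑ k, C k, ?_⟩
  rintro _ ⟨j, rfl⟩
  exact (gridSum_le_sum_coord _ N j).trans (Finset.sum_le_sum fun k _ => hC k ⟨j, rfl⟩)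

lemma IsLevy.lintegral_neg_re_levyExponent_single_lt_top [IsProbabilityMeasure P]
    (hL : IsLevy P X m Q ν) (hfv : HasFiniteVariationPaths P X) (k : ι) :
    ∫⁻ s, ENNReal.ofReal (1 / 2 * (Q k k * s ^ 2) + ∫ x, (1 - Real.cos (s * x k)) ∂ν)
      ∂(cauchyMeasure 0 1) < ∞ := by
  classical
  have hgrid : ∀ᵐ ω ∂P, BddAbove (range (gridSum (fun t => X t ω k) 1)) := by
    filter_upwards [hfv] with ω hω
    obtain ⟨C, hC⟩ := bddAbove_gridSum hω 1
    refine ⟨C, ?_⟩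
    rintro _ ⟨j, rfl⟩
    exact (gridSum_coord_le (fun t => X t ω) k 1 j).trans (hC ⟨j, rfl⟩)
  have hlt := lintegral_neg_re_exponent_lt_top (X := fun t ω => X t ω k)
    (ψ := fun s => levyExponent m Q ν (EuclideanSpace.single k s))
    (hL.isLevyProcess.measurable_coord k) (hL.isLevyProcess.hasIndepIncrements_coord k)
    (hL.isLevyProcess.identDistrib_coord k) hgrid fun h s => by
      rw [charFun_map_coord (hL.isLevyProcess.measurable h), hL.charFun_eq]
  simpa only [hL.levyMeasure.neg_re_levyExponent, quadForm_single,
    EuclideanSpace.inner_single_left, conj_trivial] using hlt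

theorem IsLevy.diag_eq_zero_of_hasFiniteVariationPaths [IsProbabilityMeasure P]
    (hL : IsLevy P X m Q ν) (hfv : HasFiniteVariationPaths P X) (k : ι) : Q k k = 0 := by
  classical
  by_contra hne
  have hpos : 0 < Q k k := lt_of_le_of_ne hL.covariance.diag_nonneg (Ne.symm hne)
  refine absurd (hL.lintegral_neg_re_levyExponent_single_lt_top hfv k) (not_lt.2 ?_)
  calc ∞ = ENNReal.ofReal (1 / 2 * Q k k) *
        ∫⁻ s, ENNReal.ofReal (s ^ 2) ∂(cauchyMeasure 0 1) := by
        rw [lintegral_sq_cauchyMeasure, ENNReal.mul_top (ENNReal.ofReal_pos.2 (by positivity)).ne']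
    _ = ∫⁻ s, ENNReal.ofReal (1 / 2 * Q k k) * ENNReal.ofReal (s ^ 2) ∂(cauchyMeasure 0 1) :=
        (lintegral_const_mul' _ _ ENNReal.ofReal_ne_top).symm
    _ ≤ _ := lintegral_mono fun s => by
        have hcos : 0 ≤ ∫ x, (1 - Real.cos (s * x k)) ∂ν :=
          integral_nonneg fun x => one_sub_cos_nonneg _
        rw [← ENNReal.ofReal_mul (by positivity)]
        exact ENNReal.ofReal_le_ofReal (by linarith)

lemma IsLevy.lintegral_one_sub_exp_neg_coord_lt_top [IsProbabilityMeasure P]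
    (hL : IsLevy P X m Q ν) (hfv : HasFiniteVariationPaths P X) (k : ι) :
    ∫⁻ x, ENNReal.ofReal (1 - Real.exp (-|x k|)) ∂ν < ∞ := by
  classical
  have := hL.levyMeasure.sFinite
  have hk : Measurable fun x : EuclideanSpace ℝ ι => x k := by fun_prop
  calc ∫⁻ x, ENNReal.ofReal (1 - Real.exp (-|x k|)) ∂ν
      = ∫⁻ s, ∫⁻ x, ENNReal.ofReal (1 - Real.cos (s * x k)) ∂ν ∂(cauchyMeasure 0 1) := by
        have hexp : Measurable fun r : ℝ => ENNReal.ofReal (1 - Real.exp (-|r|)) := by fun_prop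
        have hcos (s : ℝ) : Measurable fun r : ℝ => ENNReal.ofReal (1 - Real.cos (s * r)) := by
          fun_prop
        have h := lintegral_lintegral_one_sub_cos (ν.map fun x => x k) zero_le_one
        simp only [one_mul, lintegral_map hexp hk, lintegral_map (hcos _) hk] at h
        exact h.symm
    _ ≤ ∫⁻ s, ENNReal.ofReal (1 / 2 * (Q k k * s ^ 2) + ∫ x, (1 - Real.cos (s * x k)) ∂ν)
          ∂(cauchyMeasure 0 1) := lintegral_mono fun s => by
        have hcos : Integrable (fun x => 1 - Real.cos (s * x k)) ν := by
          simpa [EuclideanSpace.inner_single_left] using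
            hL.levyMeasure.integrable_one_sub_cos (EuclideanSpace.single k s)
        have hQ : 0 ≤ Q k k := hL.covariance.diag_nonneg
        rw [← ofReal_integral_eq_lintegral_ofReal hcos (ae_of_all _ fun x => one_sub_cos_nonneg _)]
        exact ENNReal.ofReal_le_ofReal (le_add_of_nonneg_left (by positivity))
    _ < ∞ := hL.lintegral_neg_re_levyExponent_single_lt_top hfv k

theorem IsLevy.integrable_min_norm_of_hasFiniteVariationPaths [IsProbabilityMeasure P]
    (hL : IsLevy P X m Q ν) (hfv : HasFiniteVariationPaths P X) :
    Integrable (fun x => min ‖x‖ 1) ν := by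
  refine integrable_min_norm_of_coord fun k => ?_
  have hexp : Integrable (fun x : EuclideanSpace ℝ ι => 1 - Real.exp (-|x k|)) ν :=
    ⟨by fun_prop, (hasFiniteIntegral_iff_ofReal
      (ae_of_all _ fun x => one_sub_exp_neg_nonneg (abs_nonneg _))).2
      (hL.lintegral_one_sub_exp_neg_coord_lt_top hfv k)⟩
  refine Integrable.mono' (hexp.const_mul 2) (by fun_prop) (ae_of_all _ fun x => ?_)
  rw [Real.norm_eq_abs, abs_of_nonneg (by positivity)]
  exact min_one_le_two_mul_one_sub_exp (abs_nonneg _)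

end CoordinateProcesses

section FiniteVariation

variable {ι : Type*} [Fintype ι]

lemma IsLevyMeasure.integrable_min_norm {ν : Measure (EuclideanSpace ℝ ι)} (hν : IsLevyMeasure ν)
    (h : SmallJumpsFinite ν 1) : Integrable (fun x => min ‖x‖ 1) ν := by
  have hle (x : EuclideanSpace ℝ ι) : ENNReal.ofReal (min ‖x‖ 1) ≤
      (puncturedBall ι).indicator (fun x => ENNReal.ofReal (‖x‖ ^ (1 : ℝ))) x +
        ENNReal.ofReal (min (‖x‖ ^ 2) 1) := by
    by_cases hx : x ∈ puncturedBall ι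
    · rw [indicator_of_mem hx, Real.rpow_one]
      exact le_add_right (ENNReal.ofReal_le_ofReal (min_le_left _ _))
    · refine le_add_left (ENNReal.ofReal_le_ofReal ?_)
      rcases eq_or_ne x 0 with rfl | h0
      · simp
      · have h1 : 1 < ‖x‖ := by
          by_contra! h1
          exact hx ⟨by simpa using h1, h0⟩
        rw [min_eq_right h1.le, min_eq_right (one_le_pow₀ h1.le)]
  refine ⟨by fun_prop, (hasFiniteIntegral_iff_ofReal (ae_of_all _ fun x => by positivity)).2 ?_⟩
  refine lt_of_le_of_lt (lintegral_mono hle) ?_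
  rw [lintegral_add_right _ (by fun_prop), lintegral_indicator measurableSet_puncturedBall]
  exact ENNReal.add_lt_top.2 ⟨h, hν.2⟩

lemma smallJumpsFinite_one_of_integrable {ν : Measure (EuclideanSpace ℝ ι)}
    (h : Integrable (fun x => min ‖x‖ 1) ν) : SmallJumpsFinite ν 1 := by
  have hball := (integrableOn_puncturedBall_of_integrable_min h).2
  simpa [SmallJumpsFinite, HasFiniteIntegral, ← ofReal_norm] using hball

lemma indicator_closedBall_add_indicator_truncationGap (x : EuclideanSpace ℝ (ι ⊕ ι)) :
    (Metric.closedBall 0 1).indicator lastBlock x + (truncationGap ι).indicator lastBlock x =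
      (puncturedBall ι).indicator (fun y => y) (lastBlock x) := by
  classical
  have hle := norm_lastBlock_le x
  simp only [indicator_apply, truncationGap, puncturedBall, Set.mem_sdiff,
    mem_closedBall_zero_iff, mem_singleton_iff, mem_ofPred_eq]
  by_cases h0 : lastBlock x = 0
  · simp [h0]
  · by_cases hx : ‖x‖ ≤ 1
    · simp [hx, hle.trans hx, h0]
    · simp [hx, not_le.1 hx, h0]

variable {Ω : Type*} [MeasurableSpace Ω] {P : Measure Ω} [IsProbabilityMeasure P]
  {B : ℝ≥0 → Ω → EuclideanSpace ℝ ι} {τ : Measure (EuclideanSpace ℝ ι)} [SFinite τ]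
  {ζ : Measure (EuclideanSpace ℝ (ι ⊕ ι))}

lemma integrableOn_lastBlock_closedBall
    (hint : Integrable (fun y => min ‖y‖ 1) (lastBlockLevyMeasure ζ)) :
    IntegrableOn lastBlock (Metric.closedBall 0 1) ζ := by
  have hmin : Integrable (fun x => min ‖lastBlock x‖ 1) ζ := by
    refine ⟨by fun_prop, (hasFiniteIntegral_iff_ofReal (ae_of_all _ fun x => by positivity)).2 ?_⟩
    rw [← lintegral_lastBlockLevyMeasure ζ (f := fun y => ENNReal.ofReal (min ‖y‖ 1))
      (by fun_prop) (by simp)]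
    exact (hasFiniteIntegral_iff_ofReal (ae_of_all _ fun x => by positivity)).1 hint.2
  refine Integrable.mono' hmin.integrableOn measurable_lastBlock.aestronglyMeasurable ?_
  refine (ae_restrict_iff' Metric.isClosed_closedBall.measurableSet).2 (ae_of_all _ fun x hx => ?_)
  rw [min_eq_left ((norm_lastBlock_le x).trans (mem_closedBall_zero_iff.1 hx))]

lemma IsTimeMixture.weakMean₂_eq (hζ : IsTimeMixture P B τ ζ) (hB : IsLevyProcess P B)
    (hint : IntegrableOn lastBlock (Metric.closedBall 0 1) ζ) (μ d : EuclideanSpace ℝ ι) :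
    weakMean₂ P B μ d τ =
      diamondVec d μ + ∫ x in Metric.closedBall 0 1, lastBlock x ∂ζ := by
  have hball : MeasurableSet (Metric.closedBall (0 : EuclideanSpace ℝ (ι ⊕ ι)) 1) :=
    Metric.isClosed_closedBall.measurableSet
  rw [weakMean₂, ← integral_indicator hball,
    hζ.integral_eq hB ((integrable_indicator_iff hball).2 hint)]
  congr 1
  refine integral_congr_ae (ae_of_all _ fun t => ?_)
  have hpair : Measurable fun ω => pair t (multiTime B t ω) :=
    measurable_pair.comp (measurable_const.prodMk (hB.measurable_multiTime t))
  simp only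
  rw [← integral_indicator (measurableSet_le hpair.norm measurable_const)]
  refine integral_congr_ae (ae_of_all _ fun ω => ?_)
  classical
  simp [indicator_apply]

lemma IsTimeMixture.weakMean₂_add_integral_truncationGap (hζ : IsTimeMixture P B τ ζ)
    (hB : IsLevyProcess P B) (hlevy : IsLevyMeasure ζ)
    (hint : Integrable (fun y => min ‖y‖ 1) (lastBlockLevyMeasure ζ))
    (μ d : EuclideanSpace ℝ ι) :
    weakMean₂ P B μ d τ + ∫ x in truncationGap ι, lastBlock x ∂ζ =
      diamondVec d μ + ∫ y in puncturedBall ι, y ∂(lastBlockLevyMeasure ζ) := by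
  have hclosed := integrableOn_lastBlock_closedBall hint
  have hball : MeasurableSet (Metric.closedBall (0 : EuclideanSpace ℝ (ι ⊕ ι)) 1) :=
    Metric.isClosed_closedBall.measurableSet
  rw [hζ.weakMean₂_eq hB hclosed, add_assoc, ← integral_indicator hball,
    ← integral_indicator measurableSet_truncationGap,
    ← integral_add ((integrable_indicator_iff hball).2 hclosed)
      ((integrable_indicator_iff measurableSet_truncationGap).2
        (integrableOn_lastBlock_truncationGap hlevy)),
    ← integral_indicator measurableSet_puncturedBall, integral_lastBlockLevyMeasure ζ
      (measurable_id'.indicator measurableSet_puncturedBall).stronglyMeasurable (by simp)]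
  simp_rw [indicator_closedBall_add_indicator_truncationGap]

end FiniteVariation

section VarianceGammaGamma

variable {ι : Type*} [Fintype ι] {Ω : Type*} [MeasurableSpace Ω] {P : Measure Ω}
  {Y : ℝ≥0 → Ω → EuclideanSpace ℝ ι}
  {d μ : EuclideanSpace ℝ ι} {S : Matrix ι ι ℝ} {U υ : Measure (EuclideanSpace ℝ ι)} {q : ℝ}

lemma IsVGG.posSemidef (hY : IsVGG.{w} P Y d μ S U) : S.PosSemidef := by
  obtain ⟨-, ΩB, ΩT, ΩZ, _, _, _, PB, PT, PZ, B, T, Z, -, -, -, -, ⟨hB, -⟩, -⟩ := hY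
  exact hB.covariance

theorem IsVGG.smallJumpsFinite (hY : IsVGG.{w} P Y d μ S U) (hυ : HasLevyMeasure P Y υ)
    (hq : 0 < q) (hU : ThorinTailFinite U q) : SmallJumpsFinite υ (2 * q) := by
  obtain ⟨m, Q, hL⟩ := hυ
  obtain ⟨ΩB, _, PB, B, ζ, _, hB, hThorin, hζ, hlevy, -, -, rfl⟩ := hY.exists_isTimeMixture hL
  exact hζ.smallJumpsFinite_lastBlock hB hlevy (integrable_min_norm_thorinLevyMeasure hThorin) hq
    ((thorinTailFinite_iff hThorin hq).1 hU)

theorem IsVGG.thorinTailFinite (hY : IsVGG.{w} P Y d μ S U) (hυ : HasLevyMeasure P Y υ)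
    (hS : ∀ k, 0 < S k k) (hq : 0 < q) (h : SmallJumpsFinite υ (2 * q)) :
    ThorinTailFinite U q := by
  obtain ⟨m, Q, hL⟩ := hυ
  obtain ⟨ΩB, _, PB, B, ζ, _, hB, hThorin, hζ, -, -, -, rfl⟩ := hY.exists_isTimeMixture hL
  exact (thorinTailFinite_iff hThorin hq).2 (hζ.smallJumpsFinite_of_lastBlock hB hS
    (ae_thorinLevyMeasure_mem hThorin) (integrable_min_norm_thorinLevyMeasure hThorin) hq h)

theorem IsVGG.isFV [IsProbabilityMeasure P] (hY : IsVGG.{w} P Y d μ S U) (hυ : HasLevyMeasure P Y υ)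
    (hd : diamondMat d S = 0) (hU : ThorinTailFinite U (1 / 2)) :
    IsFV P Y (diamondVec d μ) υ := by
  have hsmall : SmallJumpsFinite υ 1 := by
    simpa using hY.smallJumpsFinite hυ one_half_pos hU
  obtain ⟨m, Q, hL⟩ := hυ
  have hint := hL.levyMeasure.integrable_min_norm hsmall
  obtain ⟨ΩB, _, PB, B, ζ, _, hB, hThorin, hζ, hlevy, hm, hQ, rfl⟩ :=
    hY.exists_isTimeMixture hL
  have := (isLevyMeasure_thorinLevyMeasure hThorin).sFinite
  rw [hζ.weakMean₂_add_integral_truncationGap hB.isLevyProcess hlevy hint] at hm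
  have hQ0 (a : EuclideanSpace ℝ ι) : quadForm Q a = 0 := by rw [hQ, hd, quadForm_zero]
  exact ⟨(hm ▸ hL).hasFiniteVariationPaths hQ0 hint, m, Q, hL,
    integrableOn_puncturedBall_of_integrable_min hint, by rw [hm, add_sub_cancel_right]⟩

theorem IsVGG.drift_eq_zero [IsProbabilityMeasure P] (hY : IsVGG.{w} P Y d μ S U)
    (hυ : HasLevyMeasure P Y υ) (hS : ∀ k, 0 < S k k)
    (hfv : HasFiniteVariationPaths P Y) : d = 0 := by
  classical
  obtain ⟨m, Q, hL⟩ := hυ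
  obtain ⟨ΩB, _, PB, B, ζ, -, -, -, -, -, -, hQ, -⟩ := hY.exists_isTimeMixture hL
  ext k
  have h := hQ (EuclideanSpace.single k 1)
  rw [quadForm_single, quadForm_single, hL.diag_eq_zero_of_hasFiniteVariationPaths hfv k] at h
  simpa [diamondMat, (hS k).ne'] using h

theorem IsVGG.thorinTailFinite_half [IsProbabilityMeasure P] (hY : IsVGG.{w} P Y d μ S U)
    (hυ : HasLevyMeasure P Y υ) (hS : ∀ k, 0 < S k k)
    (hfv : HasFiniteVariationPaths P Y) : ThorinTailFinite U (1 / 2) := by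
  refine hY.thorinTailFinite hυ hS one_half_pos ?_
  obtain ⟨m, Q, hL⟩ := hυ
  simpa using smallJumpsFinite_one_of_integrable
    (hL.integrable_min_norm_of_hasFiniteVariationPaths hfv)

end VarianceGammaGamma

end WeakSub

end

theorem proposition4p2_general {ι : Type*} [Fintype ι]
    {ΩT : Type*} [MeasurableSpace ΩT] (PT : Measure ΩT) [IsProbabilityMeasure PT]
    {ΩY : Type*} [MeasurableSpace ΩY] (PY : Measure ΩY) [IsProbabilityMeasure PY]
    (T : ℝ≥0 → ΩT → EuclideanSpace ℝ ι) (Y : ℝ≥0 → ΩY → EuclideanSpace ℝ ι)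
    (d μ : EuclideanSpace ℝ ι) (S : Matrix ι ι ℝ) (U τ υ : Measure (EuclideanSpace ℝ ι))
    (hT : WeakSub.IsThorinSubordinator PT T d U) (hY : WeakSub.IsVGG.{w} PY Y d μ S U)
    (hτ : WeakSub.HasLevyMeasure PT T τ) (hυ : WeakSub.HasLevyMeasure PY Y υ) :
    (∀ q : ℝ, 0 < q → (WeakSub.ThorinTailFinite U q ↔ WeakSub.SmallJumpsFinite τ q)) ∧
    (∀ q : ℝ, 0 < q →
      (WeakSub.ThorinTailFinite U q → WeakSub.SmallJumpsFinite υ (2 * q)) ∧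
      ((∀ k, 0 < S k k) → WeakSub.SmallJumpsFinite υ (2 * q) → WeakSub.ThorinTailFinite U q)) ∧
    ((WeakSub.diamondMat d S = 0 → WeakSub.ThorinTailFinite U (1 / 2) →
        WeakSub.IsFV PY Y (WeakSub.diamondVec d μ) υ) ∧
      ((∀ k, 0 < S k k) → WeakSub.HasFiniteVariationPaths PY Y →
        d = 0 ∧ WeakSub.ThorinTailFinite U (1 / 2))) := by
  refine ⟨fun q hq => ?_,
    fun q hq => ⟨hY.smallJumpsFinite hυ hq, fun hS => hY.thorinTailFinite hυ hS hq⟩,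
    hY.isFV hυ, fun hS hfv => ⟨hY.drift_eq_zero hυ hS hfv, hY.thorinTailFinite_half hυ hS hfv⟩⟩
  obtain ⟨mT, QT, hLT⟩ := hτ
  rw [(hT.triplet hLT).1]
  exact WeakSub.thorinTailFinite_iff hT.thorin hq

theorem proposition4p2 {n : ℕ}
    {ΩT : Type*} [MeasurableSpace ΩT] (PT : Measure ΩT) [IsProbabilityMeasure PT]
    {ΩY : Type*} [MeasurableSpace ΩY] (PY : Measure ΩY) [IsProbabilityMeasure PY]
    (T : ℝ≥0 → ΩT → EuclideanSpace ℝ (Fin n)) (Y : ℝ≥0 → ΩY → EuclideanSpace ℝ (Fin n))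
    (d μ : EuclideanSpace ℝ (Fin n)) (S : Matrix (Fin n) (Fin n) ℝ)
    (U τ υ : Measure (EuclideanSpace ℝ (Fin n)))
    (hT : WeakSub.IsThorinSubordinator PT T d U)
    (hY : WeakSub.IsVGG.{w} PY Y d μ S U)
    (hτ : WeakSub.HasLevyMeasure PT T τ)
    (hυ : WeakSub.HasLevyMeasure PY Y υ) :
    (∀ q : ℝ, 0 < q → q < 1 →
      (WeakSub.ThorinTailFinite U q ↔ WeakSub.SmallJumpsFinite τ q)) ∧
    (∀ q : ℝ, 0 < q → q < 1 →
      (WeakSub.ThorinTailFinite U q → WeakSub.SmallJumpsFinite υ (2 * q)) ∧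
      (IsUnit S → WeakSub.SmallJumpsFinite υ (2 * q) → WeakSub.ThorinTailFinite U q)) ∧
    ((d = 0 → WeakSub.ThorinTailFinite U (1 / 2) → WeakSub.IsFV PY Y 0 υ) ∧
      (IsUnit S → WeakSub.HasFiniteVariationPaths PY Y →
        d = 0 ∧ WeakSub.ThorinTailFinite U (1 / 2))) := by
  obtain ⟨hi, hii, hfv, hfv'⟩ := proposition4p2_general PT PY T Y d μ S U τ υ hT hY hτ hυ
  have hdiag (hS : IsUnit S) (k : Fin n) : 0 < S k k :=
    WeakSub.posSemidef_diag_pos hY.posSemidef hS k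
  refine ⟨fun q hq _ => hi q hq,
    fun q hq _ => ⟨(hii q hq).1, fun hS => (hii q hq).2 (hdiag hS)⟩, ?_, fun hS => hfv' (hdiag hS)⟩
  rintro rfl hU
  have hdrift : WeakSub.diamondVec 0 μ = 0 := by ext; simp [WeakSub.diamondVec]
  exact hdrift ▸ hfv (by ext; simp [WeakSub.diamondMat]) hU
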